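/- Let $n\ge 3$, let $(M,g)$ be a smooth $n$-dimensional pseudo-Riemannian manifold with Levi-Civita connection $\nabla$, and suppose that $g$ is a null Ricci Walker metric: there is a smooth distribution $\mathcal N\subset TM$ of rank $p>0$ which is totally null, parallel with respect to $\nabla$, and contains the image of the Schouten tensor $\mathsf P=\frac1{n-2}\bigl(Ric-\frac{Scal}{2(n-1)}g\bigr)$ (as an endomorphism of $TM$). Let $\epsilon>0$ and let $h=h(\rho)$, $\rho\in(-\epsilon,\epsilon)$, be a family of symmetric $(0,2)$-tensor fields on $M$, smooth jointly in $x$ and $\rho$, with $h(0)=0$, $\mathrm{div}^g\,h(\rho)=0$ and $\mathrm{Im}(h(\rho)^\sharp)\subset\mathcal N$ for all $\rho$, where $g(h^\sharp X,Y)=h(X,Y)$. Put $m=\infty$ if $n$ is odd and $m=\frac{n-2}{2}$ if $n$ is even, and on $(0,\infty)\times M\times(-\epsilon,\epsilon)$ with coordinates $(t,x^i,\rho)$ consider $$\widetilde g=2\,dt\,d(\rho t)+t^2\bigl(g+h(\rho)\bigr).$$ Consider the equation $$\rho\,\ddot h_{ij}-\tfrac{n-2}{2}\dot h_{ij}-\tfrac12\Box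 h_{ij}+R_{kijl}h^{kl}+R_{ij}+\tfrac12\bigl(h^{kl}\nabla_k\nabla_l h_{ij}-\nabla_k h_{li}\nabla^l h^k{}_j\bigr)=O(\rho^m),\qquad (*)$$ where dots are $\rho$-derivatives, $\Box=\nabla^k\nabla_k$, all operations (including raising of indices) are taken with respect to $g$, and the curvature conventions are $(\nabla_i\nabla_j-\nabla_j\nabla_i)v_k=R_{ijk}{}^l v_l$, $R_{ijkl}=R_{ijk}{}^m g_{ml}$, $R_{ij}=R_{ikj}{}^k$. Then: 1. $\widetilde g$ is an ambient metric for $[g]$ in normal form with respect to $g$ if and only if $h$ satisfies $(*)$. Here "ambient metric" means that $\widetilde g$ is a nondegenerate metric with $(g+h)|_{\rho=0}=g$ and $Ric(\widetilde g)=O(\rho^m)$, and that in addition $\mathrm{tr}_g\bigl(\rho^{1-n/2}Ric(\widetilde g)|_{TM\otimes TM}\bigr)=0$ along $\rho=0$ if $n$ is even. 2. $Ric(\widetilde g)=O(\rho^m)$ if and only if $h$ satisfies $(*)$. -/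

import Mathlib

open Set Filter Topology
open scoped Manifold ContDiff

noncomputable section

namespace AmbientWalker

/-! ### Local pseudo-Riemannian geometry in coordinates

`ι` is the index set of a coordinate system; `G` is the matrix of components of a metric and
`T` the matrix of components of a symmetric `(0,2)`-tensor, as functions of the coordinates. -/

section Local

variable {ι : Type*} [Fintype ι] [DecidableEq ι]

/-- The partial derivative `∂_i f` at `x`. -/
def pd (i : ι) (f : EuclideanSpace ℝ ι → ℝ) (x : EuclideanSpace ℝ ι) : ℝ :=
  fderiv ℝ f x (EuclideanSpace.single i 1)

/-- The Christoffel symbol `Γ^k_{ij}` of the Levi-Civita connection of `G`. -/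
def christoffel (G : EuclideanSpace ℝ ι → Matrix ι ι ℝ) (k i j : ι)
    (x : EuclideanSpace ℝ ι) : ℝ :=
  (1 / 2) * ∑ l, (G x)⁻¹ k l *
    (pd i (fun y => G y j l) x + pd j (fun y => G y i l) x - pd l (fun y => G y i j) x)

/-- The curvature `R_{ijk}^l`, with the convention
`(∇_i ∇_j - ∇_j ∇_i) v_k = R_{ijk}^l v_l`. -/
def curvature (G : EuclideanSpace ℝ ι → Matrix ι ι ℝ) (i j k l : ι)
    (x : EuclideanSpace ℝ ι) : ℝ :=
  pd j (christoffel G l i k) x - pd i (christoffel G l j k) x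
    + ∑ m, (christoffel G m i k x * christoffel G l j m x
      - christoffel G m j k x * christoffel G l i m x)

/-- The curvature tensor with all indices down, `R_{ijkl} = R_{ijk}^m g_{ml}`. -/
def riemann (G : EuclideanSpace ℝ ι → Matrix ι ι ℝ) (i j k l : ι)
    (x : EuclideanSpace ℝ ι) : ℝ :=
  ∑ m, curvature G i j k m x * G x m l

/-- The Ricci tensor `R_{ij} = R_{ikj}^k`. -/
def ricci (G : EuclideanSpace ℝ ι → Matrix ι ι ℝ) (i j : ι) (x : EuclideanSpace ℝ ι) : ℝ :=
  ∑ k, curvature G i k j k x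

/-- The scalar curvature `g^{ij} R_{ij}`. -/
def scalarCurv (G : EuclideanSpace ℝ ι → Matrix ι ι ℝ) (x : EuclideanSpace ℝ ι) : ℝ :=
  ∑ i, ∑ j, (G x)⁻¹ i j * ricci G i j x

/-- The Schouten tensor `P = (Ric - Scal / (2 (n - 1)) g) / (n - 2)`, where `n` is the dimension. -/
def schouten (G : EuclideanSpace ℝ ι → Matrix ι ι ℝ) (i j : ι) (x : EuclideanSpace ℝ ι) : ℝ :=
  (1 / ((Fintype.card ι : ℝ) - 2)) *
    (ricci G i j x - scalarCurv G x / (2 * ((Fintype.card ι : ℝ) - 1)) * G x i j)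

/-- The covariant derivative `(∇_i V)^k` of a vector field with components `V^k`. -/
def covVec (G : EuclideanSpace ℝ ι → Matrix ι ι ℝ)
    (V : EuclideanSpace ℝ ι → EuclideanSpace ℝ ι) (i k : ι) (x : EuclideanSpace ℝ ι) : ℝ :=
  pd i (fun y => V y k) x + ∑ j, christoffel G k i j x * V x j

/-- The covariant derivative `∇_k T_{ij}`. -/
def cov2 (G T : EuclideanSpace ℝ ι → Matrix ι ι ℝ) (k i j : ι) (x : EuclideanSpace ℝ ι) : ℝ :=
  pd k (fun y => T y i j) x
    - ∑ m, (christoffel G m k i x * T x m j + christoffel G m k j x * T x i m)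

/-- The second covariant derivative `∇_k ∇_l T_{ij}`. -/
def hess2 (G T : EuclideanSpace ℝ ι → Matrix ι ι ℝ) (k l i j : ι)
    (x : EuclideanSpace ℝ ι) : ℝ :=
  pd k (cov2 G T l i j) x
    - ∑ m, (christoffel G m k l x * cov2 G T m i j x
      + christoffel G m k i x * cov2 G T l m j x
      + christoffel G m k j x * cov2 G T l i m x)

/-- The divergence `∇^k T_{ki}`. -/
def div2 (G T : EuclideanSpace ℝ ι → Matrix ι ι ℝ) (i : ι) (x : EuclideanSpace ℝ ι) : ℝ :=
  ∑ k, ∑ l, (G x)⁻¹ k l * cov2 G T k l i x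

/-- The tensor Laplacian `□ T_{ij} = ∇^k ∇_k T_{ij}`. -/
def box2 (G T : EuclideanSpace ℝ ι → Matrix ι ι ℝ) (i j : ι) (x : EuclideanSpace ℝ ι) : ℝ :=
  ∑ k, ∑ l, (G x)⁻¹ k l * hess2 G T k l i j x

/-- Both indices raised: `T^{kl} = g^{kp} g^{lq} T_{pq}`. -/
def raise2 (G T : EuclideanSpace ℝ ι → Matrix ι ι ℝ) (k l : ι) (x : EuclideanSpace ℝ ι) : ℝ :=
  ∑ p, ∑ q, (G x)⁻¹ k p * (G x)⁻¹ l q * T x p q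

/-- The quadratic first order term `∇_k T_{li} ∇^l T^k_j`. -/
def gradQuad (G T : EuclideanSpace ℝ ι → Matrix ι ι ℝ) (i j : ι)
    (x : EuclideanSpace ℝ ι) : ℝ :=
  ∑ k, ∑ l, ∑ p, ∑ q,
    cov2 G T k l i x * ((G x)⁻¹ l p * (G x)⁻¹ k q * cov2 G T p q j x)

end Local

/-! ### Tensor fields and distributions on a manifold -/

section Manifold

variable {n : ℕ} {M : Type*} [TopologicalSpace M]
  [ChartedSpace (EuclideanSpace ℝ (Fin n)) M]

/-- `(0,2)`-tensor fields on `M` (no regularity). -/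
abbrev BilinField (n : ℕ) (M : Type*) [TopologicalSpace M]
    [ChartedSpace (EuclideanSpace ℝ (Fin n)) M] : Type _ :=
  (x : M) → LinearMap.BilinForm ℝ (TangentSpace (𝓡 n) x)

/-- Fields of subspaces of the tangent spaces of `M` (no regularity). -/
abbrev SubspaceField (n : ℕ) (M : Type*) [TopologicalSpace M]
    [ChartedSpace (EuclideanSpace ℝ (Fin n)) M] : Type _ :=
  (x : M) → Submodule ℝ (TangentSpace (𝓡 n) x)

/-- The smooth charts of `M`: the members of its maximal smooth atlas. -/
def smoothCharts (n : ℕ) (M : Type*) [TopologicalSpace M]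
    [ChartedSpace (EuclideanSpace ℝ (Fin n)) M] :
    Set (OpenPartialHomeomorph M (EuclideanSpace ℝ (Fin n))) :=
  IsManifold.maximalAtlas (𝓡 n) ∞ M

/-- The tangent vector `v^i ∂/∂x^i` of `M` at the point with coordinates `x` in the chart `e`. -/
def chartVec (e : OpenPartialHomeomorph M (EuclideanSpace ℝ (Fin n)))
    (x v : EuclideanSpace ℝ (Fin n)) : TangentSpace (𝓡 n) (e.symm x) :=
  mfderiv (𝓡 n) (𝓡 n) e.symm x v

/-- The components `T_{ij} = T(∂_i, ∂_j)` of a `(0,2)`-tensor field in the chart `e`, as functions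
of the coordinates. -/
def components (e : OpenPartialHomeomorph M (EuclideanSpace ℝ (Fin n))) (T : BilinField n M)
    (x : EuclideanSpace ℝ (Fin n)) : Matrix (Fin n) (Fin n) ℝ :=
  Matrix.of fun i j => T (e.symm x) (chartVec e x (EuclideanSpace.single i 1))
    (chartVec e x (EuclideanSpace.single j 1))

/-- A pseudo-Riemannian metric: a smooth symmetric nondegenerate `(0,2)`-tensor field. -/
structure IsPseudoRiemannian (g : BilinField n M) : Prop where
  symm : ∀ x v w, g x v w = g x w v
  nondegenerate : ∀ x v, (∀ w, g x v w = 0) → v = 0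
  smooth : ∀ e ∈ smoothCharts n M, ∀ i j,
    ContDiffOn ℝ ∞ (fun x => components e g x i j) e.target

/-- The coordinate vector `v` represents an element of `N` at the point with coordinates `x`. -/
def InDist (N : SubspaceField n M)
    (e : OpenPartialHomeomorph M (EuclideanSpace ℝ (Fin n)))
    (x v : EuclideanSpace ℝ (Fin n)) : Prop :=
  chartVec e x v ∈ N (e.symm x)

/-- `N` is a smooth vector distribution of rank `p`: in every chart it is locally spanned by `p`
smooth pointwise linearly independent vector fields. -/
def IsDistribution (p : ℕ) (N : SubspaceField n M) : Prop :=
  ∀ e ∈ smoothCharts n M, ∀ x₀ ∈ e.target,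
    ∃ U : Set (EuclideanSpace ℝ (Fin n)), IsOpen U ∧ x₀ ∈ U ∧ U ⊆ e.target ∧
    ∃ V : Fin p → EuclideanSpace ℝ (Fin n) → EuclideanSpace ℝ (Fin n),
      (∀ a, ContDiffOn ℝ ∞ (V a) U) ∧
      ∀ x ∈ U, LinearIndependent ℝ (fun a => V a x) ∧
        ∀ v, InDist N e x v ↔ v ∈ Submodule.span ℝ (range fun a => V a x)

/-- `N` is totally null with respect to `g`. -/
def IsTotallyNull (g : BilinField n M) (N : SubspaceField n M) : Prop :=
  ∀ x, ∀ v ∈ N x, ∀ w ∈ N x, g x v w = 0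

/-- `N` is parallel with respect to the Levi-Civita connection of `g`: `∇_X V` is a section of `N`
for every vector field `X` and every local smooth section `V` of `N`. -/
def IsParallelDist (g : BilinField n M) (N : SubspaceField n M) : Prop :=
  ∀ e ∈ smoothCharts n M, ∀ U : Set (EuclideanSpace ℝ (Fin n)), IsOpen U → U ⊆ e.target →
    ∀ V : EuclideanSpace ℝ (Fin n) → EuclideanSpace ℝ (Fin n), ContDiffOn ℝ ∞ V U →
      (∀ x ∈ U, InDist N e x (V x)) →
      ∀ x ∈ U, ∀ i,
        InDist N e x (WithLp.toLp 2 fun k => covVec (components e g) V i k x)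

/-- The image of the Schouten tensor, viewed as the endomorphism `P_i^k = g^{kl} P_{il}`, is
contained in `N`. -/
def SchoutenImageIn (g : BilinField n M) (N : SubspaceField n M) : Prop :=
  ∀ e ∈ smoothCharts n M, ∀ x ∈ e.target, ∀ i,
    InDist N e x (WithLp.toLp 2 fun k =>
      ∑ l, (components e g x)⁻¹ k l * schouten (components e g) i l x)

/-- `g` is a null Ricci Walker metric with parallel totally null distribution `N`
(of some rank `p > 0`). -/
structure IsNullRicciWalker (g : BilinField n M) (N : SubspaceField n M) : Prop where
  metric : IsPseudoRiemannian g
  distribution : ∃ p, 0 < p ∧ IsDistribution p N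
  totallyNull : IsTotallyNull g N
  parallel : IsParallelDist g N
  schouten_image : SchoutenImageIn g N

/-- A smooth family `h = h(ρ)`, `|ρ| < ε`, of symmetric `(0,2)`-tensor fields (smooth jointly in
`x` and `ρ`). -/
structure IsSmoothSymmFamily (ε : ℝ) (h : ℝ → BilinField n M) : Prop where
  symm : ∀ ρ ∈ Ioo (-ε) ε, ∀ x v w, h ρ x v w = h ρ x w v
  smooth : ∀ e ∈ smoothCharts n M, ∀ i j,
    ContDiffOn ℝ ∞ (fun q : EuclideanSpace ℝ (Fin n) × ℝ => components e (h q.2) q.1 i j)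
      (e.target ×ˢ Ioo (-ε) ε)

/-- `Im(T) ⊆ N`: for every tangent vector `v`, the vector `T♯ v` defined by
`g(T♯ v, w) = T(v, w)` lies in `N`. -/
def ImageIn (g T : BilinField n M) (N : SubspaceField n M) : Prop :=
  ∀ x v, ∃ z ∈ N x, ∀ w, g x z w = T x v w

/-- `T` is divergence-free with respect to `g`. -/
def IsDivFree (g T : BilinField n M) : Prop :=
  ∀ e ∈ smoothCharts n M, ∀ x ∈ e.target, ∀ i, div2 (components e g) (components e T) i x = 0

/-! ### The ambient metric

The coordinates on `(0, ∞) × M × (-ε, ε)` are `(t, x^1, …, x^n, ρ)`. -/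

/-- The index set of the coordinates `(t, x^1, …, x^n, ρ)`. -/
abbrev AmbIdx (n : ℕ) : Type := Unit ⊕ Fin n ⊕ Unit

/-- The index of the coordinate `t`. -/
abbrev tIdx (n : ℕ) : AmbIdx n := Sum.inl ()

/-- The index of the coordinate `x^i`. -/
abbrev xIdx {n : ℕ} (i : Fin n) : AmbIdx n := Sum.inr (Sum.inl i)

/-- The index of the coordinate `ρ`. -/
abbrev rhoIdx (n : ℕ) : AmbIdx n := Sum.inr (Sum.inr ())

/-- The `M`-part `(x^1, …, x^n)` of the coordinates. -/
def xPart (y : EuclideanSpace ℝ (AmbIdx n)) : EuclideanSpace ℝ (Fin n) :=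
  WithLp.toLp 2 fun i => y (xIdx i)

/-- The components, in the coordinates `(t, x^i, ρ)` coming from the chart `e`, of
`g̃ = 2 dt d(ρ t) + t² γ(ρ) = 2 ρ dt² + 2 t dt dρ + t² γ_{ij}(x, ρ) dx^i dx^j`. -/
def ambient (e : OpenPartialHomeomorph M (EuclideanSpace ℝ (Fin n))) (γ : ℝ → BilinField n M)
    (y : EuclideanSpace ℝ (AmbIdx n)) : Matrix (AmbIdx n) (AmbIdx n) ℝ :=
  Matrix.of fun a b => match a, b with
    | Sum.inl _, Sum.inl _ => 2 * y (rhoIdx n)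
    | Sum.inl _, Sum.inr (Sum.inr _) => y (tIdx n)
    | Sum.inr (Sum.inr _), Sum.inl _ => y (tIdx n)
    | Sum.inr (Sum.inl i), Sum.inr (Sum.inl j) =>
        y (tIdx n) ^ 2 * components e (γ (y (rhoIdx n))) (xPart y) i j
    | _, _ => 0

/-- The coordinate range of `(0, ∞) × M × (-ε, ε)` in the chart `e`. -/
def ambientDomain (e : OpenPartialHomeomorph M (EuclideanSpace ℝ (Fin n))) (ε : ℝ) :
    Set (EuclideanSpace ℝ (AmbIdx n)) :=
  {y | 0 < y (tIdx n) ∧ xPart y ∈ e.target ∧ y (rhoIdx n) ∈ Ioo (-ε) ε}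

/-- The order `m` to which the equations are imposed: `m = ∞` if `n` is odd and `m = (n - 2) / 2`
if `n` is even. -/
def fgOrder (n : ℕ) : ℕ∞ := if Odd n then ⊤ else (((n - 2) / 2 : ℕ) : ℕ∞)

/-- `Ric(g̃) = O(ρ^m)`, locally uniformly near the hypersurface `ρ = 0`. -/
def AmbientRicciVanishes (γ : ℝ → BilinField n M) : Prop :=
  ∀ e ∈ smoothCharts n M, ∀ a b : AmbIdx n, ∀ k : ℕ, (k : ℕ∞) ≤ fgOrder n →
    ∀ y₀ : EuclideanSpace ℝ (AmbIdx n),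
      0 < y₀ (tIdx n) → xPart y₀ ∈ e.target → y₀ (rhoIdx n) = 0 →
      (fun y => ricci (ambient e γ) a b y) =O[𝓝 y₀] fun y => y (rhoIdx n) ^ k

/-- For `n` even: `tr_g (ρ^{1 - n/2} Ric(g̃)|_{TM ⊗ TM}) = 0` along `ρ = 0`. -/
def AmbientTraceVanishes (g : BilinField n M) (γ : ℝ → BilinField n M) : Prop :=
  ∀ e ∈ smoothCharts n M, ∀ x ∈ e.target, ∀ t : ℝ, 0 < t →
    Tendsto (fun ρ : ℝ => (ρ ^ ((n - 2) / 2))⁻¹ *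
      ∑ i, ∑ j, (components e g x)⁻¹ i j *
        ricci (ambient e γ) (xIdx i) (xIdx j)
          (WithLp.toLp 2 (Sum.elim (fun _ => t) (Sum.elim (fun i => x i) fun _ => ρ))))
      (𝓝[≠] 0) (𝓝 0)

/-- `g̃ = 2 dt d(ρ t) + t² γ(ρ)` on `(0, ∞) × M × (-ε, ε)` is an ambient metric for the conformal
class of `g`, in normal form with respect to `g`. -/
structure IsAmbientMetric (ε : ℝ) (g : BilinField n M) (γ : ℝ → BilinField n M) : Prop where
  family : IsSmoothSymmFamily ε γ
  initial : ∀ x, γ 0 x = g x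
  nondegenerate : ∀ e ∈ smoothCharts n M, ∀ y ∈ ambientDomain e ε, (ambient e γ y).det ≠ 0
  ricci_vanishes : AmbientRicciVanishes γ
  trace_vanishes : Even n → AmbientTraceVanishes g γ

/-! ### The Fefferman-Graham equation for null Ricci Walker metrics -/

/-- The `ij`-component, in the chart `e` at the point with coordinates `x`, of
`ρ ḧ_{ij} - (n-2)/2 ḣ_{ij} - 1/2 □ h_{ij} + R_{kijl} h^{kl} + R_{ij}
  + 1/2 (h^{kl} ∇_k ∇_l h_{ij} - ∇_k h_{li} ∇^l h^k_j)`,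
where all operations are those of `g` and dots are `ρ`-derivatives. -/
def walkerOperator (g : BilinField n M) (h : ℝ → BilinField n M)
    (e : OpenPartialHomeomorph M (EuclideanSpace ℝ (Fin n))) (i j : Fin n)
    (x : EuclideanSpace ℝ (Fin n)) (ρ : ℝ) : ℝ :=
  ρ * iteratedDeriv 2 (fun r => components e (h r) x i j) ρ
    - ((n : ℝ) - 2) / 2 * deriv (fun r => components e (h r) x i j) ρ
    - 1 / 2 * box2 (components e g) (components e (h ρ)) i j x
    + ∑ k, ∑ l, riemann (components e g) k i j l x
        * raise2 (components e g) (components e (h ρ)) k l x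
    + ricci (components e g) i j x
    + 1 / 2 * ((∑ k, ∑ l, raise2 (components e g) (components e (h ρ)) k l x
          * hess2 (components e g) (components e (h ρ)) k l i j x)
        - gradQuad (components e g) (components e (h ρ)) i j x)

/-- The equation `walkerOperator g h = O(ρ^m)`, locally uniformly near `ρ = 0`. -/
def SolvesWalkerEquation (g : BilinField n M) (h : ℝ → BilinField n M) : Prop :=
  ∀ e ∈ smoothCharts n M, ∀ i j, ∀ k : ℕ, (k : ℕ∞) ≤ fgOrder n → ∀ x₀ ∈ e.target,
    (fun q : EuclideanSpace ℝ (Fin n) × ℝ => walkerOperator g h e i j q.1 q.2)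
      =O[𝓝 (x₀, 0)] fun q => q.2 ^ k

end Manifold

end AmbientWalker

end

/-!
The statement is local, so everything is computed in the coordinates of a chart. Covectors which,
with the index raised by `g`, represent elements of `N` form a field `L` of spaces of covectors
that is null and parallel (`isNullParallel_chartCovectors`); a symmetric tensor has its image in
`N` if and only if its rows lie in `L`. An index of a tensor is said to run in `L` if the components
in this index, for fixed values of the others, form an element of `L`. Contracting two indices that
both run in `L` gives zero, and covariant differentiation preserves this property of an index.

*The perturbed metric.* For `h` with values in `L` one has `h g⁻¹ h = 0`, so `g + h` is
nondegenerate with inverse `g^{kl} - h^{kl}` (`IsTensorIn.inv_add`). Consequently the connections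
of `g + h` and `g` differ by the tensor `connDiff`, a polynomial in `h` and `∇h`, which is
trace-free. In the Ricci tensor of `g + h` the divergence of `connDiff` is computed by commuting
covariant derivatives; here `div h = 0` is used, and that `Ric` has values in `L`. Of the
quadratic terms only one contraction `∇_k h_{li} ∇^l h^k_j` survives. The result is
`IsTensorIn.ricci_add_eq`: `Ric(g + h)` is the part of the operator in the equation that does not
involve `ρ`-derivatives.
The hypothesis is about the Schouten tensor, but a tensor with values in `L` is trace-free because
the associated endomorphism is nilpotent, so the scalar curvature vanishes and `Ric` is a multiple
of the Schouten tensor (`ricci_mem_of_schouten_mem`).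

*The ambient metric.* For an arbitrary family of metrics `γ(ρ)`, the Christoffel symbols of
`2 dt d(ρ t) + t² γ(ρ)` are explicit (`IsMetricFamily.christoffel_table`). For `γ = g + h` the
tensor `γ'` is trace-free and satisfies `γ' γ⁻¹ γ' = 0`. Then all components of the ambient Ricci
tensor vanish, except the `(x^i, ρ)`-components, which are `1/2` times the divergence of `γ'` with
respect to `γ`, and the `(x^i, x^j)`-components `ρ γ'' - (n-2)/2 γ' + Ric(γ)`
(`IsMetricFamily.ricci_x_x`). The former vanish as well, since `div h' = 0` with respect to `g` and
the difference of the connections does not contribute (`IsTensorIn.div_add`). By the formula for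
`Ric(g + h)`, the latter are exactly the operator in the equation, for every `ρ` and not only up to
`O(ρ^m)` (`IsLocalWalker.ricci_ambMatrix`); this gives the second equivalence.

*The other conditions on an ambient metric.* Nondegeneracy holds because `g + h` is nondegenerate,
and the trace condition is automatic: each term of the operator is trace-free, so its trace with
respect to `g` vanishes identically (`IsLocalWalker.trace_walkerExpr`).
-/

namespace AmbientWalker

set_option linter.unusedSectionVars false

/-! ### Partial derivatives -/

section PartialDerivatives

variable {ι : Type*} [Fintype ι] [DecidableEq ι] {f g : EuclideanSpace ℝ ι → ℝ}
  {x : EuclideanSpace ℝ ι}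

lemma pd_congr (h : f =ᶠ[𝓝 x] g) (i : ι) : pd i f x = pd i g x := by
  simp only [pd, h.fderiv_eq]

lemma pd_const (i : ι) (c : ℝ) : pd i (fun _ => c) x = 0 := by
  simp [pd]

lemma pd_add (hf : DifferentiableAt ℝ f x) (hg : DifferentiableAt ℝ g x) (i : ι) :
    pd i (fun y => f y + g y) x = pd i f x + pd i g x := by
  simp only [pd, fderiv_fun_add hf hg, _root_.add_apply]

lemma pd_sub (hf : DifferentiableAt ℝ f x) (hg : DifferentiableAt ℝ g x) (i : ι) :
    pd i (fun y => f y - g y) x = pd i f x - pd i g x := by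
  simp only [pd, fderiv_fun_sub hf hg, _root_.sub_apply]

lemma pd_mul (hf : DifferentiableAt ℝ f x) (hg : DifferentiableAt ℝ g x) (i : ι) :
    pd i (fun y => f y * g y) x = pd i f x * g x + f x * pd i g x := by
  simp only [pd, fderiv_fun_mul hf hg, _root_.add_apply,
    _root_.smul_apply, smul_eq_mul]
  ring

lemma pd_const_mul (hf : DifferentiableAt ℝ f x) (c : ℝ) (i : ι) :
    pd i (fun y => c * f y) x = c * pd i f x := by
  rw [pd_mul (differentiableAt_const c) hf, pd_const]; ring

lemma pd_sum {κ : Type*} (s : Finset κ) {F : κ → EuclideanSpace ℝ ι → ℝ}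
    (hF : ∀ a, DifferentiableAt ℝ (F a) x) (i : ι) :
    pd i (fun y => ∑ a ∈ s, F a y) x = ∑ a ∈ s, pd i (F a) x := by
  simp only [pd, fderiv_fun_sum (fun a _ => hF a), _root_.sum_apply]

lemma contDiffAt_pd (hf : ContDiffAt ℝ ∞ f x) (i : ι) : ContDiffAt ℝ ∞ (pd i f) x :=
  (hf.fderiv_right (m := ∞) (by simp)).clm_apply contDiffAt_const

lemma differentiableAt_of_smooth {E : Type*} [NormedAddCommGroup E] [NormedSpace ℝ E]
    {f : E → ℝ} {x : E} (hf : ContDiffAt ℝ ∞ f x) : DifferentiableAt ℝ f x :=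
  hf.differentiableAt (by simp)

/-- Partial derivatives of smooth functions commute, stated for two arbitrary directions in a
normed space so that it also covers mixed derivatives in `x` and `ρ`. -/
lemma fderiv_apply_comm {E : Type*} [NormedAddCommGroup E] [NormedSpace ℝ E]
    {f : E → ℝ} {x : E} (hf : ContDiffAt ℝ ∞ f x) (v w : E) :
    fderiv ℝ (fun y => fderiv ℝ f y w) x v = fderiv ℝ (fun y => fderiv ℝ f y v) x w := by
  have hd : DifferentiableAt ℝ (fderiv ℝ f) x :=
    (hf.fderiv_right (m := ∞) (by simp)).differentiableAt (by simp)
  have key : ∀ a b : E, fderiv ℝ (fun y => fderiv ℝ f y a) x b = fderiv ℝ (fderiv ℝ f) x b a := by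
    intro a b
    rw [fderiv_clm_apply hd (differentiableAt_const a)]
    simp
  rw [key, key]
  exact (hf.isSymmSndFDerivAt (by
    rw [minSmoothness_of_isRCLikeNormedField]; exact WithTop.coe_le_coe.2 le_top)).eq v w

lemma pd_comm (hf : ContDiffAt ℝ ∞ f x) (i j : ι) : pd i (pd j f) x = pd j (pd i f) x :=
  fderiv_apply_comm hf _ _

end PartialDerivatives

/-! ### The Levi-Civita connection of a metric in coordinates -/

section LeviCivita

variable {ι : Type*} [Fintype ι] [DecidableEq ι]

/-- `G` is the component matrix of a smooth pseudo-Riemannian metric on the open set `U`. -/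
structure IsLocalMetric (G : EuclideanSpace ℝ ι → Matrix ι ι ℝ)
    (U : Set (EuclideanSpace ℝ ι)) : Prop where
  isOpen : IsOpen U
  smooth : ∀ x ∈ U, ∀ i j, ContDiffAt ℝ ∞ (fun y => G y i j) x
  symm : ∀ x ∈ U, ∀ i j, G x i j = G x j i
  det : ∀ x ∈ U, (G x).det ≠ 0

lemma contDiffAt_det {E : Type*} [NormedAddCommGroup E] [NormedSpace ℝ E] {A : E → Matrix ι ι ℝ}
    {x : E} (hA : ∀ i j, ContDiffAt ℝ ∞ (fun y => A y i j) x) :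
    ContDiffAt ℝ ∞ (fun y => (A y).det) x := by
  simp only [Matrix.det_apply']
  exact ContDiffAt.sum fun σ _ => contDiffAt_const.mul (contDiffAt_prod fun i _ => hA _ _)

lemma contDiffAt_matrix_inv {E : Type*} [NormedAddCommGroup E] [NormedSpace ℝ E]
    {A : E → Matrix ι ι ℝ} {x : E} (hA : ∀ i j, ContDiffAt ℝ ∞ (fun y => A y i j) x)
    (hdet : (A x).det ≠ 0) (i j : ι) : ContDiffAt ℝ ∞ (fun y => (A y)⁻¹ i j) x := by
  simp only [Matrix.inv_def, Matrix.smul_apply, Ring.inverse_eq_inv', smul_eq_mul,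
    Matrix.adjugate_apply]
  refine ((contDiffAt_det hA).inv hdet).mul (contDiffAt_det fun a b => ?_)
  by_cases hab : a = j
  · subst hab
    simpa only [Matrix.updateRow_self] using contDiffAt_const
  · simpa only [Matrix.updateRow_ne hab] using hA a b

variable {G : EuclideanSpace ℝ ι → Matrix ι ι ℝ} {U : Set (EuclideanSpace ℝ ι)}
  {x : EuclideanSpace ℝ ι}

namespace IsLocalMetric

lemma mem_nhds (hG : IsLocalMetric G U) (hx : x ∈ U) : ∀ᶠ y in 𝓝 x, y ∈ U :=
  hG.isOpen.mem_nhds hx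

lemma mul_inv (hG : IsLocalMetric G U) (hx : x ∈ U) : G x * (G x)⁻¹ = 1 :=
  Matrix.mul_nonsing_inv _ (isUnit_iff_ne_zero.2 (hG.det x hx))

lemma inv_mul (hG : IsLocalMetric G U) (hx : x ∈ U) : (G x)⁻¹ * G x = 1 :=
  Matrix.nonsing_inv_mul _ (isUnit_iff_ne_zero.2 (hG.det x hx))

lemma transpose_eq (hG : IsLocalMetric G U) (hx : x ∈ U) : (G x).transpose = G x := by
  ext i j; exact hG.symm x hx j i

lemma inv_symm (hG : IsLocalMetric G U) (hx : x ∈ U) (i j : ι) : (G x)⁻¹ i j = (G x)⁻¹ j i := by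
  conv_lhs => rw [← hG.transpose_eq hx, ← Matrix.transpose_nonsing_inv]
  rfl

lemma sum_inv_mul (hG : IsLocalMetric G U) (hx : x ∈ U) (i j : ι) :
    ∑ k, (G x)⁻¹ i k * G x k j = if i = j then 1 else 0 := by
  rw [← Matrix.mul_apply, hG.inv_mul hx, Matrix.one_apply]

lemma contDiffAt_inv (hG : IsLocalMetric G U) (hx : x ∈ U) (i j : ι) :
    ContDiffAt ℝ ∞ (fun y => (G y)⁻¹ i j) x :=
  contDiffAt_matrix_inv (hG.smooth x hx) (hG.det x hx) i j

lemma contDiffAt_christoffel (hG : IsLocalMetric G U) (hx : x ∈ U) (k i j : ι) :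
    ContDiffAt ℝ ∞ (christoffel G k i j) x := by
  unfold christoffel
  refine contDiffAt_const.mul (ContDiffAt.sum fun l _ => (hG.contDiffAt_inv hx k l).mul ?_)
  exact ((contDiffAt_pd (hG.smooth x hx _ _) _).add (contDiffAt_pd (hG.smooth x hx _ _) _)).sub
    (contDiffAt_pd (hG.smooth x hx _ _) _)

lemma pd_symm (hG : IsLocalMetric G U) (hx : x ∈ U) (k i j : ι) :
    pd k (fun y => G y i j) x = pd k (fun y => G y j i) x :=
  pd_congr ((hG.mem_nhds hx).mono fun y hy => hG.symm y hy i j) k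

lemma christoffel_symm (hG : IsLocalMetric G U) (hx : x ∈ U) (k i j : ι) :
    christoffel G k i j x = christoffel G k j i x := by
  unfold christoffel
  congr 1
  refine Finset.sum_congr rfl fun l _ => ?_
  rw [hG.pd_symm hx l i j]
  ring

/-- The Christoffel symbols of the first kind. -/
lemma sum_metric_mul_christoffel (hG : IsLocalMetric G U) (hx : x ∈ U) (i j l : ι) :
    ∑ m, G x l m * christoffel G m i j x =
      (1 / 2) * (pd i (fun y => G y j l) x + pd j (fun y => G y i l) x
        - pd l (fun y => G y i j) x) := by
  set v : ι → ℝ := fun l => pd i (fun y => G y j l) x + pd j (fun y => G y i l) x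
        - pd l (fun y => G y i j) x
  have h1 : (fun m => christoffel G m i j x) = (1 / 2 : ℝ) • ((G x)⁻¹).mulVec v := by
    ext m; rfl
  have h2 : (G x).mulVec (fun m => christoffel G m i j x) = (1 / 2 : ℝ) • v := by
    rw [h1, Matrix.mulVec_smul, Matrix.mulVec_mulVec, hG.mul_inv hx, Matrix.one_mulVec]
  exact congrFun h2 l

/-- The metric is parallel. -/
lemma pd_metric (hG : IsLocalMetric G U) (hx : x ∈ U) (k i j : ι) :
    pd k (fun y => G y i j) x =
      ∑ m, (christoffel G m k i x * G x m j + christoffel G m k j x * G x i m) := by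
  have h1 := hG.sum_metric_mul_christoffel hx k i j
  have h2 := hG.sum_metric_mul_christoffel hx k j i
  have e1 : ∑ m, christoffel G m k i x * G x m j = ∑ m, G x j m * christoffel G m k i x :=
    Finset.sum_congr rfl fun m _ => by rw [hG.symm x hx j m]; ring
  have e2 : ∑ m, christoffel G m k j x * G x i m = ∑ m, G x i m * christoffel G m k j x :=
    Finset.sum_congr rfl fun m _ => by ring
  rw [Finset.sum_add_distrib, e1, e2, h1, h2, hG.pd_symm hx k j i]
  ring

lemma cov2_metric (hG : IsLocalMetric G U) (hx : x ∈ U) (k i j : ι) : cov2 G G k i j x = 0 := by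
  rw [cov2, hG.pd_metric hx, sub_self]

/-- The inverse metric is parallel. -/
lemma pd_inv (hG : IsLocalMetric G U) (hx : x ∈ U) (k a b : ι) :
    pd k (fun y => (G y)⁻¹ a b) x =
      -∑ m, (christoffel G a k m x * (G x)⁻¹ m b + christoffel G b k m x * (G x)⁻¹ a m) := by
  set D : Matrix ι ι ℝ := Matrix.of fun i j => pd k (fun y => G y i j) x with hD
  set D' : Matrix ι ι ℝ := Matrix.of fun i j => pd k (fun y => (G y)⁻¹ i j) x with hD'
  set Γ : Matrix ι ι ℝ := Matrix.of fun i j => christoffel G i k j x with hΓ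
  have hDΓ : D = Γ.transpose * G x + G x * Γ := by
    ext i j
    simp only [hD, hΓ, Matrix.of_apply, Matrix.add_apply, Matrix.mul_apply, Matrix.transpose_apply]
    rw [hG.pd_metric hx, Finset.sum_add_distrib]
    congr 1
    exact Finset.sum_congr rfl fun m _ => mul_comm _ _
  have hprod : D' * G x + (G x)⁻¹ * D = 0 := by
    ext i j
    simp only [hD, hD', Matrix.of_apply, Matrix.add_apply, Matrix.mul_apply, Matrix.zero_apply]
    have hc : pd k (fun y => ∑ m, (G y)⁻¹ i m * G y m j) x = 0 := by
      rw [pd_congr (g := fun _ => if i = j then 1 else 0)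
        ((hG.mem_nhds hx).mono fun y hy => hG.sum_inv_mul hy i j), pd_const]
    rw [← hc, pd_sum _ (fun m => (differentiableAt_of_smooth (hG.contDiffAt_inv hx i m)).fun_mul
      (differentiableAt_of_smooth (hG.smooth x hx m j))), ← Finset.sum_add_distrib]
    refine Finset.sum_congr rfl fun m _ => ?_
    rw [pd_mul (differentiableAt_of_smooth (hG.contDiffAt_inv hx i m))
      (differentiableAt_of_smooth (hG.smooth x hx m j))]
  have hfin : D' = -(Γ * (G x)⁻¹ + (G x)⁻¹ * Γ.transpose) := by
    have : D' = D' * G x * (G x)⁻¹ := by rw [Matrix.mul_assoc, hG.mul_inv hx, Matrix.mul_one]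
    rw [this, eq_neg_of_add_eq_zero_left hprod, hDΓ]
    simp only [Matrix.mul_add, Matrix.neg_mul, Matrix.add_mul, neg_inj]
    rw [← Matrix.mul_assoc (G x)⁻¹ (G x), hG.inv_mul hx, Matrix.one_mul, Matrix.mul_assoc,
      Matrix.mul_assoc, hG.mul_inv hx, Matrix.mul_one, add_comm]
  have := congrFun (congrFun hfin a) b
  simp only [hD', hΓ, Matrix.of_apply, Matrix.neg_apply, Matrix.add_apply, Matrix.mul_apply,
    Matrix.transpose_apply] at this
  rw [this, Finset.sum_add_distrib]
  congr 2
  exact Finset.sum_congr rfl fun m _ => mul_comm _ _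

/-- Raising an index commutes with covariant differentiation. -/
lemma pd_raise (hG : IsLocalMetric G U) (hx : x ∈ U) {S : ι → EuclideanSpace ℝ ι → ℝ}
    (hS : ∀ b, ContDiffAt ℝ ∞ (S b) x) (k a : ι) :
    pd k (fun y => ∑ b, (G y)⁻¹ a b * S b y) x =
      ∑ b, (G x)⁻¹ a b * (pd k (S b) x - ∑ m, christoffel G m k b x * S m x)
        - ∑ m, christoffel G a k m x * ∑ b, (G x)⁻¹ m b * S b x := by
  rw [pd_sum _ (fun b => (differentiableAt_of_smooth (hG.contDiffAt_inv hx a b)).fun_mul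
      (differentiableAt_of_smooth (hS b)))]
  have h1 : ∀ b, pd k (fun y => (G y)⁻¹ a b * S b y) x =
      (G x)⁻¹ a b * pd k (S b) x - ∑ m, (christoffel G a k m x * (G x)⁻¹ m b * S b x)
        - ∑ m, (christoffel G b k m x * (G x)⁻¹ a m * S b x) := by
    intro b
    rw [pd_mul (differentiableAt_of_smooth (hG.contDiffAt_inv hx a b))
      (differentiableAt_of_smooth (hS b)), hG.pd_inv hx, Finset.sum_add_distrib, neg_mul, add_mul,
      Finset.sum_mul, Finset.sum_mul]
    ring
  simp only [h1, mul_sub, Finset.sum_sub_distrib, Finset.mul_sum]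
  rw [sub_sub, sub_sub, add_comm (∑ b, ∑ m, christoffel G a k m x * _ * _)]
  congr 2
  · rw [Finset.sum_comm]
    exact Finset.sum_congr rfl fun m _ => Finset.sum_congr rfl fun b _ => by ring
  · rw [Finset.sum_comm]
    exact Finset.sum_congr rfl fun m _ => Finset.sum_congr rfl fun b _ => by ring

/-- Contraction with the metric commutes with covariant differentiation. -/
lemma pd_contract (hG : IsLocalMetric G U) (hx : x ∈ U) {S : ι → ι → EuclideanSpace ℝ ι → ℝ}
    (hS : ∀ a b, ContDiffAt ℝ ∞ (S a b) x) (k : ι) :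
    pd k (fun y => ∑ a, ∑ b, (G y)⁻¹ a b * S a b y) x =
      ∑ a, ∑ b, (G x)⁻¹ a b * (pd k (S a b) x
        - ∑ m, (christoffel G m k a x * S m b x + christoffel G m k b x * S a m x)) := by
  have hd : ∀ a, DifferentiableAt ℝ (fun y => ∑ b, (G y)⁻¹ a b * S a b y) x := fun a =>
    differentiableAt_of_smooth (ContDiffAt.sum fun b _ => (hG.contDiffAt_inv hx a b).mul (hS a b))
  rw [pd_sum _ hd]
  have h1 : ∀ a, pd k (fun y => ∑ b, (G y)⁻¹ a b * S a b y) x = _ := fun a =>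
    hG.pd_raise hx (hS a) k a
  simp only [h1, Finset.sum_sub_distrib, mul_sub, Finset.sum_add_distrib, mul_add]
  rw [sub_sub]
  congr 1
  rw [add_comm]
  congr 1
  have h2 : ∀ a m b : ι, christoffel G a k m x * ((G x)⁻¹ m b * S a b x) =
      (G x)⁻¹ m b * (christoffel G a k m x * S a b x) := fun _ _ _ => by ring
  simp only [Finset.mul_sum, h2]
  rw [Finset.sum_comm]
  refine Finset.sum_congr rfl fun m _ => ?_
  rw [Finset.sum_comm]

end IsLocalMetric

/-! ### Covariant derivatives of symmetric tensors and curvature identities -/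

variable {T : EuclideanSpace ℝ ι → Matrix ι ι ℝ}

lemma contDiffAt_cov2 (hG : IsLocalMetric G U) (hx : x ∈ U)
    (hT : ∀ i j, ContDiffAt ℝ ∞ (fun y => T y i j) x) (k i j : ι) :
    ContDiffAt ℝ ∞ (cov2 G T k i j) x := by
  unfold cov2
  exact (contDiffAt_pd (hT i j) k).sub (ContDiffAt.sum fun m _ =>
    ((hG.contDiffAt_christoffel hx m k i).mul (hT m j)).add
      ((hG.contDiffAt_christoffel hx m k j).mul (hT i m)))

lemma cov2_symm (hT : ∀ᶠ y in 𝓝 x, ∀ i j, T y i j = T y j i) (k i j : ι) :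
    cov2 G T k i j x = cov2 G T k j i x := by
  unfold cov2
  have h := hT.self_of_nhds
  rw [pd_congr (hT.mono fun y hy => hy i j) k]
  congr 1
  exact Finset.sum_congr rfl fun m _ => by rw [h m j, h i m]; ring

lemma hess2_symm (hT : ∀ᶠ y in 𝓝 x, ∀ i j, T y i j = T y j i) (k l i j : ι) :
    hess2 G T k l i j x = hess2 G T k l j i x := by
  have h : ∀ᶠ y in 𝓝 x, ∀ l i j, cov2 G T l i j y = cov2 G T l j i y :=
    hT.eventually_nhds.mono fun y hy l i j => cov2_symm hy l i j
  have h' := h.self_of_nhds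
  unfold hess2
  rw [pd_congr (h.mono fun y hy => hy l i j) k]
  congr 1
  exact Finset.sum_congr rfl fun m _ => by rw [h' m i j, h' l m j, h' l i m]; ring

end LeviCivita

/-! ### Symmetries of the curvature -/

section Curvature

variable {ι : Type*} [Fintype ι] [DecidableEq ι]
variable {G T : EuclideanSpace ℝ ι → Matrix ι ι ℝ} {U : Set (EuclideanSpace ℝ ι)}
  {x : EuclideanSpace ℝ ι}

lemma pd_cov2 (hG : IsLocalMetric G U) (hx : x ∈ U)
    (hT : ∀ i j, ContDiffAt ℝ ∞ (fun y => T y i j) x) (k l i j : ι) :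
    pd k (cov2 G T l i j) x = pd k (pd l fun y => T y i j) x
      - ∑ m, (pd k (christoffel G m l i) x * T x m j
          + christoffel G m l i x * pd k (fun y => T y m j) x
        + (pd k (christoffel G m l j) x * T x i m
          + christoffel G m l j x * pd k (fun y => T y i m) x)) := by
  have dT : ∀ i j, DifferentiableAt ℝ (fun y => T y i j) x := fun i j =>
    differentiableAt_of_smooth (hT i j)
  have dΓ : ∀ m i j, DifferentiableAt ℝ (christoffel G m i j) x := fun m i j =>
    differentiableAt_of_smooth (hG.contDiffAt_christoffel hx m i j)
  have d1 : ∀ m, DifferentiableAt ℝ (fun y => christoffel G m l i y * T y m j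
      + christoffel G m l j y * T y i m) x := fun m =>
    ((dΓ _ _ _).fun_mul (dT _ _)).fun_add ((dΓ _ _ _).fun_mul (dT _ _))
  have e : cov2 G T l i j = fun y => pd l (fun y => T y i j) y
    - ∑ m, (christoffel G m l i y * T y m j + christoffel G m l j y * T y i m) := rfl
  rw [e, pd_sub (differentiableAt_of_smooth (contDiffAt_pd (hT i j) l))
    (DifferentiableAt.fun_sum fun m _ => d1 m), pd_sum _ d1]
  congr 1
  refine Finset.sum_congr rfl fun m _ => ?_
  rw [pd_add ((dΓ _ _ _).fun_mul (dT _ _)) ((dΓ _ _ _).fun_mul (dT _ _)),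
    pd_mul (dΓ _ _ _) (dT _ _), pd_mul (dΓ _ _ _) (dT _ _)]

/-- The Ricci identity for `(0,2)`-tensors. -/
lemma hess2_sub_hess2 (hG : IsLocalMetric G U) (hx : x ∈ U)
    (hT : ∀ i j, ContDiffAt ℝ ∞ (fun y => T y i j) x) (k l i j : ι) :
    hess2 G T k l i j x - hess2 G T l k i j x =
      ∑ m, (curvature G k l i m x * T x m j + curvature G k l j m x * T x i m) := by
  unfold hess2
  rw [pd_cov2 hG hx hT, pd_cov2 hG hx hT, pd_comm (hT i j) k l]
  simp only [curvature, cov2, hG.christoffel_symm hx _ l k]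
  simp only [mul_sub, mul_add, Finset.mul_sum, Finset.sum_add_distrib, Finset.sum_sub_distrib,
    add_mul, sub_mul, Finset.sum_mul]
  set c : ι → ι → ι → ℝ := fun a b d => christoffel G a b d x with hc
  have q1 : ∀ k l i j : ι, ∑ m, ∑ p, christoffel G m k i x * (christoffel G p l m x * T x p j)
      = ∑ p, ∑ m, christoffel G m k i x * christoffel G p l m x * T x p j := by
    intro k l i j
    rw [Finset.sum_comm]
    simp only [mul_assoc]
  have q2 : ∀ k l i j : ι, ∑ m, ∑ p, christoffel G m k i x * (christoffel G p l m x * T x j p)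
      = ∑ p, ∑ m, christoffel G m k i x * christoffel G p l m x * T x j p := by
    intro k l i j
    rw [Finset.sum_comm]
    simp only [mul_assoc]
  have q3 : ∀ k l i j : ι, ∑ m, ∑ p, christoffel G m k i x * (christoffel G p l j x * T x m p)
      = ∑ m, ∑ p, christoffel G m l j x * (christoffel G p k i x * T x p m) := by
    intro k l i j
    rw [Finset.sum_comm]
    exact Finset.sum_congr rfl fun m _ => Finset.sum_congr rfl fun p _ => by ring
  rw [q1 k l i j, q1 l k i j, q2 k l j i, q2 l k j i, q3 k l i j, q3 l k i j]
  ring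

/-- The curvature is antisymmetric in its last two indices. -/
lemma riemann_antisymm (hG : IsLocalMetric G U) (hx : x ∈ U) (i j k l : ι) :
    riemann G i j k l x = -riemann G i j l k x := by
  have hz : ∀ a b c d, hess2 G G a b c d x = 0 := by
    intro a b c d
    have h0 : ∀ b c d, cov2 G G b c d =ᶠ[𝓝 x] fun _ => 0 := fun b c d =>
      (hG.mem_nhds hx).mono fun y hy => hG.cov2_metric hy b c d
    unfold hess2
    rw [pd_congr (h0 b c d), pd_const]
    simp [(h0 _ _ _).self_of_nhds]
  have h := hess2_sub_hess2 hG hx (hG.smooth x hx) i j k l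
  rw [hz, hz, sub_zero, Finset.sum_add_distrib] at h
  have e : riemann G i j l k x = ∑ m, curvature G i j l m x * G x k m :=
    Finset.sum_congr rfl fun m _ => by rw [hG.symm x hx m k]
  rw [e]
  unfold riemann
  linarith

/-- Raising the last index of `R_{ijkl}` gives back `R_{ijk}^l`. -/
lemma sum_inv_mul_riemann (hG : IsLocalMetric G U) (hx : x ∈ U) (i j k l : ι) :
    ∑ m, (G x)⁻¹ l m * riemann G i j k m x = curvature G i j k l x := by
  have : ∀ m, (G x)⁻¹ l m * riemann G i j k m x =
      ∑ p, curvature G i j k p x * ((G x)⁻¹ l m * G x m p) := by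
    intro m
    rw [riemann, Finset.mul_sum]
    exact Finset.sum_congr rfl fun p _ => by rw [hG.symm x hx m p]; ring
  simp only [this]
  rw [Finset.sum_comm]
  simp only [← Finset.mul_sum, hG.sum_inv_mul hx]
  simp

lemma sum_curvature_trace (hG : IsLocalMetric G U) (hx : x ∈ U) (i j : ι) :
    ∑ k, curvature G i j k k x = 0 := by
  simp only [← sum_inv_mul_riemann hG hx]
  have h : ∑ k, ∑ m, (G x)⁻¹ k m * riemann G i j k m x
      = -∑ k, ∑ m, (G x)⁻¹ k m * riemann G i j k m x := by
    conv_lhs => rw [Finset.sum_comm]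
    simp only [← Finset.sum_neg_distrib]
    refine Finset.sum_congr rfl fun k _ => Finset.sum_congr rfl fun m _ => ?_
    rw [riemann_antisymm hG hx, hG.inv_symm hx]
    ring
  linarith

lemma ricci_symm (hG : IsLocalMetric G U) (hx : x ∈ U) (i j : ι) :
    ricci G i j x = ricci G j i x := by
  have h := sum_curvature_trace hG hx i j
  have hs : ∀ a b c, christoffel G a b c =ᶠ[𝓝 x] christoffel G a c b := fun a b c =>
    (hG.mem_nhds hx).mono fun y hy => hG.christoffel_symm hy a b c
  have hB : ∀ i j : ι, ∑ k, pd i (christoffel G k k j) x = ∑ k, pd i (christoffel G k j k) x :=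
    fun i j => Finset.sum_congr rfl fun k _ => pd_congr (hs k k j) i
  have hA : ∑ k, pd k (christoffel G k j i) x = ∑ k, pd k (christoffel G k i j) x :=
    Finset.sum_congr rfl fun k _ => pd_congr (hs k j i) k
  have hD : ∑ k, ∑ m, christoffel G m j i x * christoffel G k k m x
      = ∑ k, ∑ m, christoffel G m i j x * christoffel G k k m x :=
    Finset.sum_congr rfl fun k _ => Finset.sum_congr rfl fun m _ => by
      rw [hG.christoffel_symm hx m j i]
  have hQ : ∑ k, ∑ m, christoffel G m k i x * christoffel G k j m x
      = ∑ k, ∑ m, christoffel G m k j x * christoffel G k i m x := by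
    rw [Finset.sum_comm]
    refine Finset.sum_congr rfl fun m _ => Finset.sum_congr rfl fun k _ => ?_
    rw [hG.christoffel_symm hx m i k, hG.christoffel_symm hx k j m, mul_comm]
  have hq : ∑ k, ∑ m, christoffel G m i k x * christoffel G k j m x
      = ∑ k, ∑ m, christoffel G m j k x * christoffel G k i m x := by
    rw [Finset.sum_comm]
    exact Finset.sum_congr rfl fun m _ => Finset.sum_congr rfl fun k _ => mul_comm _ _
  simp only [curvature, Finset.sum_add_distrib, Finset.sum_sub_distrib] at h
  simp only [ricci, curvature, Finset.sum_add_distrib, Finset.sum_sub_distrib]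
  rw [hA, hB, hB, hD, hQ]
  linarith

lemma curvature_antisymm (i j k l : ι) : curvature G i j k l x = -curvature G j i k l x := by
  simp only [curvature, Finset.sum_sub_distrib]
  ring

/-- The contraction `g^{kl} R_{kil}^m` of the curvature is minus the Ricci tensor with one index
raised. -/
lemma sum_inv_mul_curvature (hG : IsLocalMetric G U) (hx : x ∈ U) (i m : ι) :
    ∑ k, ∑ l, (G x)⁻¹ k l * curvature G k i l m x = ∑ p, (G x)⁻¹ m p * ricci G i p x := by
  have e : ∀ k l, (G x)⁻¹ k l * curvature G k i l m x =
      ∑ p, (G x)⁻¹ m p * -((G x)⁻¹ k l * riemann G k i p l x) := by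
    intro k l
    rw [← sum_inv_mul_riemann hG hx, Finset.mul_sum]
    exact Finset.sum_congr rfl fun p _ => by rw [riemann_antisymm hG hx k i l p]; ring
  simp only [e]
  have e2 : ∑ k, ∑ l, ∑ p, (G x)⁻¹ m p * -((G x)⁻¹ k l * riemann G k i p l x) =
      ∑ p, ∑ k, ∑ l, (G x)⁻¹ m p * -((G x)⁻¹ k l * riemann G k i p l x) := by
    simp_rw [fun k : ι => Finset.sum_comm (s := Finset.univ) (t := Finset.univ)
      (f := fun l p => (G x)⁻¹ m p * -((G x)⁻¹ k l * riemann G k i p l x))]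
    rw [Finset.sum_comm]
  rw [e2]
  refine Finset.sum_congr rfl fun p _ => ?_
  simp only [← Finset.mul_sum, Finset.sum_neg_distrib, sum_inv_mul_riemann hG hx, ricci]
  congr 1
  rw [← Finset.sum_neg_distrib]
  exact Finset.sum_congr rfl fun k _ => (curvature_antisymm i k p k).symm

end Curvature

/-! ### Null parallel fields of covectors -/

section NullParallel

variable {ι : Type*} [Fintype ι] [DecidableEq ι]
variable {G T : EuclideanSpace ℝ ι → Matrix ι ι ℝ} {U : Set (EuclideanSpace ℝ ι)}
  {x : EuclideanSpace ℝ ι}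

/-- The first Bianchi identity. -/
lemma curvature_bianchi (hG : IsLocalMetric G U) (hx : x ∈ U) (i j k l : ι) :
    curvature G i j k l x + curvature G j k i l x + curvature G k i j l x = 0 := by
  have hs : ∀ a b c, christoffel G a b c =ᶠ[𝓝 x] christoffel G a c b := fun a b c =>
    (hG.mem_nhds hx).mono fun y hy => hG.christoffel_symm hy a b c
  have hΓ : ∀ m, christoffel G m j i x = christoffel G m i j x ∧
      christoffel G m k i x = christoffel G m i k x ∧
      christoffel G m k j x = christoffel G m j k x := fun m =>
    ⟨hG.christoffel_symm hx m j i, hG.christoffel_symm hx m k i, hG.christoffel_symm hx m k j⟩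
  simp only [curvature, Finset.sum_sub_distrib, fun m => (hΓ m).1, fun m => (hΓ m).2.1,
    fun m => (hΓ m).2.2]
  rw [pd_congr (hs l j i) k, pd_congr (hs l k i) j, pd_congr (hs l k j) i]
  ring

lemma riemann_antisymm_left (i j k l : ι) : riemann G i j k l x = -riemann G j i k l x := by
  simp only [riemann, ← Finset.sum_neg_distrib]
  exact Finset.sum_congr rfl fun m _ => by rw [curvature_antisymm]; ring

/-- The pair symmetry of the curvature tensor. -/
lemma riemann_pair_symm (hG : IsLocalMetric G U) (hx : x ∈ U) (i j k l : ι) :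
    riemann G i j k l x = riemann G k l i j x := by
  have hB : ∀ i j k l, riemann G i j k l x + riemann G j k i l x + riemann G k i j l x = 0 := by
    intro i j k l
    simp only [riemann, ← Finset.sum_add_distrib, ← add_mul, curvature_bianchi hG hx, zero_mul,
      Finset.sum_const_zero]
  have h1 := hB i j k l
  have h2 := hB j k l i
  have h3 := hB k l i j
  have h4 := hB l i j k
  have a := riemann_antisymm hG hx
  have b := fun i j k l => riemann_antisymm_left (G := G) (x := x) i j k l
  linarith [a i j k l, a j k i l, a k i j l, a j k l i, a k l j i, a l j k i, a k l i j,
    a l i k j, a i k l j, a l i j k, a i j l k, a j l i k, b k i j l, b l j k i, b i k l j,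
    b j l i k, b i k j l, b j l k i, b l i j k, b i j k l, b j k l i]

/-- The covariant derivative `∇_k S_{lij}` of a `(0,3)`-tensor. -/
noncomputable def cov3 (G : EuclideanSpace ℝ ι → Matrix ι ι ℝ)
    (S : ι → ι → ι → EuclideanSpace ℝ ι → ℝ) (k l i j : ι) (x : EuclideanSpace ℝ ι) : ℝ :=
  pd k (S l i j) x - ∑ m, (christoffel G m k l x * S m i j x + christoffel G m k i x * S l m j x
    + christoffel G m k j x * S l i m x)

/-- The divergence of `S^k_{ij} = g^{kl} S_{lij}` is the metric contraction of `∇_k S_{lij}`. -/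
lemma div_raise (hG : IsLocalMetric G U) (hx : x ∈ U) {S : ι → ι → ι → EuclideanSpace ℝ ι → ℝ}
    (hS : ∀ l i j, ContDiffAt ℝ ∞ (S l i j) x) (i j : ι) :
    ∑ k, (pd k (fun y => ∑ l, (G y)⁻¹ k l * S l i j y) x
      + ∑ m, christoffel G k k m x * ∑ l, (G x)⁻¹ m l * S l i j x
      - ∑ m, christoffel G m k i x * ∑ l, (G x)⁻¹ k l * S l m j x
      - ∑ m, christoffel G m k j x * ∑ l, (G x)⁻¹ k l * S l i m x)
      = ∑ k, ∑ l, (G x)⁻¹ k l * cov3 G S k l i j x := by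
  refine Finset.sum_congr rfl fun k _ => ?_
  rw [hG.pd_raise hx (fun b => hS b i j) k k]
  have e : ∀ F : ι → ι → ℝ, ∑ m, christoffel G m k i x * ∑ l, (G x)⁻¹ k l * F l m =
      ∑ l, (G x)⁻¹ k l * ∑ m, christoffel G m k i x * F l m := by
    intro F
    simp only [Finset.mul_sum]
    rw [Finset.sum_comm]
    exact Finset.sum_congr rfl fun _ _ => Finset.sum_congr rfl fun _ _ => by ring
  have e' : ∀ F : ι → ι → ℝ, ∑ m, christoffel G m k j x * ∑ l, (G x)⁻¹ k l * F l m =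
      ∑ l, (G x)⁻¹ k l * ∑ m, christoffel G m k j x * F l m := by
    intro F
    simp only [Finset.mul_sum]
    rw [Finset.sum_comm]
    exact Finset.sum_congr rfl fun _ _ => Finset.sum_congr rfl fun _ _ => by ring
  rw [e (fun l m => S l m j x), e' (fun l m => S l i m x)]
  simp only [cov3, Finset.sum_add_distrib, mul_sub, mul_add, Finset.sum_sub_distrib]
  ring

/-- A field `L` of spaces of covectors on `U` that is totally null and parallel for the metric `G`,
in the coordinates of a chart. -/
structure IsNullParallel (G : EuclideanSpace ℝ ι → Matrix ι ι ℝ) (U : Set (EuclideanSpace ℝ ι))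
    (L : EuclideanSpace ℝ ι → Submodule ℝ (ι → ℝ)) : Prop where
  null : ∀ x ∈ U, ∀ a ∈ L x, ∀ b ∈ L x, ∑ i, ∑ j, (G x)⁻¹ i j * (a i * b j) = 0
  parallel : ∀ a : ι → EuclideanSpace ℝ ι → ℝ, (∀ i, ∀ y ∈ U, ContDiffAt ℝ ∞ (a i) y) →
    (∀ y ∈ U, (fun i => a i y) ∈ L y) → ∀ x ∈ U, ∀ k,
      (fun i => pd k (a i) x - ∑ m, christoffel G m k i x * a m x) ∈ L x

/-- `T` is a smooth symmetric tensor on `U` whose rows lie in the field `L` of covectors. -/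
structure IsTensorIn (U : Set (EuclideanSpace ℝ ι)) (L : EuclideanSpace ℝ ι → Submodule ℝ (ι → ℝ))
    (T : EuclideanSpace ℝ ι → Matrix ι ι ℝ) : Prop where
  smooth : ∀ x ∈ U, ∀ i j, ContDiffAt ℝ ∞ (fun y => T y i j) x
  symm : ∀ x ∈ U, ∀ i j, T x i j = T x j i
  mem : ∀ x ∈ U, ∀ i, T x i ∈ L x

variable {L : EuclideanSpace ℝ ι → Submodule ℝ (ι → ℝ)}

lemma sum_smul_mem {x : EuclideanSpace ℝ ι} {F : ι → ι → ℝ} (c : ι → ℝ)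
    (hF : ∀ m, F m ∈ L x) : (fun j => ∑ m, c m * F m j) ∈ L x := by
  have : (fun j => ∑ m, c m * F m j) = ∑ m, c m • F m := by
    ext j; simp
  rw [this]
  exact Submodule.sum_mem _ fun m _ => Submodule.smul_mem _ _ (hF m)

namespace IsNullParallel

/-- Contracting two indices that both run in `L` gives zero. -/
lemma mul_inv_mul_eq_zero (hL : IsNullParallel G U L) (hx : x ∈ U) {A B : Matrix ι ι ℝ}
    (hA : ∀ a, A a ∈ L x) (hB : ∀ b, (fun a => B a b) ∈ L x) : A * (G x)⁻¹ * B = 0 := by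
  ext i j
  rw [Matrix.zero_apply, ← hL.null x hx _ (hA i) _ (hB j), Matrix.mul_apply]
  simp only [Matrix.mul_apply, Finset.sum_mul]
  rw [Finset.sum_comm]
  exact Finset.sum_congr rfl fun _ _ => Finset.sum_congr rfl fun _ _ => by ring

/-- A symmetric tensor with values in a null distribution is trace-free, because the corresponding
endomorphism squares to zero. -/
lemma trace_eq_zero (hL : IsNullParallel G U L) (hx : x ∈ U)
    {A : Matrix ι ι ℝ} (hA : ∀ a, A a ∈ L x) (hs : ∀ i j, A i j = A j i) :
    ∑ i, ∑ j, (G x)⁻¹ i j * A i j = 0 := by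
  have h0 : A * (G x)⁻¹ * A = 0 := hL.mul_inv_mul_eq_zero hx hA fun b => by
    have : (fun a => A a b) = A b := funext fun a => hs a b
    rw [this]; exact hA b
  have hn : IsNilpotent ((G x)⁻¹ * A) := ⟨2, by
    rw [pow_two, Matrix.mul_assoc, ← Matrix.mul_assoc A, h0, Matrix.mul_zero]⟩
  have ht := (Matrix.isNilpotent_trace_of_isNilpotent hn).eq_zero
  rw [← ht, Matrix.trace]
  simp only [Matrix.diag_apply, Matrix.mul_apply]
  exact Finset.sum_congr rfl fun i _ => Finset.sum_congr rfl fun j _ => by rw [hs i j]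

lemma trace_eq_zero_of_row_col (hL : IsNullParallel G U L) (hx : x ∈ U) {A B : Matrix ι ι ℝ}
    (hA : ∀ a, A a ∈ L x) (hB : ∀ k, (fun a => B a k) ∈ L x) :
    ((G x)⁻¹ * A * (G x)⁻¹ * B).trace = 0 := by
  rw [Matrix.mul_assoc, Matrix.mul_assoc, ← Matrix.mul_assoc A,
    hL.mul_inv_mul_eq_zero hx hA hB, Matrix.mul_zero, Matrix.trace_zero]

lemma trace_eq_zero_of_col_row (hL : IsNullParallel G U L) (hx : x ∈ U) {A B : Matrix ι ι ℝ}
    (hA : ∀ k, (fun a => A a k) ∈ L x) (hB : ∀ a, B a ∈ L x) :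
    ((G x)⁻¹ * A * (G x)⁻¹ * B).trace = 0 := by
  rw [Matrix.mul_assoc, Matrix.trace_mul_comm, ← Matrix.mul_assoc]
  exact hL.trace_eq_zero_of_row_col hx hB hA

end IsNullParallel

namespace IsTensorIn

lemma symm_nhds (hT : IsTensorIn U L T) (hG : IsLocalMetric G U) (hx : x ∈ U) :
    ∀ᶠ y in 𝓝 x, ∀ i j, T y i j = T y j i :=
  (hG.mem_nhds hx).mono hT.symm

lemma mem_col (hT : IsTensorIn U L T) (hx : x ∈ U) (j : ι) : (fun i => T x i j) ∈ L x := by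
  have : (fun a => T x a j) = T x j := funext fun a => hT.symm x hx a j
  rw [this]; exact hT.mem x hx j

lemma cov2_mem (hT : IsTensorIn U L T) (hL : IsNullParallel G U L)
    (hx : x ∈ U) (k i : ι) : (fun j => cov2 G T k i j x) ∈ L x := by
  have h1 := hL.parallel (fun j y => T y i j) (fun j y hy => hT.smooth y hy i j)
    (fun y hy => hT.mem y hy i) x hx k
  have h2 := sum_smul_mem (L := L) (x := x) (fun m => christoffel G m k i x)
    (fun m => hT.mem x hx m)
  convert (L x).sub_mem h1 h2 using 1
  ext j
  simp only [cov2, Pi.sub_apply, Finset.sum_add_distrib]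
  ring

lemma cov2_symm (hT : IsTensorIn U L T) (hG : IsLocalMetric G U) (hx : x ∈ U) (k i j : ι) :
    cov2 G T k i j x = cov2 G T k j i x :=
  AmbientWalker.cov2_symm (hT.symm_nhds hG hx) k i j

lemma cov2_mem_left (hT : IsTensorIn U L T) (hG : IsLocalMetric G U) (hL : IsNullParallel G U L)
    (hx : x ∈ U) (k j : ι) : (fun i => cov2 G T k i j x) ∈ L x := by
  have := hT.cov2_mem hL hx k j
  convert this using 2 with i
  exact hT.cov2_symm hG hx k i j

lemma hess2_mem (hT : IsTensorIn U L T) (hG : IsLocalMetric G U) (hL : IsNullParallel G U L)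
    (hx : x ∈ U) (k l i : ι) : (fun j => hess2 G T k l i j x) ∈ L x := by
  have h1 := hL.parallel (fun j => cov2 G T l i j)
    (fun j y hy => contDiffAt_cov2 hG hy (hT.smooth y hy) l i j)
    (fun y hy => hT.cov2_mem hL hy l i) x hx k
  have h2 := sum_smul_mem (L := L) (x := x) (fun m => christoffel G m k l x)
    (fun m => hT.cov2_mem hL hx m i)
  have h3 := sum_smul_mem (L := L) (x := x) (fun m => christoffel G m k i x)
    (fun m => hT.cov2_mem hL hx l m)
  convert (L x).sub_mem ((L x).sub_mem h1 h2) h3 using 1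
  ext j
  simp only [hess2, Pi.sub_apply, Finset.sum_add_distrib]
  ring

lemma raise2_eq (hG : IsLocalMetric G U) (hx : x ∈ U) :
    (Matrix.of fun k l => raise2 G T k l x) = (G x)⁻¹ * T x * (G x)⁻¹ := by
  ext k l
  simp only [raise2, Matrix.of_apply, Matrix.mul_apply, Finset.sum_mul]
  rw [Finset.sum_comm]
  exact Finset.sum_congr rfl fun q _ => Finset.sum_congr rfl fun _ _ => by
    rw [hG.inv_symm hx l q]; ring

lemma raise2_symm (hT : IsTensorIn U L T) (hx : x ∈ U) (k l : ι) :
    raise2 G T k l x = raise2 G T l k x := by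
  unfold raise2
  rw [Finset.sum_comm]
  exact Finset.sum_congr rfl fun _ _ => Finset.sum_congr rfl fun q _ => by
    rw [hT.symm x hx q]; ring

lemma mul_raise2_eq_one (hT : IsTensorIn U L T) (hG : IsLocalMetric G U)
    (hL : IsNullParallel G U L) (hx : x ∈ U) :
    (G x + T x) * ((G x)⁻¹ - Matrix.of fun k l => raise2 G T k l x) = 1 := by
  have h0 := hL.mul_inv_mul_eq_zero hx (hT.mem x hx) (hT.mem_col hx)
  rw [raise2_eq hG hx, Matrix.add_mul, Matrix.mul_sub, Matrix.mul_sub, hG.mul_inv hx,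
    ← Matrix.mul_assoc, ← Matrix.mul_assoc, ← Matrix.mul_assoc, ← Matrix.mul_assoc,
    hG.mul_inv hx, h0]
  simp

/-- The inverse of `g + h` is `g^{kl} - h^{kl}`. -/
lemma inv_add (hT : IsTensorIn U L T) (hG : IsLocalMetric G U) (hL : IsNullParallel G U L)
    (hx : x ∈ U) : (G x + T x)⁻¹ = (G x)⁻¹ - Matrix.of fun k l => raise2 G T k l x :=
  Matrix.inv_eq_right_inv (hT.mul_raise2_eq_one hG hL hx)

lemma isLocalMetric_add (hT : IsTensorIn U L T) (hG : IsLocalMetric G U)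
    (hL : IsNullParallel G U L) : IsLocalMetric (fun y => G y + T y) U where
  isOpen := hG.isOpen
  smooth x hx i j := (hG.smooth x hx i j).add (hT.smooth x hx i j)
  symm x hx i j := by simp only [Matrix.add_apply, hG.symm x hx i j, hT.symm x hx i j]
  det x hx := (Matrix.isUnit_det_of_right_inverse (hT.mul_raise2_eq_one hG hL hx)).ne_zero

end IsTensorIn

end NullParallel

/-! ### The connection of `g + h` -/

section Perturbation

variable {ι : Type*} [Fintype ι] [DecidableEq ι]
variable {G T : EuclideanSpace ℝ ι → Matrix ι ι ℝ} {U : Set (EuclideanSpace ℝ ι)}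
  {x : EuclideanSpace ℝ ι} {L : EuclideanSpace ℝ ι → Submodule ℝ (ι → ℝ)}

/-- The tensor `h_l^m ∇_m h_{ij}`. -/
noncomputable def quadTerm (G T : EuclideanSpace ℝ ι → Matrix ι ι ℝ) (l i j : ι)
    (x : EuclideanSpace ℝ ι) : ℝ :=
  ∑ a, ∑ b, (G x)⁻¹ a b * (T x l a * cov2 G T b i j x)

/-- The tensor `S_{lij}` for which `g^{kl} S_{lij}` is the difference of the Christoffel symbols
of `g + h` and `g`, when `h` takes values in a null parallel distribution. -/
noncomputable def connDiff (G T : EuclideanSpace ℝ ι → Matrix ι ι ℝ) (l i j : ι)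
    (x : EuclideanSpace ℝ ι) : ℝ :=
  (1 / 2) * (cov2 G T i j l x + cov2 G T j i l x - cov2 G T l i j x + quadTerm G T l i j x)

lemma contDiffAt_quadTerm (hG : IsLocalMetric G U) (hx : x ∈ U)
    (hT : ∀ i j, ContDiffAt ℝ ∞ (fun y => T y i j) x) (l i j : ι) :
    ContDiffAt ℝ ∞ (quadTerm G T l i j) x :=
  ContDiffAt.sum fun a _ => ContDiffAt.sum fun b _ =>
    (hG.contDiffAt_inv hx a b).mul ((hT l a).mul (contDiffAt_cov2 hG hx hT b i j))

lemma contDiffAt_connDiff (hG : IsLocalMetric G U) (hx : x ∈ U)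
    (hT : ∀ i j, ContDiffAt ℝ ∞ (fun y => T y i j) x) (l i j : ι) :
    ContDiffAt ℝ ∞ (connDiff G T l i j) x :=
  contDiffAt_const.mul ((((contDiffAt_cov2 hG hx hT i j l).add
    (contDiffAt_cov2 hG hx hT j i l)).sub (contDiffAt_cov2 hG hx hT l i j)).add
    (contDiffAt_quadTerm hG hx hT l i j))

namespace IsTensorIn

lemma mulVec_eq_zero (hT : IsTensorIn U L T) (hL : IsNullParallel G U L) (hx : x ∈ U) {v : ι → ℝ}
    (hv : v ∈ L x) : (T x * (G x)⁻¹).mulVec v = 0 := by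
  ext i
  rw [Pi.zero_apply, ← hL.null x hx _ (hT.mem x hx i) _ hv]
  simp only [Matrix.mulVec, dotProduct, Matrix.mul_apply, Finset.sum_mul]
  rw [Finset.sum_comm]
  exact Finset.sum_congr rfl fun _ _ => Finset.sum_congr rfl fun _ _ => by ring

lemma quadTerm_eq (l i j : ι) :
    quadTerm G T l i j x = (T x * (G x)⁻¹).mulVec (fun b => cov2 G T b i j x) l := by
  simp only [quadTerm, Matrix.mulVec, dotProduct, Matrix.mul_apply, Finset.sum_mul]
  rw [Finset.sum_comm]
  exact Finset.sum_congr rfl fun _ _ => Finset.sum_congr rfl fun _ _ => by ring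

/-- The difference of the connections of `g + h` and `g`. Raising the index with `g^{kl} - h^{kl}`
instead of `g^{kl}` only affects the term `∇_l h_{ij}`, whose index `l` does not run in `L`. -/
lemma christoffel_add (hT : IsTensorIn U L T) (hG : IsLocalMetric G U)
    (hL : IsNullParallel G U L) (hx : x ∈ U) (k i j : ι) :
    christoffel (fun y => G y + T y) k i j x =
      christoffel G k i j x + ∑ l, (G x)⁻¹ k l * connDiff G T l i j x := by
  have hG' := hT.isLocalMetric_add hG hL
  set u : ι → ℝ := fun l => cov2 G T i j l x
  set v : ι → ℝ := fun l => cov2 G T j i l x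
  set w : ι → ℝ := fun l => cov2 G T l i j x
  set Γ : ι → ℝ := fun m => christoffel G m i j x with hΓ
  have dG : ∀ i j, DifferentiableAt ℝ (fun y => G y i j) x := fun i j =>
    differentiableAt_of_smooth (hG.smooth x hx i j)
  have dT : ∀ i j, DifferentiableAt ℝ (fun y => T y i j) x := fun i j =>
    differentiableAt_of_smooth (hT.smooth x hx i j)
  have h1 : (G x + T x).mulVec (fun m => christoffel (fun y => G y + T y) m i j x)
      = (G x + T x).mulVec Γ + (1 / 2 : ℝ) • (u + v - w) := by
    ext l
    have e1 := hG'.sum_metric_mul_christoffel hx i j l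
    have e2 := hG.sum_metric_mul_christoffel hx i j l
    simp only [Matrix.add_apply] at e1
    have e3 : (G x + T x).mulVec Γ l = ∑ m, G x l m * christoffel G m i j x
        + ∑ m, T x l m * christoffel G m i j x := by
      simp only [Matrix.mulVec, dotProduct, Matrix.add_apply, add_mul, Finset.sum_add_distrib, hΓ]
    rw [Pi.add_apply, e3, e2]
    refine e1.trans ?_
    simp only [pd_add (dG _ _) (dT _ _)]
    simp only [u, v, w, Pi.smul_apply, Pi.add_apply, Pi.sub_apply, smul_eq_mul, cov2,
      Finset.sum_add_distrib, hG.christoffel_symm hx _ j i, hG.christoffel_symm hx _ l i,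
      hG.christoffel_symm hx _ l j]
    have s1 : ∑ m, christoffel G m i j x * T x m l = ∑ m, T x l m * christoffel G m i j x :=
      Finset.sum_congr rfl fun m _ => by rw [hT.symm x hx m l, mul_comm]
    have s2 : ∑ m, christoffel G m i l x * T x m j = ∑ m, christoffel G m i l x * T x j m :=
      Finset.sum_congr rfl fun m _ => by rw [hT.symm x hx m j]
    rw [s1, s2]
    ring
  have h2 : (fun m => christoffel (fun y => G y + T y) m i j x)
      = Γ + (G x + T x)⁻¹.mulVec ((1 / 2 : ℝ) • (u + v - w)) := by
    have := congrArg ((G x + T x)⁻¹.mulVec) h1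
    rw [Matrix.mulVec_add, Matrix.mulVec_mulVec, Matrix.mulVec_mulVec, hG'.inv_mul hx,
      Matrix.one_mulVec, Matrix.one_mulVec] at this
    exact this
  have hu : (T x * (G x)⁻¹).mulVec u = 0 := hT.mulVec_eq_zero hL hx (hT.cov2_mem hL hx i j)
  have hv : (T x * (G x)⁻¹).mulVec v = 0 := hT.mulVec_eq_zero hL hx (hT.cov2_mem hL hx j i)
  have h3 : (fun l => connDiff G T l i j x)
      = (1 / 2 : ℝ) • (u + v - w) + (1 / 2 : ℝ) • (T x * (G x)⁻¹).mulVec w := by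
    ext l
    simp only [connDiff, quadTerm_eq, u, v, w, Pi.smul_apply, Pi.add_apply, Pi.sub_apply,
      smul_eq_mul]
    ring
  have h4 : (fun m => christoffel (fun y => G y + T y) m i j x)
      = Γ + (G x)⁻¹.mulVec (fun l => connDiff G T l i j x) := by
    rw [h2, h3, hT.inv_add hG hL hx, raise2_eq hG hx, Matrix.sub_mulVec, Matrix.mulVec_add,
      Matrix.mul_assoc, ← Matrix.mulVec_mulVec _ (G x)⁻¹]
    simp only [Matrix.mulVec_smul, Matrix.mulVec_sub, Matrix.mulVec_add, hu, hv]
    simp only [Matrix.mulVec_zero, add_zero, zero_sub, smul_neg, sub_neg_eq_add]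
  exact congrFun h4 k

/-- The Christoffel symbols of `g + h` and `g` have the same trace: the two metrics have the same
volume form. -/
lemma trace_connDiff (hT : IsTensorIn U L T) (hG : IsLocalMetric G U)
    (hL : IsNullParallel G U L) (hx : x ∈ U) (j : ι) :
    ∑ k, ∑ l, (G x)⁻¹ k l * connDiff G T l k j x = 0 := by
  have h1 : ∑ k, ∑ l, (G x)⁻¹ k l * cov2 G T k j l x
      = ∑ k, ∑ l, (G x)⁻¹ k l * cov2 G T l k j x := by
    rw [Finset.sum_comm]
    exact Finset.sum_congr rfl fun k _ => Finset.sum_congr rfl fun l _ => by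
      rw [hG.inv_symm hx l k, hT.cov2_symm hG hx l j k]
  have h2 : ∑ k, ∑ l, (G x)⁻¹ k l * cov2 G T j k l x = 0 :=
    hL.trace_eq_zero hx (A := Matrix.of fun k l => cov2 G T j k l x)
      (fun a => hT.cov2_mem hL hx j a) (fun a b => hT.cov2_symm hG hx j a b)
  have h3 : ∑ k, ∑ l, (G x)⁻¹ k l * quadTerm G T l k j x = 0 := by
    have e : ∀ k l, (G x)⁻¹ k l * quadTerm G T l k j x =
        ∑ b, (G x)⁻¹ k l * (∑ a, (G x)⁻¹ a b * T x l a) * cov2 G T b k j x := by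
      intro k l
      rw [quadTerm, Finset.sum_comm, Finset.mul_sum]
      refine Finset.sum_congr rfl fun b _ => ?_
      rw [mul_assoc, Finset.sum_mul]
      exact congrArg _ (Finset.sum_congr rfl fun _ _ => by ring)
    simp only [e]
    have e2 : ∀ k, ∑ l, ∑ b, (G x)⁻¹ k l * (∑ a, (G x)⁻¹ a b * T x l a) * cov2 G T b k j x
        = ∑ b, ∑ l, (G x)⁻¹ k l * (∑ a, (G x)⁻¹ a b * T x l a) * cov2 G T b k j x :=
      fun k => Finset.sum_comm
    simp only [e2]
    rw [Finset.sum_comm]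
    refine Finset.sum_eq_zero fun b _ => ?_
    have hm : (fun l => ∑ a, (G x)⁻¹ a b * T x l a) ∈ L x :=
      sum_smul_mem (L := L) (F := fun a l => T x l a) _ fun a => hT.mem_col hx a
    rw [← hL.null x hx _ (hT.cov2_mem_left hG hL hx b j) _ hm]
    exact Finset.sum_congr rfl fun _ _ => Finset.sum_congr rfl fun _ _ => by ring
  have e : ∀ k l, (G x)⁻¹ k l * connDiff G T l k j x = (1 / 2) * ((G x)⁻¹ k l * cov2 G T k j l x
      + (G x)⁻¹ k l * cov2 G T j k l x - (G x)⁻¹ k l * cov2 G T l k j x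
      + (G x)⁻¹ k l * quadTerm G T l k j x) := fun k l => by rw [connDiff]; ring
  simp only [e, ← Finset.mul_sum, Finset.sum_add_distrib, Finset.sum_sub_distrib]
  rw [h1, h2, h3]
  ring

/-- The Ricci tensor of `g + h` in terms of the difference of the connections. -/
lemma ricci_add (hT : IsTensorIn U L T) (hG : IsLocalMetric G U)
    (hL : IsNullParallel G U L) (hx : x ∈ U) (i j : ι) :
    ricci (fun y => G y + T y) i j x = ricci G i j x
      + ∑ k, ∑ l, (G x)⁻¹ k l * cov3 G (connDiff G T) k l i j x
      - ∑ k, ∑ m, (∑ l, (G x)⁻¹ m l * connDiff G T l k j x)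
          * (∑ l, (G x)⁻¹ k l * connDiff G T l i m x) := by
  set C : ι → ι → ι → EuclideanSpace ℝ ι → ℝ := fun k i j y =>
    ∑ l, (G y)⁻¹ k l * connDiff G T l i j y with hC
  have hchr : ∀ k i j, christoffel (fun y => G y + T y) k i j =ᶠ[𝓝 x]
      fun y => christoffel G k i j y + C k i j y := fun k i j =>
    (hG.mem_nhds hx).mono fun y hy => hT.christoffel_add hG hL hy k i j
  have hchr0 : ∀ k i j, christoffel (fun y => G y + T y) k i j x =
      christoffel G k i j x + C k i j x := fun k i j => (hchr k i j).self_of_nhds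
  have dΓ : ∀ k i j, DifferentiableAt ℝ (christoffel G k i j) x := fun k i j =>
    differentiableAt_of_smooth (hG.contDiffAt_christoffel hx k i j)
  have dC : ∀ k i j, DifferentiableAt ℝ (C k i j) x := fun k i j =>
    differentiableAt_of_smooth (ContDiffAt.sum fun l _ => (hG.contDiffAt_inv hx k l).mul
      (contDiffAt_connDiff hG hx (hT.smooth x hx) l i j))
  have htr : ∀ j, ∑ k, C k k j x = 0 := fun j => hT.trace_connDiff hG hL hx j
  have hdtr : ∑ k, pd i (C k k j) x = 0 := by
    rw [← pd_sum _ (fun k => dC k k j), pd_congr (g := fun _ => 0)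
      ((hG.mem_nhds hx).mono fun y hy => hT.trace_connDiff hG hL hy j), pd_const]
  have hdiv := div_raise hG hx (contDiffAt_connDiff hG hx (hT.smooth x hx)) i j
  rw [← hdiv]
  change _ = ricci G i j x + ∑ k, (pd k (C k i j) x + ∑ m, christoffel G k k m x * C m i j x
    - ∑ m, christoffel G m k i x * C k m j x - ∑ m, christoffel G m k j x * C k i m x)
    - ∑ k, ∑ m, C m k j x * C k i m x
  have s1 : ∑ k, ∑ m, christoffel G m i j x * C k k m x = 0 := by
    rw [Finset.sum_comm]
    simp only [← Finset.mul_sum, htr, mul_zero, Finset.sum_const_zero]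
  have s2 : ∑ k, ∑ m, C m i j x * C k k m x = 0 := by
    rw [Finset.sum_comm]
    simp only [← Finset.mul_sum, htr, mul_zero, Finset.sum_const_zero]
  have s3 : ∑ k, ∑ m, C m k j x * christoffel G k i m x =
      ∑ k, ∑ m, christoffel G m k i x * C k m j x := by
    rw [Finset.sum_comm]
    exact Finset.sum_congr rfl fun k _ => Finset.sum_congr rfl fun m _ => by
      rw [hG.christoffel_symm hx m i k, mul_comm]
  have s4 : ∑ k, ∑ m, C m i j x * christoffel G k k m x =
      ∑ k, ∑ m, christoffel G k k m x * C m i j x :=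
    Finset.sum_congr rfl fun k _ => Finset.sum_congr rfl fun m _ => mul_comm _ _
  simp only [ricci, curvature, pd_congr (hchr _ _ _), hchr0, pd_add (dΓ _ _ _) (dC _ _ _),
    mul_add, add_mul, Finset.sum_add_distrib, Finset.sum_sub_distrib, s1, s2, s3, s4, hdtr]
  ring

end IsTensorIn

end Perturbation

/-! ### The Ricci tensor of `g + h` -/

section RicciPerturbation

variable {ι : Type*} [Fintype ι] [DecidableEq ι]
variable {G T : EuclideanSpace ℝ ι → Matrix ι ι ℝ} {U : Set (EuclideanSpace ℝ ι)}
  {x : EuclideanSpace ℝ ι} {L : EuclideanSpace ℝ ι → Submodule ℝ (ι → ℝ)}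

/-- The Leibniz rule for `h_l^m ∇_m h_{ij}`. -/
lemma cov3_quadTerm (hG : IsLocalMetric G U) (hx : x ∈ U)
    (hT : ∀ i j, ContDiffAt ℝ ∞ (fun y => T y i j) x) (k l i j : ι) :
    cov3 G (quadTerm G T) k l i j x =
      ∑ a, ∑ b, (G x)⁻¹ a b * (cov2 G T k l a x * cov2 G T b i j x + T x l a * hess2 G T k b i j x)
      := by
  have hc := contDiffAt_cov2 hG hx hT
  have h1 := hG.pd_contract hx (S := fun a b y => T y l a * cov2 G T b i j y)
    (fun a b => (hT l a).mul (hc b i j)) k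
  have h2 : pd k (quadTerm G T l i j) x = _ := h1
  have e : ∀ F : ι → ι → ι → ℝ, ∀ c : ι → ℝ,
      ∑ m, c m * ∑ a, ∑ b, (G x)⁻¹ a b * F m a b = ∑ a, ∑ b, (G x)⁻¹ a b * ∑ m, c m * F m a b := by
    intro F c
    simp only [Finset.mul_sum]
    rw [Finset.sum_comm]
    refine Finset.sum_congr rfl fun a _ => ?_
    rw [Finset.sum_comm]
    exact Finset.sum_congr rfl fun _ _ => Finset.sum_congr rfl fun _ _ => by ring
  rw [cov3, h2, Finset.sum_add_distrib, Finset.sum_add_distrib]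
  simp only [quadTerm]
  rw [e (fun m a b => T x m a * cov2 G T b i j x), e (fun m a b => T x l a * cov2 G T b m j x),
    e (fun m a b => T x l a * cov2 G T b i m x)]
  simp only [← Finset.sum_add_distrib, ← Finset.sum_sub_distrib, ← mul_add, ← mul_sub]
  refine Finset.sum_congr rfl fun a _ => Finset.sum_congr rfl fun b _ => ?_
  rw [pd_mul (differentiableAt_of_smooth (hT l a)) (differentiableAt_of_smooth (hc b i j))]
  have ec : cov2 G T k l a x = pd k (fun y => T y l a) x - ∑ m, (christoffel G m k l x * T x m a
    + christoffel G m k a x * T x l m) := rfl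
  rw [ec, hess2]
  congr 1
  simp only [mul_sub, sub_mul, Finset.mul_sum, Finset.sum_mul, Finset.sum_add_distrib, mul_add,
    add_mul]
  ring_nf

lemma cov3_connDiff (hG : IsLocalMetric G U) (hx : x ∈ U)
    (hT : ∀ i j, ContDiffAt ℝ ∞ (fun y => T y i j) x) (k l i j : ι) :
    cov3 G (connDiff G T) k l i j x = (1 / 2) * (hess2 G T k i j l x + hess2 G T k j i l x
      - hess2 G T k l i j x + cov3 G (quadTerm G T) k l i j x) := by
  have d := fun l i j => differentiableAt_of_smooth (contDiffAt_cov2 hG hx hT l i j)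
  have dq := differentiableAt_of_smooth (contDiffAt_quadTerm hG hx hT l i j)
  have e : pd k (connDiff G T l i j) x = (1 / 2) * (pd k (cov2 G T i j l) x
      + pd k (cov2 G T j i l) x - pd k (cov2 G T l i j) x + pd k (quadTerm G T l i j) x) := by
    have e0 : connDiff G T l i j = fun y => (1 / 2) * (cov2 G T i j l y + cov2 G T j i l y
      - cov2 G T l i j y + quadTerm G T l i j y) := rfl
    rw [e0, pd_const_mul ((((d _ _ _).fun_add (d _ _ _)).fun_sub (d _ _ _)).fun_add dq),
      pd_add (((d _ _ _).fun_add (d _ _ _)).fun_sub (d _ _ _)) dq,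
      pd_sub ((d _ _ _).fun_add (d _ _ _)) (d _ _ _), pd_add (d _ _ _) (d _ _ _)]
  simp only [cov3, hess2, e]
  have hsum : ∀ a b c d f : ι → ℝ, (∀ m, a m = (1 / 2) * (b m + c m - d m + f m)) →
      ∑ m, a m = (1 / 2) * (∑ m, b m + ∑ m, c m - ∑ m, d m + ∑ m, f m) := by
    intro a b c d f h
    simp only [h, ← Finset.mul_sum, Finset.sum_add_distrib, Finset.sum_sub_distrib]
  rw [hsum _ (fun m => christoffel G m k i x * cov2 G T m j l x
      + christoffel G m k j x * cov2 G T i m l x + christoffel G m k l x * cov2 G T i j m x)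
    (fun m => christoffel G m k j x * cov2 G T m i l x
      + christoffel G m k i x * cov2 G T j m l x + christoffel G m k l x * cov2 G T j i m x)
    (fun m => christoffel G m k l x * cov2 G T m i j x
      + christoffel G m k i x * cov2 G T l m j x + christoffel G m k j x * cov2 G T l i m x)
    (fun m => christoffel G m k l x * quadTerm G T m i j x
      + christoffel G m k i x * quadTerm G T l m j x + christoffel G m k j x * quadTerm G T l i m x)
    (fun m => by simp only [connDiff]; ring)]
  ring

namespace IsTensorIn

/-- For a divergence-free tensor, `∇^l ∇_i h_{jl}` only involves the curvature. -/
lemma sum_inv_mul_hess2 (hT : IsTensorIn U L T) (hG : IsLocalMetric G U)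
    (hL : IsNullParallel G U L) (hR : ∀ i, (fun j => ricci G i j x) ∈ L x)
    (hdiv : ∀ y ∈ U, ∀ i, div2 G T i y = 0) (hx : x ∈ U) (i j : ι) :
    ∑ k, ∑ l, (G x)⁻¹ k l * hess2 G T k i j l x
      = ∑ k, ∑ l, riemann G k i j l x * raise2 G T k l x := by
  have hdiv' : ∀ y ∈ U, ∀ j, ∑ k, ∑ l, (G y)⁻¹ k l * cov2 G T k j l y = 0 := by
    intro y hy j
    rw [← hdiv y hy j, div2]
    exact Finset.sum_congr rfl fun k _ => Finset.sum_congr rfl fun l _ => by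
      rw [hT.cov2_symm hG hy k j l]
  have h1 : ∑ k, ∑ l, (G x)⁻¹ k l * hess2 G T i k j l x = 0 := by
    have hc := hG.pd_contract hx (S := fun k l => cov2 G T k j l)
      (fun k l => contDiffAt_cov2 hG hx (hT.smooth x hx) k j l) i
    rw [pd_congr (g := fun _ => 0) ((hG.mem_nhds hx).mono fun y hy => hdiv' y hy j), pd_const] at hc
    have h2 : ∑ k, ∑ l, (G x)⁻¹ k l * ∑ m, christoffel G m i j x * cov2 G T k m l x = 0 := by
      have : ∑ k, ∑ l, (G x)⁻¹ k l * ∑ m, christoffel G m i j x * cov2 G T k m l x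
          = ∑ m, christoffel G m i j x * ∑ k, ∑ l, (G x)⁻¹ k l * cov2 G T k m l x := by
        simp only [Finset.mul_sum]
        conv_rhs => rw [Finset.sum_comm]
        refine Finset.sum_congr rfl fun a _ => ?_
        conv_rhs => rw [Finset.sum_comm]
        exact Finset.sum_congr rfl fun _ _ => Finset.sum_congr rfl fun _ _ => by ring
      rw [this]
      simp only [hdiv' x hx, mul_zero, Finset.sum_const_zero]
    have h3 := congrArg₂ (· - ·) hc.symm h2
    simp only [sub_zero, ← Finset.sum_sub_distrib, ← mul_sub] at h3
    rw [← h3]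
    refine Finset.sum_congr rfl fun k _ => Finset.sum_congr rfl fun l _ => ?_
    simp only [hess2, Finset.sum_add_distrib]
    ring
  have h2 : ∑ k, ∑ l, (G x)⁻¹ k l * ∑ m, curvature G k i j m x * T x m l
      = ∑ k, ∑ l, riemann G k i j l x * raise2 G T k l x := by
    refine Finset.sum_congr rfl fun k _ => ?_
    have e := raise2_eq (T := T) hG hx
    set R : Matrix ι ι ℝ := Matrix.of fun k l => raise2 G T k l x with hRdef
    -- Lowering the second index of `h^{kl}` gives `h^k_m`.
    have e1 : G x * R.transpose = T x * (G x)⁻¹ := by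
      have : R.transpose = R := by
        ext a b; exact hT.raise2_symm hx b a
      rw [this, e, ← Matrix.mul_assoc, ← Matrix.mul_assoc, hG.mul_inv hx, Matrix.one_mul]
    have e2 : ∀ m, ∑ l, (G x)⁻¹ k l * T x m l = ∑ l, G x m l * raise2 G T k l x := by
      intro m
      have := congrFun (congrFun e1 m) k
      simp only [Matrix.mul_apply, Matrix.transpose_apply, hRdef, Matrix.of_apply] at this
      rw [this]
      exact Finset.sum_congr rfl fun l _ => by rw [hG.inv_symm hx k l, mul_comm]
    calc ∑ l, (G x)⁻¹ k l * ∑ m, curvature G k i j m x * T x m l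
        = ∑ m, curvature G k i j m x * ∑ l, (G x)⁻¹ k l * T x m l := by
          simp only [Finset.mul_sum]
          rw [Finset.sum_comm]
          exact Finset.sum_congr rfl fun _ _ => Finset.sum_congr rfl fun _ _ => by ring
      _ = ∑ l, riemann G k i j l x * raise2 G T k l x := by
          simp only [e2, riemann, Finset.mul_sum, Finset.sum_mul]
          rw [Finset.sum_comm]
          exact Finset.sum_congr rfl fun _ _ => Finset.sum_congr rfl fun _ _ => by ring
  have h3 : ∑ k, ∑ l, (G x)⁻¹ k l * ∑ m, curvature G k i l m x * T x j m = 0 := by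
    have : ∑ k, ∑ l, (G x)⁻¹ k l * ∑ m, curvature G k i l m x * T x j m
        = ∑ m, T x j m * ∑ k, ∑ l, (G x)⁻¹ k l * curvature G k i l m x := by
      simp only [Finset.mul_sum]
      conv_rhs => rw [Finset.sum_comm]
      refine Finset.sum_congr rfl fun a _ => ?_
      conv_rhs => rw [Finset.sum_comm]
      exact Finset.sum_congr rfl fun _ _ => Finset.sum_congr rfl fun _ _ => by ring
    rw [this, ← hL.null x hx _ (hT.mem x hx j) _ (hR i)]
    refine Finset.sum_congr rfl fun m _ => ?_
    rw [sum_inv_mul_curvature hG hx, Finset.mul_sum]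
    exact Finset.sum_congr rfl fun _ _ => by ring
  have h4 : ∀ k l, (G x)⁻¹ k l * hess2 G T k i j l x = (G x)⁻¹ k l * hess2 G T i k j l x
      + ((G x)⁻¹ k l * ∑ m, curvature G k i j m x * T x m l
        + (G x)⁻¹ k l * ∑ m, curvature G k i l m x * T x j m) := by
    intro k l
    rw [← mul_add, ← mul_add, ← Finset.sum_add_distrib, ← hess2_sub_hess2 hG hx (hT.smooth x hx)]
    ring
  simp only [h4, Finset.sum_add_distrib]
  rw [h1, h2, h3]
  ring

/-- The tensor `R_{kijl} h^{kl}` is symmetric in `i` and `j`. -/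
lemma sum_riemann_mul_raise2_symm (hT : IsTensorIn U L T) (hG : IsLocalMetric G U) (hx : x ∈ U)
    (i j : ι) : ∑ k, ∑ l, riemann G k j i l x * raise2 G T k l x
      = ∑ k, ∑ l, riemann G k i j l x * raise2 G T k l x := by
  rw [Finset.sum_comm]
  refine Finset.sum_congr rfl fun k _ => Finset.sum_congr rfl fun l _ => ?_
  rw [riemann_pair_symm hG hx l j i k, riemann_antisymm_left, riemann_antisymm hG hx k i l j,
    hT.raise2_symm hx l k, neg_neg]

/-- The divergence of the difference of the connections of `g + h` and `g`. -/
lemma div_connDiff (hT : IsTensorIn U L T) (hG : IsLocalMetric G U)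
    (hL : IsNullParallel G U L) (hR : ∀ i, (fun j => ricci G i j x) ∈ L x)
    (hdiv : ∀ y ∈ U, ∀ i, div2 G T i y = 0) (hx : x ∈ U) (i j : ι) :
    ∑ k, ∑ l, (G x)⁻¹ k l * cov3 G (connDiff G T) k l i j x
      = -(1 / 2) * box2 G T i j x + ∑ k, ∑ l, riemann G k i j l x * raise2 G T k l x
        + (1 / 2) * ∑ k, ∑ l, raise2 G T k l x * hess2 G T k l i j x := by
  have h1 := hT.sum_inv_mul_hess2 hG hL hR hdiv hx i j
  have h2 := hT.sum_inv_mul_hess2 hG hL hR hdiv hx j i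
  rw [hT.sum_riemann_mul_raise2_symm hG hx] at h2
  have h3 : ∑ k, ∑ l, (G x)⁻¹ k l * cov3 G (quadTerm G T) k l i j x
      = ∑ k, ∑ l, raise2 G T k l x * hess2 G T k l i j x := by
    have e : ∀ k l, (G x)⁻¹ k l * cov3 G (quadTerm G T) k l i j x
        = ∑ a, ((∑ b, (G x)⁻¹ a b * cov2 G T b i j x) * ((G x)⁻¹ k l * cov2 G T k l a x)
          + ∑ b, (G x)⁻¹ k l * (G x)⁻¹ a b * T x l a * hess2 G T k b i j x) := by
      intro k l
      rw [cov3_quadTerm hG hx (hT.smooth x hx), Finset.mul_sum]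
      refine Finset.sum_congr rfl fun a _ => ?_
      rw [Finset.sum_mul, ← Finset.sum_add_distrib, Finset.mul_sum]
      exact Finset.sum_congr rfl fun b _ => by ring
    simp only [e, Finset.sum_add_distrib]
    have z : ∑ k, ∑ l, ∑ a, (∑ b, (G x)⁻¹ a b * cov2 G T b i j x)
        * ((G x)⁻¹ k l * cov2 G T k l a x) = 0 := by
      simp_rw [fun k => Finset.sum_comm (s := Finset.univ) (t := Finset.univ)
        (f := fun l a => (∑ b, (G x)⁻¹ a b * cov2 G T b i j x)
          * ((G x)⁻¹ k l * cov2 G T k l a x))]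
      rw [Finset.sum_comm]
      refine Finset.sum_eq_zero fun a _ => ?_
      simp only [← Finset.mul_sum]
      have := hdiv x hx a
      rw [div2] at this
      rw [this, mul_zero]
    rw [z, zero_add]
    refine Finset.sum_congr rfl fun k _ => ?_
    simp only [raise2, Finset.sum_mul]
    simp_rw [fun l => Finset.sum_comm (s := Finset.univ) (t := Finset.univ)
      (f := fun a b => (G x)⁻¹ k l * (G x)⁻¹ a b * T x l a * hess2 G T k b i j x)]
    rw [Finset.sum_comm]
    exact Finset.sum_congr rfl fun b _ => Finset.sum_congr rfl fun _ _ =>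
      Finset.sum_congr rfl fun a _ => by rw [hG.inv_symm hx a b]
  have e : ∀ k l, (G x)⁻¹ k l * cov3 G (connDiff G T) k l i j x
      = (1 / 2) * ((G x)⁻¹ k l * hess2 G T k i j l x + (G x)⁻¹ k l * hess2 G T k j i l x
        - (G x)⁻¹ k l * hess2 G T k l i j x
        + (G x)⁻¹ k l * cov3 G (quadTerm G T) k l i j x) := fun k l => by
    rw [cov3_connDiff hG hx (hT.smooth x hx)]; ring
  simp only [e, ← Finset.mul_sum, Finset.sum_add_distrib, Finset.sum_sub_distrib]
  rw [h1, h2, h3, box2]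
  ring

lemma quadTerm_mem (hT : IsTensorIn U L T) (hL : IsNullParallel G U L) (hx : x ∈ U) (l i : ι) :
    (fun j => quadTerm G T l i j x) ∈ L x := by
  have e : (fun j => quadTerm G T l i j x)
      = fun j => ∑ b, (∑ a, (G x)⁻¹ a b * T x l a) * cov2 G T b i j x := by
    ext j
    rw [quadTerm, Finset.sum_comm]
    refine Finset.sum_congr rfl fun b _ => ?_
    rw [Finset.sum_mul]
    exact Finset.sum_congr rfl fun _ _ => by ring
  rw [e]
  exact sum_smul_mem (L := L) _ fun b => hT.cov2_mem hL hx b i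

lemma quadTerm_mem_middle (hT : IsTensorIn U L T) (hG : IsLocalMetric G U)
    (hL : IsNullParallel G U L) (hx : x ∈ U) (l j : ι) :
    (fun i => quadTerm G T l i j x) ∈ L x := by
  convert hT.quadTerm_mem hL hx l j using 2 with i
  simp only [quadTerm, hT.cov2_symm hG hx _ i j]

lemma quadTerm_mem_left (hT : IsTensorIn U L T) (hx : x ∈ U) (i j : ι) :
    (fun l => quadTerm G T l i j x) ∈ L x := by
  have e : (fun l => quadTerm G T l i j x)
      = fun l => ∑ a, (∑ b, (G x)⁻¹ a b * cov2 G T b i j x) * T x l a := by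
    ext l
    rw [quadTerm]
    refine Finset.sum_congr rfl fun b _ => ?_
    rw [Finset.sum_mul]
    exact Finset.sum_congr rfl fun _ _ => by ring
  rw [e]
  exact sum_smul_mem (L := L) (F := fun a l => T x l a) _ fun a => hT.mem_col hx a

/-- The part of the Ricci tensor of `g + h` that is quadratic in the difference of the
connections. Each of the other products of the terms of `S_{lij}` contains a contraction of two
indices in the null distribution. -/
lemma connDiff_mul_connDiff (hT : IsTensorIn U L T) (hG : IsLocalMetric G U)
    (hL : IsNullParallel G U L) (hx : x ∈ U) (i j : ι) :
    ∑ k, ∑ m, (∑ l, (G x)⁻¹ m l * connDiff G T l k j x)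
        * (∑ l, (G x)⁻¹ k l * connDiff G T l i m x) = (1 / 2) * gradQuad G T i j x := by
  have hm := fun k i => hT.cov2_mem hL hx k i
  have hm' := fun k j => hT.cov2_mem_left hG hL hx k j
  have hq1 := fun l i => hT.quadTerm_mem hL hx l i
  have hq2 := fun l i => hT.quadTerm_mem_middle hG hL hx l i
  have hq3 := fun i j => hT.quadTerm_mem_left (G := G) hx i j
  set g : Matrix ι ι ℝ := (G x)⁻¹ with hg
  -- The terms of `S_{akj}` and `S_{bim}` as matrices in `(a, k)` and `(b, m)`, grouped according
  -- to which of these indices lie in the null distribution: the first, both, or the second.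
  set P1 : Matrix ι ι ℝ := Matrix.of fun a k => cov2 G T k j a x with hP1
  set P2 : Matrix ι ι ℝ := Matrix.of fun a k => cov2 G T j k a x + quadTerm G T a k j x with hP2
  set P3 : Matrix ι ι ℝ := Matrix.of fun a k => cov2 G T a k j x with hP3
  set R1 : Matrix ι ι ℝ := Matrix.of fun b m => cov2 G T m i b x with hR1
  set R2 : Matrix ι ι ℝ := Matrix.of fun b m => cov2 G T i m b x + quadTerm G T b i m x with hR2
  set R3 : Matrix ι ι ℝ := Matrix.of fun b m => cov2 G T b i m x with hR3
  have cP1 : ∀ k, (fun a => P1 a k) ∈ L x := fun k => hm k j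
  have cP2 : ∀ k, (fun a => P2 a k) ∈ L x := fun k => (L x).add_mem (hm j k) (hq3 k j)
  have rP2 : ∀ a, P2 a ∈ L x := fun a => (L x).add_mem (hm' j a) (hq2 a j)
  have rP3 : ∀ a, P3 a ∈ L x := fun a => hm' a j
  have cR1 : ∀ m, (fun b => R1 b m) ∈ L x := fun m => hm m i
  have cR2 : ∀ m, (fun b => R2 b m) ∈ L x := fun m => (L x).add_mem (hm i m) (hq3 i m)
  have rR2 : ∀ b, R2 b ∈ L x := fun b => (L x).add_mem (hm' i b) (hq1 b i)
  have rR3 : ∀ b, R3 b ∈ L x := fun b => hm b i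
  have tr0 : ∀ {A B : Matrix ι ι ℝ}, (∀ a, B a ∈ L x) → (∀ k, (fun a => A a k) ∈ L x) →
      (g * A * g * B).trace = 0 := fun hB hA => hL.trace_eq_zero_of_col_row hx hA hB
  have tr0' : ∀ {A B : Matrix ι ι ℝ}, (∀ a, A a ∈ L x) → (∀ k, (fun a => B a k) ∈ L x) →
      (g * A * g * B).trace = 0 := fun hA hB => hL.trace_eq_zero_of_row_col hx hA hB
  have key : ∑ k, ∑ m, (∑ l, (G x)⁻¹ m l * connDiff G T l k j x)
        * (∑ l, (G x)⁻¹ k l * connDiff G T l i m x)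
      = (1 / 4) * (g * (P1 + P2 - P3) * g * (R1 + R2 - R3)).trace := by
    have e1 : ∀ k m, ∑ l, (G x)⁻¹ m l * connDiff G T l k j x
        = (1 / 2) * (g * (P1 + P2 - P3)) m k := by
      intro k m
      rw [Matrix.mul_apply, Finset.mul_sum]
      refine Finset.sum_congr rfl fun l _ => ?_
      simp only [connDiff, hP1, hP2, hP3, Matrix.add_apply, Matrix.sub_apply, Matrix.of_apply, hg]
      ring
    have e2 : ∀ k m, ∑ l, (G x)⁻¹ k l * connDiff G T l i m x
        = (1 / 2) * (g * (R1 + R2 - R3)) k m := by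
      intro k m
      rw [Matrix.mul_apply, Finset.mul_sum]
      refine Finset.sum_congr rfl fun l _ => ?_
      simp only [connDiff, hR1, hR2, hR3, Matrix.add_apply, Matrix.sub_apply, Matrix.of_apply, hg]
      ring
    simp only [e1, e2]
    rw [Matrix.mul_assoc (g * (P1 + P2 - P3)), Matrix.trace]
    simp only [Matrix.diag_apply, Matrix.mul_apply (M := g * (P1 + P2 - P3)), Finset.mul_sum]
    rw [Finset.sum_comm]
    exact Finset.sum_congr rfl fun _ _ => Finset.sum_congr rfl fun _ _ => by ring
  rw [key]
  simp only [Matrix.mul_add, Matrix.mul_sub, Matrix.add_mul, Matrix.sub_mul, Matrix.trace_add,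
    Matrix.trace_sub]
  rw [tr0 rR2 cP1, tr0 rR3 cP1, tr0' rP2 cR1, tr0 rR2 cP2, tr0 rR3 cP2, tr0' rP3 cR1,
    tr0' rP3 cR2]
  have q1 : (g * P1 * g * R1).trace = gradQuad G T i j x := by
    simp only [Matrix.trace, Matrix.diag_apply, Matrix.mul_apply, gradQuad, Finset.sum_mul]
    refine Finset.sum_congr rfl fun m _ => Finset.sum_congr rfl fun b _ =>
      Finset.sum_congr rfl fun k _ => Finset.sum_congr rfl fun a _ => ?_
    simp only [hP1, hR1, Matrix.of_apply, hg]
    rw [hG.inv_symm hx k b, hT.cov2_symm hG hx m i b, hT.cov2_symm hG hx k j a]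
    ring
  have q3 : (g * P3 * g * R3).trace = gradQuad G T i j x := by
    simp only [Matrix.trace, Matrix.diag_apply, Matrix.mul_apply, gradQuad, Finset.sum_mul]
    rw [Finset.sum_comm]
    refine Finset.sum_congr rfl fun b _ => Finset.sum_congr rfl fun m _ => ?_
    rw [Finset.sum_comm]
    refine Finset.sum_congr rfl fun a _ => Finset.sum_congr rfl fun k _ => ?_
    simp only [hP3, hR3, Matrix.of_apply, hg]
    rw [hG.inv_symm hx k b, hT.cov2_symm hG hx b i m]
    ring
  rw [q1, q3]
  ring

/-- The Ricci tensor of `g + h` for a divergence-free `h` with values in a null parallel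
distribution that contains the image of the Ricci tensor of `g`. -/
lemma ricci_add_eq (hT : IsTensorIn U L T) (hG : IsLocalMetric G U)
    (hL : IsNullParallel G U L) (hR : ∀ i, (fun j => ricci G i j x) ∈ L x)
    (hdiv : ∀ y ∈ U, ∀ i, div2 G T i y = 0) (hx : x ∈ U) (i j : ι) :
    ricci (fun y => G y + T y) i j x = ricci G i j x - (1 / 2) * box2 G T i j x
      + ∑ k, ∑ l, riemann G k i j l x * raise2 G T k l x
      + (1 / 2) * ((∑ k, ∑ l, raise2 G T k l x * hess2 G T k l i j x) - gradQuad G T i j x) := by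
  rw [hT.ricci_add hG hL hx, hT.div_connDiff hG hL hR hdiv hx, hT.connDiff_mul_connDiff hG hL hx]
  ring

end IsTensorIn

end RicciPerturbation

/-! ### Traces and divergences -/

section TracesAndDivergence

variable {ι : Type*} [Fintype ι] [DecidableEq ι]
variable {G T : EuclideanSpace ℝ ι → Matrix ι ι ℝ} {U : Set (EuclideanSpace ℝ ι)}
  {x : EuclideanSpace ℝ ι} {L : EuclideanSpace ℝ ι → Submodule ℝ (ι → ℝ)}

namespace IsTensorIn

lemma trace_box2 (hT : IsTensorIn U L T) (hG : IsLocalMetric G U) (hL : IsNullParallel G U L)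
    (hx : x ∈ U) : ∑ i, ∑ j, (G x)⁻¹ i j * box2 G T i j x = 0 := by
  refine hL.trace_eq_zero hx (A := Matrix.of fun i j => box2 G T i j x) (fun i => ?_)
    (fun i j => ?_)
  · have : (fun j => box2 G T i j x) = ∑ k, fun j => ∑ l, (G x)⁻¹ k l * hess2 G T k l i j x := by
      ext j; simp [box2]
    change (fun j => box2 G T i j x) ∈ L x
    rw [this]
    exact (L x).sum_mem fun k _ => sum_smul_mem (L := L) _ fun l => hT.hess2_mem hG hL hx k l i
  · simp only [Matrix.of_apply, box2, hess2_symm (hT.symm_nhds hG hx) _ _ i j]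

lemma trace_raise2_mul_hess2 (hT : IsTensorIn U L T) (hG : IsLocalMetric G U)
    (hL : IsNullParallel G U L) (hx : x ∈ U) :
    ∑ i, ∑ j, (G x)⁻¹ i j * ∑ k, ∑ l, raise2 G T k l x * hess2 G T k l i j x = 0 := by
  refine hL.trace_eq_zero hx
    (A := Matrix.of fun i j => ∑ k, ∑ l, raise2 G T k l x * hess2 G T k l i j x) (fun i => ?_)
    (fun i j => ?_)
  · have : (fun j => ∑ k, ∑ l, raise2 G T k l x * hess2 G T k l i j x)
        = ∑ k, fun j => ∑ l, raise2 G T k l x * hess2 G T k l i j x := by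
      ext j; simp
    change (fun j => ∑ k, ∑ l, raise2 G T k l x * hess2 G T k l i j x) ∈ L x
    rw [this]
    exact (L x).sum_mem fun k _ => sum_smul_mem (L := L) _ fun l => hT.hess2_mem hG hL hx k l i
  · simp only [Matrix.of_apply, hess2_symm (hT.symm_nhds hG hx) _ _ i j]

lemma trace_gradQuad (hT : IsTensorIn U L T)
    (hL : IsNullParallel G U L) (hx : x ∈ U) :
    ∑ i, ∑ j, (G x)⁻¹ i j * gradQuad G T i j x = 0 := by
  have e : ∀ i j, (G x)⁻¹ i j * gradQuad G T i j x = ∑ k, ∑ l, ∑ p, ∑ q,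
      (G x)⁻¹ l p * (G x)⁻¹ k q * ((G x)⁻¹ i j * (cov2 G T k l i x * cov2 G T p q j x)) := by
    intro i j
    simp only [gradQuad, Finset.mul_sum]
    exact Finset.sum_congr rfl fun _ _ => Finset.sum_congr rfl fun _ _ =>
      Finset.sum_congr rfl fun _ _ => Finset.sum_congr rfl fun _ _ => by ring
  have e2 : ∀ F : ι → ι → ι → ι → ι → ι → ℝ, (∀ k l p q, ∑ i, ∑ j, F i j k l p q = 0) →
      ∑ i, ∑ j, ∑ k, ∑ l, ∑ p, ∑ q, F i j k l p q = 0 := by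
    intro F hF
    have h1 : ∑ z : ι × ι, ∑ w : ι × ι × ι × ι, F z.1 z.2 w.1 w.2.1 w.2.2.1 w.2.2.2 = 0 := by
      rw [Finset.sum_comm]
      refine Finset.sum_eq_zero fun w _ => ?_
      rw [Fintype.sum_prod_type]
      exact hF _ _ _ _
    simpa only [Fintype.sum_prod_type] using h1
  simp only [e]
  refine e2 _ fun k l p q => ?_
  simp only [← Finset.mul_sum]
  rw [hL.null x hx _ (hT.cov2_mem hL hx k l) _ (hT.cov2_mem hL hx p q), mul_zero]

/-- The trace of `R_{kijl} h^{kl}` is `-R_{kl} h^{kl}`, a contraction of two tensors with values in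
`L`. -/
lemma trace_riemann (hT : IsTensorIn U L T) (hG : IsLocalMetric G U)
    (hL : IsNullParallel G U L) (hR : ∀ i, (fun j => ricci G i j x) ∈ L x) (hx : x ∈ U) :
    ∑ i, ∑ j, (G x)⁻¹ i j * ∑ k, ∑ l, riemann G k i j l x * raise2 G T k l x = 0 := by
  have h1 : ∀ k l, ∑ i, ∑ j, (G x)⁻¹ i j * riemann G k i j l x = -ricci G k l x := by
    intro k l
    rw [ricci, ← Finset.sum_neg_distrib]
    refine Finset.sum_congr rfl fun i _ => ?_
    rw [← sum_inv_mul_riemann hG hx, ← Finset.sum_neg_distrib]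
    exact Finset.sum_congr rfl fun j _ => by rw [riemann_antisymm hG hx k i j l]; ring
  have h2 : ∑ i, ∑ j, (G x)⁻¹ i j * ∑ k, ∑ l, riemann G k i j l x * raise2 G T k l x
      = ∑ k, ∑ l, raise2 G T k l x * ∑ i, ∑ j, (G x)⁻¹ i j * riemann G k i j l x := by
    have : ∑ z : ι × ι, ∑ w : ι × ι,
        (G x)⁻¹ z.1 z.2 * (riemann G w.1 z.1 z.2 w.2 x * raise2 G T w.1 w.2 x)
        = ∑ w : ι × ι, ∑ z : ι × ι,
          raise2 G T w.1 w.2 x * ((G x)⁻¹ z.1 z.2 * riemann G w.1 z.1 z.2 w.2 x) := by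
      rw [Finset.sum_comm]
      exact Finset.sum_congr rfl fun _ _ => Finset.sum_congr rfl fun _ _ => by ring
    simpa only [Fintype.sum_prod_type, Finset.mul_sum] using this
  rw [h2]
  simp only [h1]
  have h4 : ((G x)⁻¹ * T x * (G x)⁻¹ * Matrix.of fun k l => ricci G l k x).trace = 0 :=
    hL.trace_eq_zero_of_row_col hx (hT.mem x hx) (fun k => hR k)
  rw [← raise2_eq hG hx, Matrix.trace] at h4
  simp only [Matrix.diag_apply, Matrix.mul_apply, Matrix.of_apply] at h4
  simp only [mul_neg, Finset.sum_neg_distrib, h4, neg_zero]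

/-- `∇^γ_k (h')^k_j` for `γ = g + h`, in terms of the Christoffel symbols of `γ`: the difference of
the connections does not contribute. -/
lemma div_add (hT : IsTensorIn U L T) {T' : EuclideanSpace ℝ ι → Matrix ι ι ℝ}
    (hT' : IsTensorIn U L T') (hG : IsLocalMetric G U) (hL : IsNullParallel G U L)
    (hdiv : ∀ i, div2 G T' i x = 0) (hx : x ∈ U) (j : ι) :
    ∑ k, pd k (fun y => ∑ l, (G y + T y)⁻¹ k l * T' y j l) x
      + ∑ k, ∑ m, christoffel (fun y => G y + T y) k k m x * ∑ l, (G x + T x)⁻¹ m l * T' x j l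
      - ∑ k, ∑ m, christoffel (fun y => G y + T y) k j m x * ∑ l, (G x + T x)⁻¹ m l * T' x k l
      = 0 := by
  have hinv : ∀ y ∈ U, ∀ k j, ∑ l, (G y + T y)⁻¹ k l * T' y j l = ∑ l, (G y)⁻¹ k l * T' y j l := by
    intro y hy k j
    have h0 : ∑ l, raise2 G T k l y * T' y j l = 0 := by
      have := hL.mul_inv_mul_eq_zero hy (hT.mem y hy) (hT'.mem_col hy)
      have h1 : (Matrix.of fun k l => raise2 G T k l y) * T' y = 0 := by
        rw [raise2_eq hG hy, Matrix.mul_assoc, Matrix.mul_assoc, ← Matrix.mul_assoc (T y), this,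
          Matrix.mul_zero]
      rw [← Matrix.zero_apply (α := ℝ) k j, ← h1, Matrix.mul_apply]
      exact Finset.sum_congr rfl fun l _ => by rw [hT'.symm y hy j l]; rfl
    rw [hT.inv_add hG hL hy]
    simp only [Matrix.sub_apply, Matrix.of_apply, sub_mul, Finset.sum_sub_distrib, h0, sub_zero]
  have hpd : ∀ k, pd k (fun y => ∑ l, (G y + T y)⁻¹ k l * T' y j l) x
      = pd k (fun y => ∑ l, (G y)⁻¹ k l * T' y j l) x := fun k =>
    pd_congr ((hG.mem_nhds hx).mono fun y hy => hinv y hy k j) k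
  simp only [hpd, hinv x hx, hT.christoffel_add hG hL hx, add_mul, Finset.sum_add_distrib,
    hG.pd_raise hx (fun b => hT'.smooth x hx j b)]
  have z1 : ∑ k, ∑ m, (∑ l, (G x)⁻¹ k l * connDiff G T l k m x) * ∑ l, (G x)⁻¹ m l * T' x j l
      = 0 := by
    rw [Finset.sum_comm]
    simp only [← Finset.sum_mul, hT.trace_connDiff hG hL hx, zero_mul, Finset.sum_const_zero]
  have z2 : ∑ k, ∑ m, (∑ l, (G x)⁻¹ k l * connDiff G T l j m x) * ∑ l, (G x)⁻¹ m l * T' x k l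
      = 0 := by
    set P : Matrix ι ι ℝ := Matrix.of fun l m =>
      (1 / 2) * (cov2 G T j m l x + cov2 G T m j l x + quadTerm G T l j m x) with hP
    set Q : Matrix ι ι ℝ := Matrix.of fun l m => (1 / 2) * cov2 G T l j m x with hQ
    have cP : ∀ m, (fun l => P l m) ∈ L x := fun m => (L x).smul_mem (1 / 2 : ℝ)
      ((L x).add_mem ((L x).add_mem (hT.cov2_mem hL hx j m) (hT.cov2_mem hL hx m j))
        (hT.quadTerm_mem_left hx j m))
    have rQ : ∀ l, Q l ∈ L x := fun l => (L x).smul_mem (1 / 2 : ℝ) (hT.cov2_mem hL hx l j)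
    have hPQ : ∀ l m, connDiff G T l j m x = P l m - Q l m := by
      intro l m
      simp only [connDiff, hP, hQ, Matrix.of_apply]
      ring
    have t1 := hL.trace_eq_zero_of_col_row hx cP (hT'.mem x hx)
    have t2 := hL.trace_eq_zero_of_row_col hx rQ (hT'.mem_col hx)
    have t3 : ((G x)⁻¹ * (P - Q) * (G x)⁻¹ * T' x).trace = 0 := by
      rw [Matrix.mul_sub, Matrix.sub_mul, Matrix.sub_mul, Matrix.trace_sub, t1, t2, sub_zero]
    rw [← t3, Matrix.mul_assoc ((G x)⁻¹ * (P - Q)), Matrix.trace]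
    simp only [Matrix.diag_apply, Matrix.mul_apply (M := (G x)⁻¹ * (P - Q))]
    refine Finset.sum_congr rfl fun k _ => Finset.sum_congr rfl fun m _ => ?_
    rw [Matrix.mul_apply, Matrix.mul_apply]
    congr 1
    · exact Finset.sum_congr rfl fun l _ => by rw [hPQ, Matrix.sub_apply]
    · exact Finset.sum_congr rfl fun l _ => by rw [hT'.symm x hx k l]
  rw [z1, z2]
  have h0 : ∑ k, ∑ l, (G x)⁻¹ k l * cov2 G T' k j l x = 0 := by
    rw [← hdiv j, div2]
    exact Finset.sum_congr rfl fun k _ => Finset.sum_congr rfl fun l _ => by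
      rw [hT'.cov2_symm hG hx k j l]
  have h1 : ∑ k, ∑ m, christoffel G k j m x * ∑ l, (G x)⁻¹ m l * T' x k l
      = ∑ k, ∑ l, (G x)⁻¹ k l * ∑ m, christoffel G m k j x * T' x m l := by
    simp only [Finset.mul_sum]
    rw [Finset.sum_comm]
    refine Finset.sum_congr rfl fun m _ => ?_
    rw [Finset.sum_comm]
    exact Finset.sum_congr rfl fun l _ => Finset.sum_congr rfl fun k _ => by
      rw [hG.christoffel_symm hx k j m]; ring
  have h2 : ∑ k, ∑ l, (G x)⁻¹ k l * cov2 G T' k j l x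
      = ∑ k, ∑ l, (G x)⁻¹ k l * (pd k (fun y => T' y j l) x
        - ∑ m, christoffel G m k l x * T' x j m)
        - ∑ k, ∑ l, (G x)⁻¹ k l * ∑ m, christoffel G m k j x * T' x m l := by
    simp only [← Finset.sum_sub_distrib, ← mul_sub]
    refine Finset.sum_congr rfl fun k _ => Finset.sum_congr rfl fun l _ => ?_
    simp only [cov2, Finset.sum_add_distrib]
    ring
  simp only [Finset.sum_sub_distrib] at h2 ⊢
  rw [h1]
  linarith

end IsTensorIn

end TracesAndDivergence

/-! ### Families depending on `ρ` -/

section RhoDerivative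

variable {ι : Type*} [Fintype ι] [DecidableEq ι] {F : EuclideanSpace ℝ ι × ℝ → ℝ}
  {x : EuclideanSpace ℝ ι} {ρ : ℝ}

lemma pd_slice (hF : DifferentiableAt ℝ F (x, ρ)) (k : ι) :
    pd k (fun y => F (y, ρ)) x = fderiv ℝ F (x, ρ) (EuclideanSpace.single k 1, 0) := by
  have h : HasFDerivAt (fun y => F (y, ρ)) _ x :=
    hF.hasFDerivAt.comp x (hasFDerivAt_prodMk_left x ρ)
  rw [pd, h.fderiv]
  simp

lemma hasDerivAt_slice (hF : DifferentiableAt ℝ F (x, ρ)) :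
    HasDerivAt (fun r => F (x, r)) (fderiv ℝ F (x, ρ) (0, 1)) ρ := by
  have h : HasFDerivAt (fun r => F (x, r)) _ ρ :=
    hF.hasFDerivAt.comp ρ (hasFDerivAt_prodMk_right x ρ)
  simpa using h.hasDerivAt

lemma eventually_differentiableAt (hF : ContDiffAt ℝ ∞ F (x, ρ)) :
    ∀ᶠ q in 𝓝 (x, ρ), DifferentiableAt ℝ F q :=
  ((hF.of_le (m := 1) (WithTop.coe_le_coe.2 le_top)).eventually (by simp)).mono fun _ hq =>
    hq.differentiableAt (by simp)

lemma eventually_slice_left {P : EuclideanSpace ℝ ι × ℝ → Prop} (h : ∀ᶠ q in 𝓝 (x, ρ), P q) :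
    ∀ᶠ y in 𝓝 x, P (y, ρ) :=
  ((Continuous.prodMk_left ρ).tendsto x).eventually h

lemma eventually_slice_right {P : EuclideanSpace ℝ ι × ℝ → Prop} (h : ∀ᶠ q in 𝓝 (x, ρ), P q) :
    ∀ᶠ r in 𝓝 ρ, P (x, r) :=
  ((Continuous.prodMk_right x).tendsto ρ).eventually h

lemma deriv_slice_eventuallyEq (hF : ContDiffAt ℝ ∞ F (x, ρ)) :
    (fun q : EuclideanSpace ℝ ι × ℝ => deriv (fun r => F (q.1, r)) q.2) =ᶠ[𝓝 (x, ρ)]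
      fun q => fderiv ℝ F q (0, 1) :=
  (eventually_differentiableAt hF).mono fun q hq =>
    (hasDerivAt_slice (x := q.1) (ρ := q.2) hq).deriv

lemma contDiffAt_fderiv_apply (hF : ContDiffAt ℝ ∞ F (x, ρ)) (v : EuclideanSpace ℝ ι × ℝ) :
    ContDiffAt ℝ ∞ (fun q => fderiv ℝ F q v) (x, ρ) :=
  (hF.fderiv_right (m := ∞) (by simp)).clm_apply contDiffAt_const

lemma contDiffAt_deriv_slice (hF : ContDiffAt ℝ ∞ F (x, ρ)) :
    ContDiffAt ℝ ∞ (fun q : EuclideanSpace ℝ ι × ℝ => deriv (fun r => F (q.1, r)) q.2) (x, ρ) :=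
  (contDiffAt_fderiv_apply hF _).congr_of_eventuallyEq (deriv_slice_eventuallyEq hF)

lemma contDiffAt_slice_left (hF : ContDiffAt ℝ ∞ F (x, ρ)) :
    ContDiffAt ℝ ∞ (fun y => F (y, ρ)) x :=
  ContDiffAt.comp x hF (contDiffAt_id.prodMk contDiffAt_const)

/-- Derivatives in `x` and `ρ` commute. -/
lemma hasDerivAt_pd_slice (hF : ContDiffAt ℝ ∞ F (x, ρ)) (k : ι) :
    HasDerivAt (fun r => pd k (fun y => F (y, r)) x)
      (pd k (fun y => deriv (fun r => F (y, r)) ρ) x) ρ := by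
  have h1 : pd k (fun y => deriv (fun r => F (y, r)) ρ) x
      = fderiv ℝ (fun q => fderiv ℝ F q (0, 1)) (x, ρ) (EuclideanSpace.single k 1, 0) := by
    rw [← pd_slice (differentiableAt_of_smooth (contDiffAt_fderiv_apply hF _))]
    exact pd_congr (eventually_slice_left (deriv_slice_eventuallyEq hF)) k
  have h2 : (fun r => pd k (fun y => F (y, r)) x) =ᶠ[𝓝 ρ]
      fun r => fderiv ℝ F (x, r) (EuclideanSpace.single k 1, 0) :=
    (eventually_slice_right (eventually_differentiableAt hF)).mono fun r hr => pd_slice hr k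
  rw [h1, fderiv_apply_comm hF]
  exact (hasDerivAt_slice (F := fun q => fderiv ℝ F q (EuclideanSpace.single k 1, 0))
    (differentiableAt_of_smooth (contDiffAt_fderiv_apply hF _))).congr_of_eventuallyEq h2

/-- A family `H ρ`, `|ρ| < ε`, of symmetric tensors, smooth jointly in `x` and `ρ`, whose rows lie
in the field `L` of covectors. -/
structure IsTensorFamily (ε : ℝ) (U : Set (EuclideanSpace ℝ ι))
    (L : EuclideanSpace ℝ ι → Submodule ℝ (ι → ℝ))
    (H : ℝ → EuclideanSpace ℝ ι → Matrix ι ι ℝ) : Prop where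
  smooth : ∀ x ∈ U, ∀ ρ ∈ Ioo (-ε) ε, ∀ i j,
    ContDiffAt ℝ ∞ (fun q : EuclideanSpace ℝ ι × ℝ => H q.2 q.1 i j) (x, ρ)
  symm : ∀ x ∈ U, ∀ ρ ∈ Ioo (-ε) ε, ∀ i j, H ρ x i j = H ρ x j i
  mem : ∀ x ∈ U, ∀ ρ ∈ Ioo (-ε) ε, ∀ i, H ρ x i ∈ L x

/-- The `ρ`-derivative of a family of matrix-valued functions. -/
noncomputable def rhoDeriv (H : ℝ → EuclideanSpace ℝ ι → Matrix ι ι ℝ) (ρ : ℝ)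
    (x : EuclideanSpace ℝ ι) : Matrix ι ι ℝ :=
  Matrix.of fun i j => deriv (fun r => H r x i j) ρ

variable {ε : ℝ} {U : Set (EuclideanSpace ℝ ι)} {L : EuclideanSpace ℝ ι → Submodule ℝ (ι → ℝ)}
  {H : ℝ → EuclideanSpace ℝ ι → Matrix ι ι ℝ} {G : EuclideanSpace ℝ ι → Matrix ι ι ℝ}

/-- A derivative of a curve in a finite-dimensional subspace lies in the subspace. -/
lemma deriv_mem_submodule {V : Type*} [NormedAddCommGroup V] [NormedSpace ℝ V]
    [FiniteDimensional ℝ V] (S : Submodule ℝ V) {f : ℝ → V} {f' : V} (hf : HasDerivAt f f' ρ)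
    (hS : ∀ᶠ r in 𝓝 ρ, f r ∈ S) : f' ∈ S := by
  refine S.closed_of_finiteDimensional.mem_of_tendsto (hasDerivAt_iff_tendsto_slope.1 hf) ?_
  filter_upwards [hS.filter_mono nhdsWithin_le_nhds] with r hr
  exact S.smul_mem _ (S.sub_mem hr hS.self_of_nhds)

namespace IsTensorFamily

lemma tensor (hH : IsTensorFamily ε U L H) (hρ : ρ ∈ Ioo (-ε) ε) : IsTensorIn U L (H ρ) where
  smooth x hx i j := contDiffAt_slice_left (hH.smooth x hx ρ hρ i j)
  symm x hx := hH.symm x hx ρ hρ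
  mem x hx := hH.mem x hx ρ hρ

lemma hasDerivAt (hH : IsTensorFamily ε U L H) (hx : x ∈ U) (hρ : ρ ∈ Ioo (-ε) ε) (i j : ι) :
    HasDerivAt (fun r => H r x i j) (rhoDeriv H ρ x i j) ρ :=
  (hasDerivAt_slice (F := fun q => H q.2 q.1 i j)
    (differentiableAt_of_smooth (hH.smooth x hx ρ hρ i j))).differentiableAt.hasDerivAt

lemma rhoDeriv (hH : IsTensorFamily ε U L H) : IsTensorFamily ε U L (rhoDeriv H) where
  smooth x hx ρ hρ i j := contDiffAt_deriv_slice (hH.smooth x hx ρ hρ i j)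
  symm x hx ρ hρ i j := by
    refine Filter.EventuallyEq.deriv_eq ?_
    filter_upwards [isOpen_Ioo.mem_nhds hρ] with r hr
    exact hH.symm x hx r hr i j
  mem x hx ρ hρ i := by
    refine deriv_mem_submodule (ρ := ρ) (L x) (f := fun r => H r x i)
      (hasDerivAt_pi.2 fun j => hH.hasDerivAt hx hρ i j) ?_
    filter_upwards [isOpen_Ioo.mem_nhds hρ] with r hr
    exact hH.mem x hx r hr i

lemma div2_rhoDeriv (hH : IsTensorFamily ε U L H) (hx : x ∈ U) (hρ : ρ ∈ Ioo (-ε) ε)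
    (hdiv : ∀ r ∈ Ioo (-ε) ε, ∀ i, div2 G (H r) i x = 0) (i : ι) :
    div2 G (AmbientWalker.rhoDeriv H ρ) i x = 0 := by
  have hc : ∀ k l, HasDerivAt (fun r => cov2 G (H r) k l i x)
      (cov2 G (AmbientWalker.rhoDeriv H ρ) k l i x) ρ := fun k l =>
    (hasDerivAt_pd_slice (hH.smooth x hx ρ hρ l i) k).sub
      (HasDerivAt.fun_sum fun m _ => ((hH.hasDerivAt hx hρ m i).const_mul _).add
        ((hH.hasDerivAt hx hρ l m).const_mul _))
  have hd : HasDerivAt (fun r => div2 G (H r) i x) (div2 G (AmbientWalker.rhoDeriv H ρ) i x) ρ :=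
    HasDerivAt.fun_sum fun k _ => HasDerivAt.fun_sum fun l _ => (hc k l).const_mul _
  have h0 : (fun r => div2 G (H r) i x) =ᶠ[𝓝 ρ] fun _ => 0 := by
    filter_upwards [isOpen_Ioo.mem_nhds hρ] with r hr
    exact hdiv r hr i
  rw [← hd.deriv, h0.deriv_eq, deriv_const]

end IsTensorFamily

end RhoDerivative

/-! ### The ambient metric in coordinates -/

section Ambient

variable {n : ℕ}

/-- The component matrix of `2 dt d(ρ t) + t² γ(ρ)`, where `γ(ρ)` is given by its components in
the coordinates of a chart. -/
noncomputable def ambMatrix (γ : ℝ → EuclideanSpace ℝ (Fin n) → Matrix (Fin n) (Fin n) ℝ)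
    (y : EuclideanSpace ℝ (AmbIdx n)) : Matrix (AmbIdx n) (AmbIdx n) ℝ :=
  Matrix.of fun a b => match a, b with
    | Sum.inl _, Sum.inl _ => 2 * y (rhoIdx n)
    | Sum.inl _, Sum.inr (Sum.inr _) => y (tIdx n)
    | Sum.inr (Sum.inr _), Sum.inl _ => y (tIdx n)
    | Sum.inr (Sum.inl i), Sum.inr (Sum.inl j) =>
        y (tIdx n) ^ 2 * γ (y (rhoIdx n)) (xPart y) i j
    | _, _ => 0

/-- The inverse of `ambMatrix`. -/
noncomputable def ambInv (γ : ℝ → EuclideanSpace ℝ (Fin n) → Matrix (Fin n) (Fin n) ℝ)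
    (y : EuclideanSpace ℝ (AmbIdx n)) : Matrix (AmbIdx n) (AmbIdx n) ℝ :=
  Matrix.of fun a b => match a, b with
    | Sum.inl _, Sum.inr (Sum.inr _) => (y (tIdx n))⁻¹
    | Sum.inr (Sum.inr _), Sum.inl _ => (y (tIdx n))⁻¹
    | Sum.inr (Sum.inr _), Sum.inr (Sum.inr _) => -2 * y (rhoIdx n) * (y (tIdx n) ^ 2)⁻¹
    | Sum.inr (Sum.inl i), Sum.inr (Sum.inl j) =>
        (y (tIdx n) ^ 2)⁻¹ * (γ (y (rhoIdx n)) (xPart y))⁻¹ i j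
    | _, _ => 0

lemma sum_ambIdx (f : AmbIdx n → ℝ) :
    ∑ a, f a = f (tIdx n) + ∑ i, f (xIdx i) + f (rhoIdx n) := by
  simp [Fintype.sum_sum_type, add_assoc]

/-- The projection to the coordinates `(x, ρ)`. -/
noncomputable def toXRho : EuclideanSpace ℝ (AmbIdx n) →L[ℝ] EuclideanSpace ℝ (Fin n) × ℝ :=
  LinearMap.toContinuousLinearMap
    { toFun := fun y => (xPart y, y (rhoIdx n))
      map_add' := fun _ _ => rfl
      map_smul' := fun _ _ => rfl }

lemma toXRho_apply (y : EuclideanSpace ℝ (AmbIdx n)) : toXRho y = (xPart y, y (rhoIdx n)) := rfl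

lemma toXRho_t : toXRho (EuclideanSpace.single (tIdx n) 1) = 0 := by
  refine Prod.ext ?_ ?_
  · ext i; simp [toXRho_apply, xPart]
  · simp [toXRho_apply]

lemma toXRho_x (i : Fin n) :
    toXRho (EuclideanSpace.single (xIdx i) 1) = (EuclideanSpace.single i 1, 0) := by
  refine Prod.ext ?_ ?_
  · ext j; simp [toXRho_apply, xPart]
  · simp [toXRho_apply]

lemma toXRho_rho : toXRho (EuclideanSpace.single (rhoIdx n) 1) = (0, 1) := by
  refine Prod.ext ?_ ?_
  · ext i; simp [toXRho_apply, xPart]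
  · simp [toXRho_apply]

section Lift

variable {F : EuclideanSpace ℝ (Fin n) × ℝ → ℝ} {y : EuclideanSpace ℝ (AmbIdx n)}

lemma contDiffAt_lift (hF : ContDiffAt ℝ ∞ F (xPart y, y (rhoIdx n))) :
    ContDiffAt ℝ ∞ (fun z => F (xPart z, z (rhoIdx n))) y :=
  ContDiffAt.comp (f := toXRho) y hF toXRho.contDiff.contDiffAt

lemma pd_lift (hF : DifferentiableAt ℝ F (xPart y, y (rhoIdx n))) (a : AmbIdx n) :
    pd a (fun z => F (xPart z, z (rhoIdx n))) y
      = fderiv ℝ F (xPart y, y (rhoIdx n)) (toXRho (EuclideanSpace.single a 1)) := by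
  have h : HasFDerivAt (fun z => F (xPart z, z (rhoIdx n))) _ y :=
    HasFDerivAt.comp (f := toXRho) y (hF : DifferentiableAt ℝ F (toXRho y)).hasFDerivAt
      toXRho.hasFDerivAt
  rw [pd, h.fderiv]
  rfl

lemma pd_t_lift (hF : DifferentiableAt ℝ F (xPart y, y (rhoIdx n))) :
    pd (tIdx n) (fun z => F (xPart z, z (rhoIdx n))) y = 0 := by
  rw [pd_lift hF, toXRho_t, map_zero]

lemma pd_x_lift (hF : DifferentiableAt ℝ F (xPart y, y (rhoIdx n))) (i : Fin n) :
    pd (xIdx i) (fun z => F (xPart z, z (rhoIdx n))) y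
      = pd i (fun x => F (x, y (rhoIdx n))) (xPart y) := by
  rw [pd_lift hF, toXRho_x, pd_slice hF]

lemma pd_rho_lift (hF : DifferentiableAt ℝ F (xPart y, y (rhoIdx n))) :
    pd (rhoIdx n) (fun z => F (xPart z, z (rhoIdx n))) y
      = deriv (fun r => F (xPart y, r)) (y (rhoIdx n)) := by
  rw [pd_lift hF, toXRho_rho, (hasDerivAt_slice hF).deriv]

lemma contDiffAt_coord (a : AmbIdx n) :
    ContDiffAt ℝ ∞ (fun z : EuclideanSpace ℝ (AmbIdx n) => z a) y :=
  (EuclideanSpace.proj a : EuclideanSpace ℝ (AmbIdx n) →L[ℝ] ℝ).contDiff.contDiffAt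

lemma pd_coord (a b : AmbIdx n) :
    pd b (fun z : EuclideanSpace ℝ (AmbIdx n) => z a) y = if a = b then 1 else 0 := by
  have h : HasFDerivAt (fun z : EuclideanSpace ℝ (AmbIdx n) => z a)
      (EuclideanSpace.proj a : EuclideanSpace ℝ (AmbIdx n) →L[ℝ] ℝ) y :=
    (EuclideanSpace.proj a : EuclideanSpace ℝ (AmbIdx n) →L[ℝ] ℝ).hasFDerivAt
  rw [pd, h.fderiv]
  simp

end Lift

end Ambient

/-! ### The Christoffel symbols of the ambient metric -/

section AmbientChristoffel

variable {n : ℕ} {γ : ℝ → EuclideanSpace ℝ (Fin n) → Matrix (Fin n) (Fin n) ℝ} {ε : ℝ}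
  {U : Set (EuclideanSpace ℝ (Fin n))} {y : EuclideanSpace ℝ (AmbIdx n)}

/-- A family of pseudo-Riemannian metrics on `U`, smooth jointly in `x` and `ρ`. -/
structure IsMetricFamily (ε : ℝ) (U : Set (EuclideanSpace ℝ (Fin n)))
    (γ : ℝ → EuclideanSpace ℝ (Fin n) → Matrix (Fin n) (Fin n) ℝ) : Prop where
  isOpen : IsOpen U
  smooth : ∀ x ∈ U, ∀ ρ ∈ Ioo (-ε) ε, ∀ i j,
    ContDiffAt ℝ ∞ (fun q : EuclideanSpace ℝ (Fin n) × ℝ => γ q.2 q.1 i j) (x, ρ)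
  metric : ∀ ρ ∈ Ioo (-ε) ε, IsLocalMetric (γ ρ) U

/-- The set of `(t, x, ρ)` with `t > 0`, `x ∈ U` and `|ρ| < ε`. -/
def ambRegion (U : Set (EuclideanSpace ℝ (Fin n))) (ε : ℝ) : Set (EuclideanSpace ℝ (AmbIdx n)) :=
  {y | 0 < y (tIdx n) ∧ xPart y ∈ U ∧ y (rhoIdx n) ∈ Ioo (-ε) ε}

lemma isOpen_ambRegion (hU : IsOpen U) : IsOpen (ambRegion U ε) := by
  have h1 : Continuous fun y : EuclideanSpace ℝ (AmbIdx n) => y (tIdx n) :=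
    (EuclideanSpace.proj (tIdx n) : EuclideanSpace ℝ (AmbIdx n) →L[ℝ] ℝ).continuous
  have h2 : Continuous fun y : EuclideanSpace ℝ (AmbIdx n) => toXRho y := toXRho.continuous
  exact (isOpen_lt continuous_const h1).inter
    ((hU.preimage (continuous_fst.comp h2)).inter (isOpen_Ioo.preimage (continuous_snd.comp h2)))

/-- The Ricci tensor in terms of the Christoffel symbols and their trace. -/
lemma ricci_eq_trace {ι : Type*} [Fintype ι] [DecidableEq ι]
    {G : EuclideanSpace ℝ ι → Matrix ι ι ℝ} {U : Set (EuclideanSpace ℝ ι)}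
    {x : EuclideanSpace ℝ ι} (hG : IsLocalMetric G U) (hx : x ∈ U) (a b : ι) :
    ricci G a b x = ∑ k, pd k (christoffel G k a b) x
      - pd a (fun z => ∑ k, christoffel G k k b z) x
      + ∑ m, christoffel G m a b x * ∑ k, christoffel G k k m x
      - ∑ k, ∑ m, christoffel G m k b x * christoffel G k a m x := by
  have h : ∑ m, christoffel G m a b x * ∑ k, christoffel G k k m x
      = ∑ k, ∑ m, christoffel G m a b x * christoffel G k k m x := by
    rw [Finset.sum_comm]
    simp only [Finset.mul_sum]
  rw [h, pd_sum _ (fun k => differentiableAt_of_smooth (hG.contDiffAt_christoffel hx k k b))]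
  simp only [ricci, curvature, Finset.sum_add_distrib, Finset.sum_sub_distrib]
  ring

namespace IsMetricFamily

lemma mul_ambInv (hγ : IsMetricFamily ε U γ) (hy : y ∈ ambRegion U ε) :
    ambMatrix γ y * ambInv γ y = 1 := by
  obtain ⟨ht, hx, hρ⟩ := hy
  have h1 := (hγ.metric _ hρ).mul_inv hx
  ext a b
  rw [Matrix.mul_apply, sum_ambIdx]
  rcases a with _ | i | _ <;> rcases b with _ | j | _ <;>
    simp [ambMatrix, ambInv, ht.ne', Matrix.one_apply]
  · field_simp
    ring
  · have := congrFun (congrFun h1 i) j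
    rw [Matrix.mul_apply, Matrix.one_apply] at this
    rw [← this]
    refine Finset.sum_congr rfl fun k _ => ?_
    field_simp

lemma ambMatrix_inv (hγ : IsMetricFamily ε U γ) (hy : y ∈ ambRegion U ε) :
    (ambMatrix γ y)⁻¹ = ambInv γ y :=
  Matrix.inv_eq_right_inv (hγ.mul_ambInv hy)

lemma contDiffAt_entry (hγ : IsMetricFamily ε U γ) (hy : y ∈ ambRegion U ε) (i j : Fin n) :
    ContDiffAt ℝ ∞ (fun z : EuclideanSpace ℝ (AmbIdx n) => γ (z (rhoIdx n)) (xPart z) i j) y :=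
  contDiffAt_lift (F := fun q => γ q.2 q.1 i j) (hγ.smooth _ hy.2.1 _ hy.2.2 i j)

lemma isLocalMetric (hγ : IsMetricFamily ε U γ) :
    IsLocalMetric (ambMatrix γ) (ambRegion U ε) where
  isOpen := isOpen_ambRegion hγ.isOpen
  smooth y hy a b := by
    rcases a with _ | i | _ <;> rcases b with _ | j | _
    · exact contDiffAt_const.mul (contDiffAt_coord _)
    · exact contDiffAt_const
    · exact contDiffAt_coord _
    · exact contDiffAt_const
    · exact ((contDiffAt_coord _).pow 2).mul (hγ.contDiffAt_entry hy i j)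
    · exact contDiffAt_const
    · exact contDiffAt_coord _
    · exact contDiffAt_const
    · exact contDiffAt_const
  symm y hy a b := by
    rcases a with _ | i | _ <;> rcases b with _ | j | _ <;> try rfl
    simp only [ambMatrix, Matrix.of_apply, (hγ.metric _ hy.2.2).symm _ hy.2.1 i j]
  det y hy := (Matrix.isUnit_det_of_right_inverse (hγ.mul_ambInv hy)).ne_zero

lemma pd_ambMatrix_t_t (c : AmbIdx n) :
    pd c (fun z => ambMatrix γ z (tIdx n) (tIdx n)) y = 2 * if rhoIdx n = c then 1 else 0 := by
  rw [← pd_coord (y := y) (rhoIdx n) c]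
  exact pd_const_mul (differentiableAt_of_smooth (contDiffAt_coord _)) 2 c

lemma pd_ambMatrix_t_rho (c : AmbIdx n) :
    pd c (fun z => ambMatrix γ z (tIdx n) (rhoIdx n)) y = if tIdx n = c then 1 else 0 :=
  pd_coord _ _

lemma pd_ambMatrix_rho_t (c : AmbIdx n) :
    pd c (fun z => ambMatrix γ z (rhoIdx n) (tIdx n)) y = if tIdx n = c then 1 else 0 :=
  pd_coord _ _

lemma pd_ambMatrix_t_x (c : AmbIdx n) (i : Fin n) :
    pd c (fun z => ambMatrix γ z (tIdx n) (xIdx i)) y = 0 := pd_const _ _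

lemma pd_ambMatrix_x_t (c : AmbIdx n) (i : Fin n) :
    pd c (fun z => ambMatrix γ z (xIdx i) (tIdx n)) y = 0 := pd_const _ _

lemma pd_ambMatrix_rho_x (c : AmbIdx n) (i : Fin n) :
    pd c (fun z => ambMatrix γ z (rhoIdx n) (xIdx i)) y = 0 := pd_const _ _

lemma pd_ambMatrix_x_rho (c : AmbIdx n) (i : Fin n) :
    pd c (fun z => ambMatrix γ z (xIdx i) (rhoIdx n)) y = 0 := pd_const _ _

lemma pd_ambMatrix_rho_rho (c : AmbIdx n) :
    pd c (fun z => ambMatrix γ z (rhoIdx n) (rhoIdx n)) y = 0 := pd_const _ _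

lemma pd_ambMatrix_x_x (hγ : IsMetricFamily ε U γ) (hy : y ∈ ambRegion U ε) (c : AmbIdx n)
    (i j : Fin n) : pd c (fun z => ambMatrix γ z (xIdx i) (xIdx j)) y =
      (2 * y (tIdx n) * if tIdx n = c then 1 else 0) * γ (y (rhoIdx n)) (xPart y) i j
        + y (tIdx n) ^ 2 * pd c (fun z => γ (z (rhoIdx n)) (xPart z) i j) y := by
  have dt := differentiableAt_of_smooth (contDiffAt_coord (y := y) (tIdx n))
  have e : (fun z => ambMatrix γ z (xIdx i) (xIdx j))
      = fun z => (z (tIdx n) * z (tIdx n)) * γ (z (rhoIdx n)) (xPart z) i j := by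
    ext z
    simp only [ambMatrix, Matrix.of_apply]
    ring
  rw [e, pd_mul (dt.fun_mul dt) (differentiableAt_of_smooth (hγ.contDiffAt_entry hy i j)),
    pd_mul dt dt, pd_coord]
  ring

lemma pd_t_entry (hγ : IsMetricFamily ε U γ) (hy : y ∈ ambRegion U ε) (i j : Fin n) :
    pd (tIdx n) (fun z => γ (z (rhoIdx n)) (xPart z) i j) y = 0 :=
  pd_t_lift (F := fun q => γ q.2 q.1 i j)
    (differentiableAt_of_smooth (hγ.smooth _ hy.2.1 _ hy.2.2 i j))

lemma pd_x_entry (hγ : IsMetricFamily ε U γ) (hy : y ∈ ambRegion U ε) (k i j : Fin n) :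
    pd (xIdx k) (fun z => γ (z (rhoIdx n)) (xPart z) i j) y
      = pd k (fun x => γ (y (rhoIdx n)) x i j) (xPart y) :=
  pd_x_lift (F := fun q => γ q.2 q.1 i j)
    (differentiableAt_of_smooth (hγ.smooth _ hy.2.1 _ hy.2.2 i j)) k

lemma pd_rho_entry (hγ : IsMetricFamily ε U γ) (hy : y ∈ ambRegion U ε) (i j : Fin n) :
    pd (rhoIdx n) (fun z => γ (z (rhoIdx n)) (xPart z) i j) y
      = rhoDeriv γ (y (rhoIdx n)) (xPart y) i j :=
  pd_rho_lift (F := fun q => γ q.2 q.1 i j)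
    (differentiableAt_of_smooth (hγ.smooth _ hy.2.1 _ hy.2.2 i j))

lemma christoffel_t (hγ : IsMetricFamily ε U γ) (hy : y ∈ ambRegion U ε) (a b : AmbIdx n) :
    christoffel (ambMatrix γ) (tIdx n) a b y = (1 / 2) * ((y (tIdx n))⁻¹ *
      (pd a (fun z => ambMatrix γ z b (rhoIdx n)) y + pd b (fun z => ambMatrix γ z a (rhoIdx n)) y
        - pd (rhoIdx n) (fun z => ambMatrix γ z a b) y)) := by
  rw [christoffel, hγ.ambMatrix_inv hy, sum_ambIdx]
  simp [ambInv]

lemma christoffel_x (hγ : IsMetricFamily ε U γ) (hy : y ∈ ambRegion U ε) (k : Fin n)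
    (a b : AmbIdx n) :
    christoffel (ambMatrix γ) (xIdx k) a b y = (1 / 2) *
      ∑ l, (y (tIdx n) ^ 2)⁻¹ * (γ (y (rhoIdx n)) (xPart y))⁻¹ k l *
      (pd a (fun z => ambMatrix γ z b (xIdx l)) y + pd b (fun z => ambMatrix γ z a (xIdx l)) y
        - pd (xIdx l) (fun z => ambMatrix γ z a b) y) := by
  rw [christoffel, hγ.ambMatrix_inv hy, sum_ambIdx]
  simp [ambInv]

lemma christoffel_rho (hγ : IsMetricFamily ε U γ) (hy : y ∈ ambRegion U ε) (a b : AmbIdx n) :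
    christoffel (ambMatrix γ) (rhoIdx n) a b y = (1 / 2) * ((y (tIdx n))⁻¹ *
      (pd a (fun z => ambMatrix γ z b (tIdx n)) y + pd b (fun z => ambMatrix γ z a (tIdx n)) y
        - pd (tIdx n) (fun z => ambMatrix γ z a b) y)
      - 2 * y (rhoIdx n) * (y (tIdx n) ^ 2)⁻¹ *
      (pd a (fun z => ambMatrix γ z b (rhoIdx n)) y + pd b (fun z => ambMatrix γ z a (rhoIdx n)) y
        - pd (rhoIdx n) (fun z => ambMatrix γ z a b) y)) := by
  rw [christoffel, hγ.ambMatrix_inv hy, sum_ambIdx]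
  simp [ambInv]
  ring

lemma christoffel_t_t_t (hγ : IsMetricFamily ε U γ) (hy : y ∈ ambRegion U ε) :
    christoffel (ambMatrix γ) (tIdx n) (tIdx n) (tIdx n) y = 0 := by
  simp [hγ.christoffel_t hy, pd_ambMatrix_t_t, pd_ambMatrix_t_rho]
  norm_num

lemma christoffel_t_t_x (hγ : IsMetricFamily ε U γ) (hy : y ∈ ambRegion U ε)
    (i : Fin n) :
    christoffel (ambMatrix γ) (tIdx n) (tIdx n) (xIdx i) y = 0 := by
  simp [hγ.christoffel_t hy, pd_ambMatrix_t_x, pd_ambMatrix_t_rho, pd_ambMatrix_x_rho]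

lemma christoffel_t_t_rho (hγ : IsMetricFamily ε U γ) (hy : y ∈ ambRegion U ε) :
    christoffel (ambMatrix γ) (tIdx n) (tIdx n) (rhoIdx n) y = 0 := by
  simp [hγ.christoffel_t hy, pd_ambMatrix_t_rho, pd_ambMatrix_rho_rho]

lemma christoffel_t_x_x (hγ : IsMetricFamily ε U γ) (hy : y ∈ ambRegion U ε)
    (i j : Fin n) :
    christoffel (ambMatrix γ) (tIdx n) (xIdx i) (xIdx j) y
      = -(1 / 2) * (y (tIdx n) * rhoDeriv γ (y (rhoIdx n)) (xPart y) i j) := by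
  have := hy.1.ne'
  simp [hγ.christoffel_t hy, pd_ambMatrix_x_rho, hγ.pd_ambMatrix_x_x hy, hγ.pd_rho_entry hy]
  field_simp

lemma christoffel_t_x_rho (hγ : IsMetricFamily ε U γ) (hy : y ∈ ambRegion U ε)
    (i : Fin n) :
    christoffel (ambMatrix γ) (tIdx n) (xIdx i) (rhoIdx n) y = 0 := by
  simp [hγ.christoffel_t hy, pd_ambMatrix_x_rho, pd_ambMatrix_rho_rho]

lemma christoffel_t_rho_rho (hγ : IsMetricFamily ε U γ) (hy : y ∈ ambRegion U ε) :
    christoffel (ambMatrix γ) (tIdx n) (rhoIdx n) (rhoIdx n) y = 0 := by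
  simp [hγ.christoffel_t hy, pd_ambMatrix_rho_rho]

lemma christoffel_x_t_t (hγ : IsMetricFamily ε U γ) (hy : y ∈ ambRegion U ε)
    (k : Fin n) :
    christoffel (ambMatrix γ) (xIdx k) (tIdx n) (tIdx n) y = 0 := by
  simp [hγ.christoffel_x hy, pd_ambMatrix_t_x, pd_ambMatrix_t_t]

lemma christoffel_x_t_x (hγ : IsMetricFamily ε U γ) (hy : y ∈ ambRegion U ε)
    (k j : Fin n) :
    christoffel (ambMatrix γ) (xIdx k) (tIdx n) (xIdx j) y
      = if k = j then (y (tIdx n))⁻¹ else 0 := by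
  have ht := hy.1.ne'
  have h := (hγ.metric _ hy.2.2).sum_inv_mul hy.2.1 k j
  have e : ∀ l, (y (tIdx n) ^ 2)⁻¹ * (γ (y (rhoIdx n)) (xPart y))⁻¹ k l *
      (pd (tIdx n) (fun z => ambMatrix γ z (xIdx j) (xIdx l)) y
        + pd (xIdx j) (fun z => ambMatrix γ z (tIdx n) (xIdx l)) y
        - pd (xIdx l) (fun z => ambMatrix γ z (tIdx n) (xIdx j)) y)
      = 2 * (y (tIdx n))⁻¹ * ((γ (y (rhoIdx n)) (xPart y))⁻¹ k l
        * γ (y (rhoIdx n)) (xPart y) l j) := by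
    intro l
    rw [hγ.pd_ambMatrix_x_x hy, pd_ambMatrix_t_x, pd_ambMatrix_t_x, hγ.pd_t_entry hy,
      (hγ.metric _ hy.2.2).symm _ hy.2.1 j l, if_pos rfl]
    field_simp
    ring
  rw [hγ.christoffel_x hy, Finset.sum_congr rfl fun l _ => e l, ← Finset.mul_sum, h]
  split_ifs <;> ring

lemma christoffel_x_t_rho (hγ : IsMetricFamily ε U γ) (hy : y ∈ ambRegion U ε)
    (k : Fin n) :
    christoffel (ambMatrix γ) (xIdx k) (tIdx n) (rhoIdx n) y = 0 := by
  simp [hγ.christoffel_x hy, pd_ambMatrix_t_x, pd_ambMatrix_rho_x, pd_ambMatrix_t_rho]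

lemma christoffel_x_x_x (hγ : IsMetricFamily ε U γ) (hy : y ∈ ambRegion U ε)
    (k i j : Fin n) :
    christoffel (ambMatrix γ) (xIdx k) (xIdx i) (xIdx j) y
      = christoffel (γ (y (rhoIdx n))) k i j (xPart y) := by
  have ht := hy.1.ne'
  rw [hγ.christoffel_x hy, christoffel]
  simp only [hγ.pd_ambMatrix_x_x hy, hγ.pd_x_entry hy]
  congr 1
  refine Finset.sum_congr rfl fun l _ => ?_
  simp
  field_simp

lemma christoffel_x_x_rho (hγ : IsMetricFamily ε U γ) (hy : y ∈ ambRegion U ε)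
    (k j : Fin n) :
    christoffel (ambMatrix γ) (xIdx k) (xIdx j) (rhoIdx n) y
      = (1 / 2) * ∑ l, (γ (y (rhoIdx n)) (xPart y))⁻¹ k l
        * rhoDeriv γ (y (rhoIdx n)) (xPart y) j l := by
  have ht := hy.1.ne'
  simp only [hγ.christoffel_x hy, hγ.pd_ambMatrix_x_x hy, hγ.pd_rho_entry hy, pd_ambMatrix_rho_x,
    pd_ambMatrix_x_rho]
  congr 1
  refine Finset.sum_congr rfl fun l _ => ?_
  simp
  field_simp

lemma christoffel_x_rho_rho (hγ : IsMetricFamily ε U γ) (hy : y ∈ ambRegion U ε)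
    (k : Fin n) :
    christoffel (ambMatrix γ) (xIdx k) (rhoIdx n) (rhoIdx n) y = 0 := by
  simp [hγ.christoffel_x hy, pd_ambMatrix_rho_x, pd_ambMatrix_rho_rho]

lemma christoffel_rho_t_t (hγ : IsMetricFamily ε U γ) (hy : y ∈ ambRegion U ε) :
    christoffel (ambMatrix γ) (rhoIdx n) (tIdx n) (tIdx n) y = 0 := by
  simp [hγ.christoffel_rho hy, pd_ambMatrix_t_t, pd_ambMatrix_t_rho]
  norm_num

lemma christoffel_rho_t_x (hγ : IsMetricFamily ε U γ) (hy : y ∈ ambRegion U ε)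
    (j : Fin n) :
    christoffel (ambMatrix γ) (rhoIdx n) (tIdx n) (xIdx j) y = 0 := by
  simp [hγ.christoffel_rho hy, pd_ambMatrix_t_t, pd_ambMatrix_t_rho, pd_ambMatrix_x_t,
    pd_ambMatrix_x_rho, pd_ambMatrix_t_x]

lemma christoffel_rho_t_rho (hγ : IsMetricFamily ε U γ) (hy : y ∈ ambRegion U ε) :
    christoffel (ambMatrix γ) (rhoIdx n) (tIdx n) (rhoIdx n) y = (y (tIdx n))⁻¹ := by
  simp [hγ.christoffel_rho hy, pd_ambMatrix_t_t, pd_ambMatrix_t_rho, pd_ambMatrix_rho_t,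
    pd_ambMatrix_rho_rho]
  ring

lemma christoffel_rho_x_x (hγ : IsMetricFamily ε U γ) (hy : y ∈ ambRegion U ε)
    (i j : Fin n) :
    christoffel (ambMatrix γ) (rhoIdx n) (xIdx i) (xIdx j) y
      = -γ (y (rhoIdx n)) (xPart y) i j
        + y (rhoIdx n) * rhoDeriv γ (y (rhoIdx n)) (xPart y) i j := by
  have ht := hy.1.ne'
  simp [hγ.christoffel_rho hy, pd_ambMatrix_x_t, pd_ambMatrix_x_rho, hγ.pd_ambMatrix_x_x hy,
    hγ.pd_t_entry hy, hγ.pd_rho_entry hy]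
  field_simp

lemma christoffel_rho_x_rho (hγ : IsMetricFamily ε U γ) (hy : y ∈ ambRegion U ε)
    (i : Fin n) :
    christoffel (ambMatrix γ) (rhoIdx n) (xIdx i) (rhoIdx n) y = 0 := by
  simp [hγ.christoffel_rho hy, pd_ambMatrix_x_t, pd_ambMatrix_x_rho, pd_ambMatrix_rho_t,
    pd_ambMatrix_rho_rho]

lemma christoffel_rho_rho_rho (hγ : IsMetricFamily ε U γ) (hy : y ∈ ambRegion U ε) :
    christoffel (ambMatrix γ) (rhoIdx n) (rhoIdx n) (rhoIdx n) y = 0 := by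
  simp [hγ.christoffel_rho hy, pd_ambMatrix_rho_t, pd_ambMatrix_rho_rho]

lemma christoffel_x_t_comm (hγ : IsMetricFamily ε U γ) (hy : y ∈ ambRegion U ε)
    (c : AmbIdx n) (i : Fin n) :
    christoffel (ambMatrix γ) c (xIdx i) (tIdx n) y
      = christoffel (ambMatrix γ) c (tIdx n) (xIdx i) y :=
  hγ.isLocalMetric.christoffel_symm hy _ _ _

lemma christoffel_rho_t_comm (hγ : IsMetricFamily ε U γ) (hy : y ∈ ambRegion U ε)
    (c : AmbIdx n) :
    christoffel (ambMatrix γ) c (rhoIdx n) (tIdx n) y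
      = christoffel (ambMatrix γ) c (tIdx n) (rhoIdx n) y :=
  hγ.isLocalMetric.christoffel_symm hy _ _ _

lemma christoffel_rho_x_comm (hγ : IsMetricFamily ε U γ) (hy : y ∈ ambRegion U ε)
    (c : AmbIdx n) (i : Fin n) :
    christoffel (ambMatrix γ) c (rhoIdx n) (xIdx i) y
      = christoffel (ambMatrix γ) c (xIdx i) (rhoIdx n) y :=
  hγ.isLocalMetric.christoffel_symm hy _ _ _

/-- All Christoffel symbols of the ambient metric, as a list of rewriting rules. -/
lemma christoffel_table (hγ : IsMetricFamily ε U γ) (hy : y ∈ ambRegion U ε) :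
    (christoffel (ambMatrix γ) (tIdx n) (tIdx n) (tIdx n) y = 0) ∧
    (∀ (i : Fin n), christoffel (ambMatrix γ) (tIdx n) (tIdx n) (xIdx i) y = 0) ∧
    (christoffel (ambMatrix γ) (tIdx n) (tIdx n) (rhoIdx n) y = 0) ∧
    (∀ (i j : Fin n), christoffel (ambMatrix γ) (tIdx n) (xIdx i) (xIdx j) y = -(1 / 2) *
      (y (tIdx n) * rhoDeriv γ (y (rhoIdx n)) (xPart y) i j)) ∧
    (∀ (i : Fin n), christoffel (ambMatrix γ) (tIdx n) (xIdx i) (rhoIdx n) y = 0) ∧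
    (christoffel (ambMatrix γ) (tIdx n) (rhoIdx n) (rhoIdx n) y = 0) ∧
    (∀ (k : Fin n), christoffel (ambMatrix γ) (xIdx k) (tIdx n) (tIdx n) y = 0) ∧
    (∀ (k j : Fin n), christoffel (ambMatrix γ) (xIdx k) (tIdx n) (xIdx j) y = if k = j
      then (y (tIdx n))⁻¹ else 0) ∧
    (∀ (k : Fin n), christoffel (ambMatrix γ) (xIdx k) (tIdx n) (rhoIdx n) y = 0) ∧
    (∀ (k i j : Fin n), christoffel (ambMatrix γ) (xIdx k) (xIdx i) (xIdx j) y =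
      christoffel (γ (y (rhoIdx n))) k i j (xPart y)) ∧
    (∀ (k j : Fin n), christoffel (ambMatrix γ) (xIdx k) (xIdx j) (rhoIdx n) y = (1 / 2) *
      ∑ l, (γ (y (rhoIdx n)) (xPart y))⁻¹ k l * rhoDeriv γ (y (rhoIdx n)) (xPart y) j l) ∧
    (∀ (k : Fin n), christoffel (ambMatrix γ) (xIdx k) (rhoIdx n) (rhoIdx n) y = 0) ∧
    (christoffel (ambMatrix γ) (rhoIdx n) (tIdx n) (tIdx n) y = 0) ∧
    (∀ (j : Fin n), christoffel (ambMatrix γ) (rhoIdx n) (tIdx n) (xIdx j) y = 0) ∧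
    (christoffel (ambMatrix γ) (rhoIdx n) (tIdx n) (rhoIdx n) y = (y (tIdx n))⁻¹) ∧
    (∀ (i j : Fin n), christoffel (ambMatrix γ) (rhoIdx n) (xIdx i) (xIdx j) y = -γ (y
      (rhoIdx n)) (xPart y) i j + y (rhoIdx n) * rhoDeriv γ (y (rhoIdx n)) (xPart y) i j) ∧
    (∀ (i : Fin n), christoffel (ambMatrix γ) (rhoIdx n) (xIdx i) (rhoIdx n) y = 0) ∧
    (christoffel (ambMatrix γ) (rhoIdx n) (rhoIdx n) (rhoIdx n) y = 0) ∧
    (∀ (c : AmbIdx n) (i : Fin n), christoffel (ambMatrix γ) c (xIdx i) (tIdx n) y =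
      christoffel (ambMatrix γ) c (tIdx n) (xIdx i) y) ∧
    (∀ (c : AmbIdx n), christoffel (ambMatrix γ) c (rhoIdx n) (tIdx n) y = christoffel
      (ambMatrix γ) c (tIdx n) (rhoIdx n) y) ∧
    (∀ (c : AmbIdx n) (i : Fin n), christoffel (ambMatrix γ) c (rhoIdx n) (xIdx i) y =
      christoffel (ambMatrix γ) c (xIdx i) (rhoIdx n) y) :=
  ⟨hγ.christoffel_t_t_t hy,
    hγ.christoffel_t_t_x hy,
    hγ.christoffel_t_t_rho hy,
    hγ.christoffel_t_x_x hy,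
    hγ.christoffel_t_x_rho hy,
    hγ.christoffel_t_rho_rho hy,
    hγ.christoffel_x_t_t hy,
    hγ.christoffel_x_t_x hy,
    hγ.christoffel_x_t_rho hy,
    hγ.christoffel_x_x_x hy,
    hγ.christoffel_x_x_rho hy,
    hγ.christoffel_x_rho_rho hy,
    hγ.christoffel_rho_t_t hy,
    hγ.christoffel_rho_t_x hy,
    hγ.christoffel_rho_t_rho hy,
    hγ.christoffel_rho_x_x hy,
    hγ.christoffel_rho_x_rho hy,
    hγ.christoffel_rho_rho_rho hy,
    hγ.christoffel_x_t_comm hy,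
    hγ.christoffel_rho_t_comm hy,
    hγ.christoffel_rho_x_comm hy⟩

end IsMetricFamily

end AmbientChristoffel

/-! ### The Ricci tensor of an ambient metric -/

section AmbientRicciComponents

variable {n : ℕ} {γ : ℝ → EuclideanSpace ℝ (Fin n) → Matrix (Fin n) (Fin n) ℝ} {ε : ℝ}
  {U : Set (EuclideanSpace ℝ (Fin n))} {y : EuclideanSpace ℝ (AmbIdx n)}

/-- Derivatives in `x` of a function of `(t, x, ρ)` that only depends on `(x, ρ)`.
Regularity of that function in `ρ` is not needed. -/
lemma pd_x_of_eventuallyEq {Φ : EuclideanSpace ℝ (AmbIdx n) → ℝ}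
    {f : ℝ → EuclideanSpace ℝ (Fin n) → ℝ} (hΦ : DifferentiableAt ℝ Φ y)
    (hf : DifferentiableAt ℝ (f (y (rhoIdx n))) (xPart y))
    (h : Φ =ᶠ[𝓝 y] fun z => f (z (rhoIdx n)) (xPart z)) (k : Fin n) :
    pd (xIdx k) Φ y = pd k (f (y (rhoIdx n))) (xPart y) := by
  rw [pd, pd, ← hΦ.lineDeriv_eq_fderiv, ← hf.lineDeriv_eq_fderiv]
  refine Filter.EventuallyEq.deriv_eq ?_
  have hc : Tendsto (fun s : ℝ => y + s • EuclideanSpace.single (xIdx k) (1 : ℝ)) (𝓝 0) (𝓝 y) := by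
    have : Continuous fun s : ℝ => y + s • EuclideanSpace.single (xIdx k) (1 : ℝ) := by fun_prop
    simpa using this.tendsto 0
  filter_upwards [hc.eventually h] with s hs
  rw [hs]
  have e1 : (y + s • EuclideanSpace.single (xIdx k) (1 : ℝ)) (rhoIdx n) = y (rhoIdx n) := by
    simp
  have e2 : xPart (y + s • EuclideanSpace.single (xIdx k) (1 : ℝ))
      = xPart y + s • EuclideanSpace.single k (1 : ℝ) := by
    ext i; simp [xPart]
  rw [e1, e2]

lemma pd_t_inv (hy : y ∈ ambRegion U ε) (c : ℝ) :
    pd (tIdx n) (fun z => c * (z (tIdx n))⁻¹) y = -c * (y (tIdx n) ^ 2)⁻¹ := by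
  have ht := hy.1.ne'
  have h : HasFDerivAt (fun z : EuclideanSpace ℝ (AmbIdx n) => z (tIdx n))
      (EuclideanSpace.proj (tIdx n) : EuclideanSpace ℝ (AmbIdx n) →L[ℝ] ℝ) y :=
    (EuclideanSpace.proj (tIdx n) : EuclideanSpace ℝ (AmbIdx n) →L[ℝ] ℝ).hasFDerivAt
  have h2 := ((hasDerivAt_inv ht).comp_hasFDerivAt y h).const_mul c
  have h3 : HasFDerivAt (fun z : EuclideanSpace ℝ (AmbIdx n) => c * (z (tIdx n))⁻¹) _ y := h2
  rw [pd, h3.fderiv]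
  simp

lemma differentiableAt_t_inv (hy : y ∈ ambRegion U ε) (c : ℝ) :
    DifferentiableAt ℝ (fun z : EuclideanSpace ℝ (AmbIdx n) => c * (z (tIdx n))⁻¹) y :=
  (differentiableAt_const c).mul
    ((differentiableAt_of_smooth (contDiffAt_coord (tIdx n))).inv hy.1.ne')

lemma pd_x_inv (hy : y ∈ ambRegion U ε) (c : ℝ) (k : Fin n) :
    pd (xIdx k) (fun z => c * (z (tIdx n))⁻¹) y = 0 := by
  rw [pd, ← (differentiableAt_t_inv hy c).lineDeriv_eq_fderiv, lineDeriv]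
  simp

lemma pd_rho_inv (hy : y ∈ ambRegion U ε) (c : ℝ) :
    pd (rhoIdx n) (fun z => c * (z (tIdx n))⁻¹) y = 0 := by
  rw [pd, ← (differentiableAt_t_inv hy c).lineDeriv_eq_fderiv, lineDeriv]
  simp

namespace IsMetricFamily

lemma contDiffAt_rhoDeriv (hγ : IsMetricFamily ε U γ) (hy : y ∈ ambRegion U ε) (i j : Fin n) :
    ContDiffAt ℝ ∞ (fun q : EuclideanSpace ℝ (Fin n) × ℝ => rhoDeriv γ q.2 q.1 i j)
      (xPart y, y (rhoIdx n)) :=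
  contDiffAt_deriv_slice (hγ.smooth _ hy.2.1 _ hy.2.2 i j)

lemma rhoDeriv_symm (hγ : IsMetricFamily ε U γ) (hy : y ∈ ambRegion U ε) (i j : Fin n) :
    rhoDeriv γ (y (rhoIdx n)) (xPart y) i j = rhoDeriv γ (y (rhoIdx n)) (xPart y) j i := by
  refine Filter.EventuallyEq.deriv_eq ?_
  filter_upwards [isOpen_Ioo.mem_nhds hy.2.2] with r hr
  exact (hγ.metric r hr).symm _ hy.2.1 i j

lemma mem_nhds (hγ : IsMetricFamily ε U γ) (hy : y ∈ ambRegion U ε) :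
    ∀ᶠ z in 𝓝 y, z ∈ ambRegion U ε :=
  (isOpen_ambRegion hγ.isOpen).mem_nhds hy

lemma differentiableAt_christoffel (hγ : IsMetricFamily ε U γ) (hy : y ∈ ambRegion U ε)
    (a b c : AmbIdx n) : DifferentiableAt ℝ (christoffel (ambMatrix γ) a b c) y :=
  differentiableAt_of_smooth (hγ.isLocalMetric.contDiffAt_christoffel hy a b c)

lemma pd_eq_zero (hγ : IsMetricFamily ε U γ) (hy : y ∈ ambRegion U ε)
    {f : EuclideanSpace ℝ (AmbIdx n) → ℝ} (hf : ∀ z ∈ ambRegion U ε, f z = 0) (a : AmbIdx n) :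
    pd a f y = 0 := by
  rw [pd_congr (g := fun _ => 0) ((hγ.mem_nhds hy).mono hf), pd_const]

lemma trace_t (hγ : IsMetricFamily ε U γ) (hy : y ∈ ambRegion U ε) :
    ∑ a, christoffel (ambMatrix γ) a a (tIdx n) y = ((n : ℝ) + 1) * (y (tIdx n))⁻¹ := by
  rw [sum_ambIdx]
  simp only [hγ.christoffel_table hy]
  simp
  ring

lemma trace_x (hγ : IsMetricFamily ε U γ) (hy : y ∈ ambRegion U ε) (j : Fin n) :
    ∑ a, christoffel (ambMatrix γ) a a (xIdx j) y
      = ∑ k, christoffel (γ (y (rhoIdx n))) k k j (xPart y) := by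
  rw [sum_ambIdx]
  simp only [hγ.christoffel_t_t_x hy, hγ.christoffel_x_x_x hy, hγ.christoffel_rho_x_comm hy,
    hγ.christoffel_rho_x_rho hy, zero_add, add_zero]

lemma trace_rho (hγ : IsMetricFamily ε U γ)
    (htr : ∀ x ∈ U, ∀ ρ ∈ Ioo (-ε) ε, ∑ k, ∑ l, (γ ρ x)⁻¹ k l * rhoDeriv γ ρ x k l = 0)
    (hy : y ∈ ambRegion U ε) :
    ∑ a, christoffel (ambMatrix γ) a a (rhoIdx n) y = 0 := by
  rw [sum_ambIdx]
  simp only [hγ.christoffel_t_t_rho hy, hγ.christoffel_x_x_rho hy, hγ.christoffel_rho_rho_rho hy,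
    add_zero, ← Finset.mul_sum, htr _ hy.2.1 _ hy.2.2, mul_zero]

lemma ricci_t_t (hγ : IsMetricFamily ε U γ) (hy : y ∈ ambRegion U ε) :
    ricci (ambMatrix γ) (tIdx n) (tIdx n) y = 0 := by
  rw [ricci_eq_trace hγ.isLocalMetric hy,
    pd_congr ((hγ.mem_nhds hy).mono fun z hz => hγ.trace_t hz),
    pd_t_inv hy]
  simp only [sum_ambIdx, hγ.pd_eq_zero hy fun z hz => hγ.christoffel_t_t_t hz,
    hγ.pd_eq_zero hy fun z hz => hγ.christoffel_x_t_t hz _,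
    hγ.pd_eq_zero hy fun z hz => hγ.christoffel_rho_t_t hz]
  simp only [hγ.christoffel_table hy]
  simp
  ring

lemma ricci_x_t (hγ : IsMetricFamily ε U γ)
    (hy : y ∈ ambRegion U ε) (j : Fin n) :
    ricci (ambMatrix γ) (xIdx j) (tIdx n) y = 0 := by
  have h1 : ∀ k, pd (xIdx k) (christoffel (ambMatrix γ) (xIdx k) (xIdx j) (tIdx n)) y = 0 := by
    intro k
    rw [pd_congr (g := fun z => (if k = j then 1 else 0) * (z (tIdx n))⁻¹)
      ((hγ.mem_nhds hy).mono fun z hz => ?_), pd_x_inv hy]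
    rw [hγ.christoffel_x_t_comm hz, hγ.christoffel_x_t_x hz]
    simp
  rw [ricci_eq_trace hγ.isLocalMetric hy,
    pd_congr ((hγ.mem_nhds hy).mono fun z hz => hγ.trace_t hz),
    pd_x_inv hy]
  simp only [sum_ambIdx (n := n) (fun k => pd k _ y), h1,
    hγ.pd_eq_zero hy fun z hz => (hγ.christoffel_x_t_comm hz _ j).trans (hγ.christoffel_t_t_x hz j),
    hγ.pd_eq_zero hy fun z hz => (hγ.christoffel_x_t_comm hz _ j).trans (hγ.christoffel_rho_t_x hz j)]
  rw [sum_ambIdx]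
  simp only [hγ.trace_x hy]
  simp only [sum_ambIdx, hγ.christoffel_table hy]
  simp [(hγ.metric _ hy.2.2).christoffel_symm hy.2.1 _ j]
  rw [Finset.mul_sum, sub_self]

lemma ricci_rho_t (hγ : IsMetricFamily ε U γ)
    (htr : ∀ x ∈ U, ∀ ρ ∈ Ioo (-ε) ε, ∑ k, ∑ l, (γ ρ x)⁻¹ k l * rhoDeriv γ ρ x k l = 0)
    (hy : y ∈ ambRegion U ε) :
    ricci (ambMatrix γ) (rhoIdx n) (tIdx n) y = 0 := by
  have h3 : pd (rhoIdx n) (christoffel (ambMatrix γ) (rhoIdx n) (rhoIdx n) (tIdx n)) y = 0 := by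
    rw [pd_congr (g := fun z => 1 * (z (tIdx n))⁻¹)
      ((hγ.mem_nhds hy).mono fun z hz => ?_), pd_rho_inv hy]
    rw [hγ.christoffel_rho_t_comm hz, hγ.christoffel_rho_t_rho hz]
    exact (one_mul _).symm
  have h4 := htr _ hy.2.1 _ hy.2.2
  rw [ricci_eq_trace hγ.isLocalMetric hy,
    pd_congr ((hγ.mem_nhds hy).mono fun z hz => hγ.trace_t hz),
    pd_rho_inv hy, sum_ambIdx (n := n) (fun k => pd k _ y), h3,
    hγ.pd_eq_zero hy fun z hz => (hγ.christoffel_rho_t_comm hz _).trans (hγ.christoffel_t_t_rho hz)]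
  simp only [
    hγ.pd_eq_zero hy fun z hz => (hγ.christoffel_rho_t_comm hz _).trans (hγ.christoffel_x_t_rho hz _)]
  rw [sum_ambIdx (fun m => _ * _)]
  simp only [hγ.trace_rho htr hy]
  simp only [sum_ambIdx, hγ.christoffel_table hy]
  simp [← Finset.mul_sum, h4]

lemma sum_inv_mul_rhoDeriv (hγ : IsMetricFamily ε U γ) (hy : y ∈ ambRegion U ε) (k j : Fin n) :
    ∑ l, (γ (y (rhoIdx n)) (xPart y))⁻¹ k l * rhoDeriv γ (y (rhoIdx n)) (xPart y) j l
      = ((γ (y (rhoIdx n)) (xPart y))⁻¹ * rhoDeriv γ (y (rhoIdx n)) (xPart y)) k j := by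
  rw [Matrix.mul_apply]
  exact Finset.sum_congr rfl fun l _ => by rw [hγ.rhoDeriv_symm hy j l]

lemma ricci_rho_rho (hγ : IsMetricFamily ε U γ)
    (htr : ∀ x ∈ U, ∀ ρ ∈ Ioo (-ε) ε, ∑ k, ∑ l, (γ ρ x)⁻¹ k l * rhoDeriv γ ρ x k l = 0)
    (hnil : ∀ x ∈ U, ∀ ρ ∈ Ioo (-ε) ε, rhoDeriv γ ρ x * (γ ρ x)⁻¹ * rhoDeriv γ ρ x = 0)
    (hy : y ∈ ambRegion U ε) :
    ricci (ambMatrix γ) (rhoIdx n) (rhoIdx n) y = 0 := by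
  have hn := hnil _ hy.2.1 _ hy.2.2
  set g := γ (y (rhoIdx n)) (xPart y)
  set g' := rhoDeriv γ (y (rhoIdx n)) (xPart y)
  have hsq : ∑ k, ∑ m, (1 / 2 * (g⁻¹ * g') m k) * (1 / 2 * (g⁻¹ * g') k m) = 0 := by
    have h0 : g⁻¹ * g' * (g⁻¹ * g') = 0 := by
      rw [Matrix.mul_assoc, ← Matrix.mul_assoc g', hn, Matrix.mul_zero]
    have h1 : ∀ k, ∑ m, (g⁻¹ * g') k m * (g⁻¹ * g') m k = 0 := fun k => by
      rw [← Matrix.mul_apply, h0, Matrix.zero_apply]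
    refine Finset.sum_eq_zero fun k _ => ?_
    rw [← mul_zero (1 / 4 : ℝ), ← h1 k, Finset.mul_sum]
    exact Finset.sum_congr rfl fun m _ => by ring
  rw [ricci_eq_trace hγ.isLocalMetric hy, hγ.pd_eq_zero hy fun z hz => hγ.trace_rho htr hz]
  simp only [sum_ambIdx, hγ.pd_eq_zero hy fun z hz => hγ.christoffel_t_rho_rho hz,
    hγ.pd_eq_zero hy fun z hz => hγ.christoffel_x_rho_rho hz _,
    hγ.pd_eq_zero hy fun z hz => hγ.christoffel_rho_rho_rho hz]
  simp only [hγ.christoffel_table hy, hγ.sum_inv_mul_rhoDeriv hy, zero_mul, mul_zero,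
    Finset.sum_const_zero, zero_add, add_zero, sub_zero]
  rw [hsq, sub_zero]

/-- The components `R_{jρ}` of the ambient Ricci tensor are half the divergence of `γ'` with respect
to `γ`, when `γ'` is trace-free. -/
lemma ricci_x_rho (hγ : IsMetricFamily ε U γ)
    (htr : ∀ x ∈ U, ∀ ρ ∈ Ioo (-ε) ε, ∑ k, ∑ l, (γ ρ x)⁻¹ k l * rhoDeriv γ ρ x k l = 0)
    (hy : y ∈ ambRegion U ε) (j : Fin n) :
    ricci (ambMatrix γ) (xIdx j) (rhoIdx n) y = (1 / 2) *
      (∑ k, pd k (fun x => ∑ l, (γ (y (rhoIdx n)) x)⁻¹ k l * rhoDeriv γ (y (rhoIdx n)) x j l)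
          (xPart y)
        + ∑ k, ∑ m, christoffel (γ (y (rhoIdx n))) k k m (xPart y)
          * ∑ l, (γ (y (rhoIdx n)) (xPart y))⁻¹ m l * rhoDeriv γ (y (rhoIdx n)) (xPart y) j l
        - ∑ k, ∑ m, christoffel (γ (y (rhoIdx n))) k j m (xPart y)
          * ∑ l, (γ (y (rhoIdx n)) (xPart y))⁻¹ m l * rhoDeriv γ (y (rhoIdx n)) (xPart y) k l)
      := by
  have hd : ∀ k, DifferentiableAt ℝ (fun x => ∑ l, (γ (y (rhoIdx n)) x)⁻¹ k l
      * rhoDeriv γ (y (rhoIdx n)) x j l) (xPart y) := fun k =>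
    differentiableAt_of_smooth (ContDiffAt.sum fun l _ =>
      ((hγ.metric _ hy.2.2).contDiffAt_inv hy.2.1 k l).mul
        (contDiffAt_slice_left (hγ.contDiffAt_rhoDeriv hy j l)))
  have h1 : ∀ k, pd (xIdx k) (christoffel (ambMatrix γ) (xIdx k) (xIdx j) (rhoIdx n)) y
      = (1 / 2) * pd k (fun x => ∑ l, (γ (y (rhoIdx n)) x)⁻¹ k l
        * rhoDeriv γ (y (rhoIdx n)) x j l) (xPart y) := by
    intro k
    rw [← pd_const_mul (hd k)]
    exact pd_x_of_eventuallyEq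
      (f := fun r x => (1 / 2) * ∑ l, (γ r x)⁻¹ k l * rhoDeriv γ r x j l)
      (hγ.differentiableAt_christoffel hy _ _ _) ((hd k).const_mul _)
      ((hγ.mem_nhds hy).mono fun z hz => hγ.christoffel_x_x_rho hz k j) k
  rw [ricci_eq_trace hγ.isLocalMetric hy, hγ.pd_eq_zero hy fun z hz => hγ.trace_rho htr hz]
  rw [sum_ambIdx (n := n) (fun k => pd k _ y), sum_ambIdx (fun m => _ * _)]
  simp only [h1, hγ.pd_eq_zero hy fun z hz => hγ.christoffel_t_x_rho hz j,
    hγ.pd_eq_zero hy fun z hz => hγ.christoffel_rho_x_rho hz j, hγ.trace_x hy]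
  simp only [sum_ambIdx, hγ.christoffel_table hy, zero_mul, mul_zero,
    Finset.sum_const_zero, zero_add, add_zero, sub_zero]
  have e1 : ∀ F : Fin n → Fin n → ℝ, ∀ c : Fin n → ℝ,
      ∑ m, 1 / 2 * c m * ∑ k, F k m = 1 / 2 * ∑ k, ∑ m, F k m * c m := by
    intro F c
    simp only [Finset.mul_sum]
    rw [Finset.sum_comm]
    exact Finset.sum_congr rfl fun _ _ => Finset.sum_congr rfl fun _ _ => by ring
  rw [e1 (fun k m => christoffel (γ (y (rhoIdx n))) k k m (xPart y))]
  have e2 : ∀ F : Fin n → Fin n → ℝ, ∀ c : Fin n → Fin n → ℝ,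
      ∑ k, ∑ m, 1 / 2 * c k m * F k m = 1 / 2 * ∑ k, ∑ m, F k m * c k m := by
    intro F c
    simp only [Finset.mul_sum]
    exact Finset.sum_congr rfl fun _ _ => Finset.sum_congr rfl fun _ _ => by ring
  rw [e2 (fun k m => christoffel (γ (y (rhoIdx n))) k j m (xPart y))
    (fun k m => ∑ l, (γ (y (rhoIdx n)) (xPart y))⁻¹ m l * rhoDeriv γ (y (rhoIdx n)) (xPart y) k l),
    ← Finset.mul_sum]
  ring

/-- The tangential components of the Ricci tensor of the ambient metric, when `γ'` is trace-free
and squares to zero. -/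
lemma ricci_x_x (hγ : IsMetricFamily ε U γ)
    (htr : ∀ x ∈ U, ∀ ρ ∈ Ioo (-ε) ε, ∑ k, ∑ l, (γ ρ x)⁻¹ k l * rhoDeriv γ ρ x k l = 0)
    (hnil : ∀ x ∈ U, ∀ ρ ∈ Ioo (-ε) ε, rhoDeriv γ ρ x * (γ ρ x)⁻¹ * rhoDeriv γ ρ x = 0)
    (hy : y ∈ ambRegion U ε) (i j : Fin n) :
    ricci (ambMatrix γ) (xIdx i) (xIdx j) y
      = y (rhoIdx n) * rhoDeriv (rhoDeriv γ) (y (rhoIdx n)) (xPart y) i j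
        - ((n : ℝ) - 2) / 2 * rhoDeriv γ (y (rhoIdx n)) (xPart y) i j
        + ricci (γ (y (rhoIdx n))) i j (xPart y) := by
  have ht := hy.1.ne'
  have hn := hnil _ hy.2.1 _ hy.2.2
  have hloc := hγ.metric _ hy.2.2
  have hinv := hloc.mul_inv hy.2.1
  have dΓ := fun a b c =>
    differentiableAt_of_smooth (hloc.contDiffAt_christoffel hy.2.1 a b c)
  have dr := differentiableAt_of_smooth (contDiffAt_coord (y := y) (rhoIdx n))
  have dt := differentiableAt_of_smooth (contDiffAt_coord (y := y) (tIdx n))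
  have sg' := contDiffAt_lift (y := y) (F := fun q => rhoDeriv γ q.2 q.1 i j)
    (hγ.contDiffAt_rhoDeriv hy i j)
  have dg' := differentiableAt_of_smooth sg'
  have dg := differentiableAt_of_smooth (hγ.contDiffAt_entry hy i j)
  have h1 : pd (tIdx n) (christoffel (ambMatrix γ) (tIdx n) (xIdx i) (xIdx j)) y
      = -(1 / 2) * rhoDeriv γ (y (rhoIdx n)) (xPart y) i j := by
    rw [pd_congr ((hγ.mem_nhds hy).mono fun z hz => hγ.christoffel_t_x_x hz i j),
      pd_const_mul (dt.fun_mul dg'), pd_mul dt dg', pd_coord,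
      pd_t_lift (F := fun q => rhoDeriv γ q.2 q.1 i j)
        (differentiableAt_of_smooth (hγ.contDiffAt_rhoDeriv hy i j))]
    simp
  have h2 : pd (rhoIdx n) (christoffel (ambMatrix γ) (rhoIdx n) (xIdx i) (xIdx j)) y
      = y (rhoIdx n) * rhoDeriv (rhoDeriv γ) (y (rhoIdx n)) (xPart y) i j := by
    have e : (fun z : EuclideanSpace ℝ (AmbIdx n) => -γ (z (rhoIdx n)) (xPart z) i j
        + z (rhoIdx n) * rhoDeriv γ (z (rhoIdx n)) (xPart z) i j)
        = fun z => z (rhoIdx n) * rhoDeriv γ (z (rhoIdx n)) (xPart z) i j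
          - γ (z (rhoIdx n)) (xPart z) i j := by
      ext z; ring
    rw [pd_congr ((hγ.mem_nhds hy).mono fun z hz => hγ.christoffel_rho_x_x hz i j), e,
      pd_sub (dr.fun_mul dg') dg, pd_mul dr dg', pd_coord, hγ.pd_rho_entry hy,
      pd_rho_lift (F := fun q => rhoDeriv γ q.2 q.1 i j)
        (differentiableAt_of_smooth (hγ.contDiffAt_rhoDeriv hy i j)), if_pos rfl, one_mul,
      add_sub_cancel_left]
    rfl
  have h3 : ∀ k, pd (xIdx k) (christoffel (ambMatrix γ) (xIdx k) (xIdx i) (xIdx j)) y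
      = pd k (christoffel (γ (y (rhoIdx n))) k i j) (xPart y) := fun k =>
    pd_x_of_eventuallyEq (f := fun r x => christoffel (γ r) k i j x)
      (hγ.differentiableAt_christoffel hy _ _ _) (dΓ k i j)
      ((hγ.mem_nhds hy).mono fun z hz => hγ.christoffel_x_x_x hz k i j) k
  have h4 : pd (xIdx i) (fun z => ∑ k, christoffel (ambMatrix γ) k k (xIdx j) z) y
      = pd i (fun x => ∑ k, christoffel (γ (y (rhoIdx n))) k k j x) (xPart y) :=
    pd_x_of_eventuallyEq (f := fun r x => ∑ k, christoffel (γ r) k k j x)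
      (DifferentiableAt.fun_sum fun k _ => hγ.differentiableAt_christoffel hy _ _ _)
      (DifferentiableAt.fun_sum fun k _ => dΓ k k j)
      ((hγ.mem_nhds hy).mono fun z hz => hγ.trace_x hz j) i
  have hsymm := hγ.rhoDeriv_symm hy
  have hsg := hloc.symm _ hy.2.1
  rw [ricci_eq_trace hγ.isLocalMetric hy, ricci_eq_trace hloc hy.2.1, h4]
  rw [sum_ambIdx (n := n) (fun k => pd k _ y), sum_ambIdx (fun m => _ * _)]
  simp only [h1, h2, h3, hγ.trace_t hy, hγ.trace_x hy, hγ.trace_rho htr hy]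
  simp only [sum_ambIdx, hγ.christoffel_table hy, hγ.sum_inv_mul_rhoDeriv hy, mul_zero,
    zero_add, add_zero]
  set g := γ (y (rhoIdx n)) (xPart y)
  set g' := rhoDeriv γ (y (rhoIdx n)) (xPart y)
  have hA : ∀ a b, ∑ x, 1 / 2 * (g⁻¹ * g') x b * (-g a x + y (rhoIdx n) * g' a x)
      = -(1 / 2) * g' a b := by
    intro a b
    have e1 : ∑ x, g a x * (g⁻¹ * g') x b = g' a b := by
      rw [← Matrix.mul_apply, ← Matrix.mul_assoc, hinv, Matrix.one_mul]
    have e2 : ∑ x, g' a x * (g⁻¹ * g') x b = 0 := by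
      rw [← Matrix.mul_apply, ← Matrix.mul_assoc, hn, Matrix.zero_apply]
    calc ∑ x, 1 / 2 * (g⁻¹ * g') x b * (-g a x + y (rhoIdx n) * g' a x)
        = ∑ x, (-(1 / 2) * (g a x * (g⁻¹ * g') x b)
          + 1 / 2 * y (rhoIdx n) * (g' a x * (g⁻¹ * g') x b)) :=
          Finset.sum_congr rfl fun _ _ => by ring
      _ = -(1 / 2) * g' a b := by
          rw [Finset.sum_add_distrib, ← Finset.mul_sum, ← Finset.mul_sum, e1, e2]
          ring
  have f1 : ∑ x, (if x = j then (y (tIdx n))⁻¹ else 0) * (-(1 / 2) * (y (tIdx n) * g' i x))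
      = -(1 / 2) * g' i j := by
    simp only [ite_mul, zero_mul, Finset.sum_ite_eq', Finset.mem_univ, if_true]
    field_simp
  have f2 : ∑ x, (-(1 / 2) * (y (tIdx n) * g' x j) * if x = i then (y (tIdx n))⁻¹ else 0)
      = -(1 / 2) * g' i j := by
    simp only [mul_ite, mul_zero, Finset.sum_ite_eq', Finset.mem_univ, if_true]
    field_simp
  have f3 : ∑ x, (-g x j + y (rhoIdx n) * g' x j) * (1 / 2 * (g⁻¹ * g') x i)
      = -(1 / 2) * g' i j := by
    rw [hsymm i j, ← hA j i]
    exact Finset.sum_congr rfl fun x _ => by rw [hsg x j, hsymm x j]; ring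
  rw [Finset.sum_add_distrib, Finset.sum_add_distrib, f1, f2, f3, hA]
  have f4 : -(1 / 2) * (y (tIdx n) * g' i j) * (((n : ℝ) + 1) * (y (tIdx n))⁻¹)
      = -(1 / 2) * ((n : ℝ) + 1) * g' i j := by
    field_simp
  rw [f4]
  ring

end IsMetricFamily

end AmbientRicciComponents

/-! ### The ambient Ricci tensor of a null Ricci Walker metric -/

section LocalWalker

variable {n : ℕ} {G : EuclideanSpace ℝ (Fin n) → Matrix (Fin n) (Fin n) ℝ} {ε : ℝ}
  {U : Set (EuclideanSpace ℝ (Fin n))} {L : EuclideanSpace ℝ (Fin n) → Submodule ℝ (Fin n → ℝ)}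
  {H : ℝ → EuclideanSpace ℝ (Fin n) → Matrix (Fin n) (Fin n) ℝ}
  {y : EuclideanSpace ℝ (AmbIdx n)} {x : EuclideanSpace ℝ (Fin n)} {ρ : ℝ}

/-- In the coordinates of a chart: a metric `G` with a null parallel field `L` of covectors that
contains the image of the Ricci tensor, and a family `H` of divergence-free tensors with values
in `L`. -/
structure IsLocalWalker (ε : ℝ) (U : Set (EuclideanSpace ℝ (Fin n)))
    (L : EuclideanSpace ℝ (Fin n) → Submodule ℝ (Fin n → ℝ))
    (G : EuclideanSpace ℝ (Fin n) → Matrix (Fin n) (Fin n) ℝ)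
    (H : ℝ → EuclideanSpace ℝ (Fin n) → Matrix (Fin n) (Fin n) ℝ) : Prop where
  metric : IsLocalMetric G U
  nullParallel : IsNullParallel G U L
  ricci_mem : ∀ x ∈ U, ∀ i, (fun j => ricci G i j x) ∈ L x
  family : IsTensorFamily ε U L H
  div : ∀ ρ ∈ Ioo (-ε) ε, ∀ x ∈ U, ∀ i, div2 G (H ρ) i x = 0

/-- The operator `walkerOperator`, written in terms of component matrices. -/
noncomputable def walkerExpr (G : EuclideanSpace ℝ (Fin n) → Matrix (Fin n) (Fin n) ℝ)
    (H : ℝ → EuclideanSpace ℝ (Fin n) → Matrix (Fin n) (Fin n) ℝ) (i j : Fin n)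
    (x : EuclideanSpace ℝ (Fin n)) (ρ : ℝ) : ℝ :=
  ρ * rhoDeriv (rhoDeriv H) ρ x i j - ((n : ℝ) - 2) / 2 * rhoDeriv H ρ x i j
    - 1 / 2 * box2 G (H ρ) i j x
    + ∑ k, ∑ l, riemann G k i j l x * raise2 G (H ρ) k l x
    + ricci G i j x
    + 1 / 2 * ((∑ k, ∑ l, raise2 G (H ρ) k l x * hess2 G (H ρ) k l i j x)
        - gradQuad G (H ρ) i j x)

lemma rhoDeriv_add (G : EuclideanSpace ℝ (Fin n) → Matrix (Fin n) (Fin n) ℝ)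
    (H : ℝ → EuclideanSpace ℝ (Fin n) → Matrix (Fin n) (Fin n) ℝ) :
    rhoDeriv (fun r x => G x + H r x) = rhoDeriv H := by
  ext ρ x i j
  simp only [rhoDeriv, Matrix.of_apply, Matrix.add_apply, deriv_const_add]

namespace IsLocalWalker

lemma metricFamily (h : IsLocalWalker ε U L G H) :
    IsMetricFamily ε U (fun ρ x => G x + H ρ x) where
  isOpen := h.metric.isOpen
  smooth x hx ρ hρ i j :=
    (ContDiffAt.comp (f := Prod.fst) (g := fun y => G y i j) (x, ρ) (h.metric.smooth x hx i j)
      contDiffAt_fst).add (h.family.smooth x hx ρ hρ i j)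
  metric _ hρ := (h.family.tensor hρ).isLocalMetric_add h.metric h.nullParallel

lemma trace_rhoDeriv (h : IsLocalWalker ε U L G H) :
    ∀ x ∈ U, ∀ ρ ∈ Ioo (-ε) ε, ∑ k, ∑ l, (G x + H ρ x)⁻¹ k l
      * rhoDeriv (fun ρ x => G x + H ρ x) ρ x k l = 0 := by
  intro x hx ρ hρ
  have hT := h.family.tensor hρ
  have hT' := h.family.rhoDeriv.tensor hρ
  have h1 := h.nullParallel.trace_eq_zero hx (hT'.mem x hx) (hT'.symm x hx)
  have h2 := h.nullParallel.trace_eq_zero_of_row_col hx (hT.mem x hx) (hT'.mem_col hx)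
  rw [← IsTensorIn.raise2_eq h.metric hx, Matrix.trace] at h2
  simp only [Matrix.diag_apply, Matrix.mul_apply, hT'.symm x hx _, Matrix.of_apply] at h2
  rw [rhoDeriv_add, hT.inv_add h.metric h.nullParallel hx]
  simp only [Matrix.sub_apply, Matrix.of_apply, sub_mul, Finset.sum_sub_distrib, h1, zero_sub,
    neg_eq_zero]
  exact h2

lemma rhoDeriv_mul_rhoDeriv (h : IsLocalWalker ε U L G H) :
    ∀ x ∈ U, ∀ ρ ∈ Ioo (-ε) ε, rhoDeriv (fun ρ x => G x + H ρ x) ρ x * (G x + H ρ x)⁻¹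
      * rhoDeriv (fun ρ x => G x + H ρ x) ρ x = 0 := by
  intro x hx ρ hρ
  have hT := h.family.tensor hρ
  have hT' := h.family.rhoDeriv.tensor hρ
  have h1 := h.nullParallel.mul_inv_mul_eq_zero hx (hT'.mem x hx) (hT'.mem_col hx)
  have h2 := h.nullParallel.mul_inv_mul_eq_zero hx (hT'.mem x hx) (hT.mem_col hx)
  rw [rhoDeriv_add, hT.inv_add h.metric h.nullParallel hx, IsTensorIn.raise2_eq h.metric hx,
    Matrix.mul_sub, Matrix.sub_mul, h1, ← Matrix.mul_assoc, ← Matrix.mul_assoc, h2]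
  simp

lemma ricci_x_x (h : IsLocalWalker ε U L G H) (hy : y ∈ ambRegion U ε) (i j : Fin n) :
    ricci (ambMatrix fun ρ x => G x + H ρ x) (xIdx i) (xIdx j) y
      = walkerExpr G H i j (xPart y) (y (rhoIdx n)) := by
  rw [h.metricFamily.ricci_x_x h.trace_rhoDeriv h.rhoDeriv_mul_rhoDeriv hy,
    (h.family.tensor hy.2.2).ricci_add_eq h.metric h.nullParallel
      (h.ricci_mem _ hy.2.1) (h.div _ hy.2.2) hy.2.1, rhoDeriv_add, walkerExpr]
  ring

lemma ricci_x_rho (h : IsLocalWalker ε U L G H) (hy : y ∈ ambRegion U ε) (j : Fin n) :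
    ricci (ambMatrix fun ρ x => G x + H ρ x) (xIdx j) (rhoIdx n) y = 0 := by
  rw [h.metricFamily.ricci_x_rho h.trace_rhoDeriv hy, rhoDeriv_add]
  have := (h.family.tensor hy.2.2).div_add (h.family.rhoDeriv.tensor hy.2.2) h.metric
    h.nullParallel (h.family.div2_rhoDeriv hy.2.1 hy.2.2 fun r hr => h.div r hr _ hy.2.1) hy.2.1 j
  rw [this, mul_zero]

/-- The ambient Ricci tensor has only tangential components, and these are given by
`walkerExpr`. -/
lemma ricci_ambMatrix (h : IsLocalWalker ε U L G H) (hy : y ∈ ambRegion U ε) (a b : AmbIdx n) :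
    ricci (ambMatrix fun ρ x => G x + H ρ x) a b y = 0 ∨
      ∃ i j, a = xIdx i ∧ b = xIdx j ∧
        ricci (ambMatrix fun ρ x => G x + H ρ x) a b y
          = walkerExpr G H i j (xPart y) (y (rhoIdx n)) := by
  have hγ := h.metricFamily
  have hs := ricci_symm hγ.isLocalMetric hy
  have htr := h.trace_rhoDeriv
  rcases a with _ | i | _ <;> rcases b with _ | j | _
  · exact Or.inl (hγ.ricci_t_t hy)
  · exact Or.inl ((hs _ _).trans (hγ.ricci_x_t hy j))
  · exact Or.inl ((hs _ _).trans (hγ.ricci_rho_t htr hy))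
  · exact Or.inl (hγ.ricci_x_t hy i)
  · exact Or.inr ⟨i, j, rfl, rfl, h.ricci_x_x hy i j⟩
  · exact Or.inl (h.ricci_x_rho hy i)
  · exact Or.inl (hγ.ricci_rho_t htr hy)
  · exact Or.inl ((hs _ _).trans (h.ricci_x_rho hy j))
  · exact Or.inl (hγ.ricci_rho_rho htr h.rhoDeriv_mul_rhoDeriv hy)

/-- The trace of the tangential part of the ambient Ricci tensor vanishes identically. -/
lemma trace_walkerExpr (h : IsLocalWalker ε U L G H) (hx : x ∈ U) (hρ : ρ ∈ Ioo (-ε) ε) :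
    ∑ i, ∑ j, (G x)⁻¹ i j * walkerExpr G H i j x ρ = 0 := by
  have hT := h.family.tensor hρ
  have hT' := h.family.rhoDeriv.tensor hρ
  have hT'' := h.family.rhoDeriv.rhoDeriv.tensor hρ
  have hL := h.nullParallel
  have t1 := hL.trace_eq_zero hx (hT''.mem x hx) (hT''.symm x hx)
  have t2 := hL.trace_eq_zero hx (hT'.mem x hx) (hT'.symm x hx)
  have t3 := hT.trace_box2 h.metric hL hx
  have t4 := hT.trace_riemann h.metric hL (h.ricci_mem x hx) hx
  have t5 := hL.trace_eq_zero hx (A := Matrix.of fun i j => ricci G i j x) (h.ricci_mem x hx)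
    (ricci_symm h.metric hx)
  have t6 := hT.trace_raise2_mul_hess2 h.metric hL hx
  have t7 := hT.trace_gradQuad hL hx
  have e : ∀ i j, (G x)⁻¹ i j * walkerExpr G H i j x ρ
      = ρ * ((G x)⁻¹ i j * rhoDeriv (rhoDeriv H) ρ x i j)
        - ((n : ℝ) - 2) / 2 * ((G x)⁻¹ i j * rhoDeriv H ρ x i j)
        - 1 / 2 * ((G x)⁻¹ i j * box2 G (H ρ) i j x)
        + (G x)⁻¹ i j * ∑ k, ∑ l, riemann G k i j l x * raise2 G (H ρ) k l x
        + (G x)⁻¹ i j * Matrix.of (fun i j => ricci G i j x) i j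
        + 1 / 2 * ((G x)⁻¹ i j * ∑ k, ∑ l, raise2 G (H ρ) k l x * hess2 G (H ρ) k l i j x)
        - 1 / 2 * ((G x)⁻¹ i j * gradQuad G (H ρ) i j x) := by
    intro i j
    rw [walkerExpr, Matrix.of_apply]
    ring
  simp only [e, Finset.sum_add_distrib, Finset.sum_sub_distrib, ← Finset.mul_sum]
  rw [t1, t2, t3, t4, t5, t6, t7]
  ring

end IsLocalWalker

/-- The scalar curvature vanishes if the image of the Schouten tensor is null, because that tensor
is then trace-free. Hence the Ricci tensor is a multiple of the Schouten tensor. -/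
lemma ricci_mem_of_schouten_mem (hn : 3 ≤ n) (hG : IsLocalMetric G U) (hL : IsNullParallel G U L)
    (hP : ∀ x ∈ U, ∀ i, (fun j => schouten G i j x) ∈ L x) (hx : x ∈ U) (i : Fin n) :
    (fun j => ricci G i j x) ∈ L x := by
  have hn' : (3 : ℝ) ≤ n := by exact_mod_cast hn
  have hsymm : ∀ i j, schouten G i j x = schouten G j i x := by
    intro i j
    rw [schouten, schouten, ricci_symm hG hx i j, hG.symm x hx i j]
  have ht := hL.trace_eq_zero hx (A := Matrix.of fun i j => schouten G i j x) (hP x hx) hsymm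
  have hGG : ∑ i, ∑ j, (G x)⁻¹ i j * G x i j = n := by
    have : ∀ i, ∑ j, (G x)⁻¹ i j * G x i j = 1 := by
      intro i
      have := hG.sum_inv_mul hx i i
      rw [if_pos rfl] at this
      rw [← this]
      exact Finset.sum_congr rfl fun j _ => by rw [hG.symm x hx i j]
    simp [this]
  set S := scalarCurv G x with hS
  have e : ∀ i j, (G x)⁻¹ i j * Matrix.of (fun i j => schouten G i j x) i j
      = (1 / ((n : ℝ) - 2)) * ((G x)⁻¹ i j * ricci G i j x
        - S / (2 * ((n : ℝ) - 1)) * ((G x)⁻¹ i j * G x i j)) := by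
    intro i j
    rw [Matrix.of_apply, schouten, Fintype.card_fin]
    ring
  simp only [e, ← Finset.mul_sum, Finset.sum_sub_distrib] at ht
  rw [hGG, show ∑ i, ∑ j, (G x)⁻¹ i j * ricci G i j x = S from rfl] at ht
  have h2 : (n : ℝ) - 2 ≠ 0 := by linarith
  have h1 : (n : ℝ) - 1 ≠ 0 := by linarith
  have hS0 : S = 0 := by
    field_simp at ht
    have h3 : S * ((n : ℝ) - 2) = 0 := by linarith
    exact (mul_eq_zero.1 h3).resolve_right h2
  have : (fun j => ricci G i j x) = ((n : ℝ) - 2) • fun j => schouten G i j x := by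
    ext j
    rw [Pi.smul_apply, schouten, ← hS, hS0, Fintype.card_fin, smul_eq_mul]
    field_simp
    ring
  rw [this]
  exact (L x).smul_mem _ (hP x hx i)

end LocalWalker

/-! ### From the manifold to charts -/

section Charts

variable {n : ℕ} {M : Type*} [TopologicalSpace M] [ChartedSpace (EuclideanSpace ℝ (Fin n)) M]
  {e : OpenPartialHomeomorph M (EuclideanSpace ℝ (Fin n))} {x : EuclideanSpace ℝ (Fin n)}

lemma chartVec_add (v w : EuclideanSpace ℝ (Fin n)) :
    chartVec e x (v + w) = chartVec e x v + chartVec e x w :=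
  (mfderiv (𝓡 n) (𝓡 n) e.symm x).map_add v w

lemma chartVec_smul (c : ℝ) (v : EuclideanSpace ℝ (Fin n)) :
    chartVec e x (c • v) = c • chartVec e x v :=
  (mfderiv (𝓡 n) (𝓡 n) e.symm x).map_smul c v

lemma chartVec_bijective [IsManifold (𝓡 n) ∞ M] (he : e ∈ smoothCharts n M) (hx : x ∈ e.target) :
    Function.Bijective (chartVec e x) := by
  have : IsManifold (𝓡 n) 1 M := IsManifold.of_le (m := 1) (n := ∞) (by simp)
  have he1 : e ∈ IsManifold.maximalAtlas (𝓡 n) 1 M :=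
    IsManifold.maximalAtlas_subset_of_le (by simp) he
  have hd : e.MDifferentiable (𝓡 n) (𝓡 n) :=
    ⟨fun y hy => (mdifferentiableAt_of_mem_maximalAtlas he1 hy).mdifferentiableWithinAt,
      fun y hy => (mdifferentiableAt_symm_of_mem_maximalAtlas he1 hy).mdifferentiableWithinAt⟩
  exact hd.symm.mfderiv_bijective hx

lemma eq_sum_single (v : EuclideanSpace ℝ (Fin n)) :
    v = ∑ i, v i • EuclideanSpace.single i (1 : ℝ) := by
  ext j
  simp [Pi.single_apply]

lemma chartVec_eq_sum (v : EuclideanSpace ℝ (Fin n)) :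
    chartVec e x v = ∑ i, v i • chartVec e x (EuclideanSpace.single i 1) := by
  conv_lhs => rw [eq_sum_single v]
  exact (map_sum (mfderiv (𝓡 n) (𝓡 n) e.symm x) _ _).trans
    (Finset.sum_congr rfl fun i _ => chartVec_smul _ _)

lemma apply_chartVec_single (T : BilinField n M) (v : EuclideanSpace ℝ (Fin n)) (j : Fin n) :
    T (e.symm x) (chartVec e x v) (chartVec e x (EuclideanSpace.single j 1))
      = ∑ i, v i * components e T x i j := by
  rw [chartVec_eq_sum v]
  simp [components]

lemma apply_chartVec (T : BilinField n M) (v w : EuclideanSpace ℝ (Fin n)) :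
    T (e.symm x) (chartVec e x v) (chartVec e x w)
      = ∑ i, ∑ j, v i * w j * components e T x i j := by
  rw [chartVec_eq_sum w, map_sum]
  simp only [map_smul, smul_eq_mul, apply_chartVec_single, Finset.mul_sum]
  rw [Finset.sum_comm]
  exact Finset.sum_congr rfl fun _ _ => Finset.sum_congr rfl fun _ _ => by ring

variable {g : BilinField n M} {N : SubspaceField n M}

lemma IsPseudoRiemannian.isLocalMetric [IsManifold (𝓡 n) ∞ M] (hg : IsPseudoRiemannian g)
    (he : e ∈ smoothCharts n M) : IsLocalMetric (components e g) e.target where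
  isOpen := e.open_target
  smooth x hx i j := (hg.smooth e he i j).contDiffAt (e.open_target.mem_nhds hx)
  symm x _ i j := hg.symm _ _ _
  det x hx hdet := by
    obtain ⟨v, hv, hv0⟩ := Matrix.exists_vecMul_eq_zero_iff.2 hdet
    have hb := chartVec_bijective he hx
    have h0 : chartVec e x (WithLp.toLp 2 v) = 0 := by
      refine hg.nondegenerate _ _ fun w => ?_
      obtain ⟨w, rfl⟩ := hb.2 w
      rw [chartVec_eq_sum w, map_sum]
      refine Finset.sum_eq_zero fun j _ => ?_
      rw [map_smul, apply_chartVec_single]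
      have : ∑ i, v i * components e g x i j = 0 := congrFun hv0 j
      simp [this]
    have h1 : chartVec e x 0 = 0 := (mfderiv (𝓡 n) (𝓡 n) e.symm x).map_zero
    have h2 := hb.1 (h0.trans h1.symm)
    exact hv (by simpa using congrArg WithLp.ofLp h2)

/-- The covectors at the point with coordinates `x` which, with the index raised by `g`, represent
elements of `N`. -/
noncomputable def chartCovectors (g : BilinField n M) (N : SubspaceField n M)
    (e : OpenPartialHomeomorph M (EuclideanSpace ℝ (Fin n))) (x : EuclideanSpace ℝ (Fin n)) :
    Submodule ℝ (Fin n → ℝ) where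
  carrier := {a | InDist N e x (WithLp.toLp 2 ((components e g x)⁻¹.mulVec a))}
  add_mem' {a b} ha hb := by
    have : WithLp.toLp 2 ((components e g x)⁻¹.mulVec (a + b))
        = WithLp.toLp 2 ((components e g x)⁻¹.mulVec a)
          + WithLp.toLp 2 ((components e g x)⁻¹.mulVec b) := by
      rw [Matrix.mulVec_add]; rfl
    simp only [mem_ofPred_eq, InDist, this, chartVec_add] at ha hb ⊢
    exact (N _).add_mem ha hb
  zero_mem' := by
    have h1 : chartVec e x 0 = 0 := (mfderiv (𝓡 n) (𝓡 n) e.symm x).map_zero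
    simp only [mem_ofPred_eq, InDist, Matrix.mulVec_zero, WithLp.toLp_zero, h1]
    exact (N _).zero_mem
  smul_mem' c a ha := by
    have : WithLp.toLp 2 ((components e g x)⁻¹.mulVec (c • a))
        = c • WithLp.toLp 2 ((components e g x)⁻¹.mulVec a) := by
      rw [Matrix.mulVec_smul]; rfl
    simp only [mem_ofPred_eq, InDist, this, chartVec_smul] at ha ⊢
    exact (N _).smul_mem c ha

lemma mem_chartCovectors {a : Fin n → ℝ} : a ∈ chartCovectors g N e x ↔
    InDist N e x (WithLp.toLp 2 ((components e g x)⁻¹.mulVec a)) := Iff.rfl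

/-- In a chart, a totally null parallel distribution gives a null parallel field of covectors. -/
lemma isNullParallel_chartCovectors [IsManifold (𝓡 n) ∞ M] (hg : IsPseudoRiemannian g)
    (hN : IsTotallyNull g N) (hp : IsParallelDist g N) (he : e ∈ smoothCharts n M) :
    IsNullParallel (components e g) e.target (chartCovectors g N e) where
  null x hx a ha b hb := by
    have hG := hg.isLocalMetric he
    have h := hN _ _ ha _ hb
    rw [apply_chartVec] at h
    rw [← h]
    set G := components e g x
    have e1 : ∑ i, ∑ j, G⁻¹.mulVec a i * G⁻¹.mulVec b j * G i j = dotProduct (G⁻¹.mulVec a) b := by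
      have hb : G.mulVec (G⁻¹.mulVec b) = b := by
        rw [Matrix.mulVec_mulVec, hG.mul_inv hx, Matrix.one_mulVec]
      conv_rhs => rw [← hb]
      refine Finset.sum_congr rfl fun i _ => ?_
      change _ = G⁻¹.mulVec a i * ∑ j, G i j * G⁻¹.mulVec b j
      rw [Finset.mul_sum]
      exact Finset.sum_congr rfl fun _ _ => by ring
    refine Eq.trans ?_ e1.symm
    simp only [dotProduct, Matrix.mulVec, Finset.sum_mul]
    rw [Finset.sum_comm]
    exact Finset.sum_congr rfl fun i _ => Finset.sum_congr rfl fun j _ => by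
      rw [hG.inv_symm hx j i]; ring
  parallel a ha hm x hx k := by
    have hG := hg.isLocalMetric he
    set V : EuclideanSpace ℝ (Fin n) → EuclideanSpace ℝ (Fin n) := fun y =>
      WithLp.toLp 2 ((components e g y)⁻¹.mulVec fun i => a i y) with hV
    have hVs : ContDiffOn ℝ ∞ V e.target := by
      rw [contDiffOn_euclidean]
      intro i y hy
      change ContDiffWithinAt ℝ ∞ (fun y => ∑ l, (components e g y)⁻¹ i l * a l y) e.target y
      exact (ContDiffAt.sum fun l _ => (hG.contDiffAt_inv hy i l).mul
        (ha l y hy)).contDiffWithinAt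
    have h := hp e he e.target e.open_target subset_rfl V hVs hm x hx k
    rw [mem_chartCovectors]
    convert h using 2
    ext i
    simp only [covVec, hV, Matrix.mulVec, dotProduct]
    rw [hG.pd_raise hx (fun b => ha b x hx) k i]
    ring

variable {ε : ℝ} {h : ℝ → BilinField n M}

/-- A tensor with image in `N` has its rows in `chartCovectors`. -/
lemma row_mem_chartCovectors [IsManifold (𝓡 n) ∞ M] (hg : IsPseudoRiemannian g)
    (he : e ∈ smoothCharts n M) (hx : x ∈ e.target) {T : BilinField n M} (hT : ImageIn g T N)
    (i : Fin n) : components e T x i ∈ chartCovectors g N e x := by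
  have hG := hg.isLocalMetric he
  obtain ⟨z, hz, hzT⟩ := hT (e.symm x) (chartVec e x (EuclideanSpace.single i 1))
  obtain ⟨ζ, rfl⟩ := (chartVec_bijective he hx).2 z
  have h1 : components e T x i = (components e g x).mulVec ζ := by
    ext j
    have := hzT (chartVec e x (EuclideanSpace.single j 1))
    rw [apply_chartVec_single] at this
    change T (e.symm x) _ _ = _
    rw [← this]
    exact Finset.sum_congr rfl fun k _ => by rw [hG.symm x hx k j, mul_comm]
  rw [mem_chartCovectors, h1, Matrix.mulVec_mulVec, hG.inv_mul hx, Matrix.one_mulVec]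
  exact hz

lemma IsNullRicciWalker.isLocalWalker [IsManifold (𝓡 n) ∞ M] (hn : 3 ≤ n)
    (hg : IsNullRicciWalker g N) (h_smooth : IsSmoothSymmFamily ε h)
    (h_image : ∀ ρ ∈ Ioo (-ε) ε, ImageIn g (h ρ) N) (h_div : ∀ ρ ∈ Ioo (-ε) ε, IsDivFree g (h ρ))
    (he : e ∈ smoothCharts n M) :
    IsLocalWalker ε e.target (chartCovectors g N e) (components e g)
      (fun ρ => components e (h ρ)) where
  metric := hg.metric.isLocalMetric he
  nullParallel := isNullParallel_chartCovectors hg.metric hg.totallyNull hg.parallel he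
  ricci_mem _ hx i := ricci_mem_of_schouten_mem hn (hg.metric.isLocalMetric he)
    (isNullParallel_chartCovectors hg.metric hg.totallyNull hg.parallel he)
    (fun x hx i => hg.schouten_image e he x hx i) hx i
  family :=
    { smooth := fun _ hx _ hρ i j => (h_smooth.smooth e he i j).contDiffAt
        ((e.open_target.prod isOpen_Ioo).mem_nhds ⟨hx, hρ⟩)
      symm := fun _ _ ρ hρ _ _ => h_smooth.symm ρ hρ _ _ _
      mem := fun _ hx ρ hρ i => row_mem_chartCovectors hg.metric he hx (h_image ρ hρ) i }
  div ρ hρ x hx i := h_div ρ hρ e he x hx i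

lemma walkerOperator_eq_walkerExpr (i j : Fin n) (ρ : ℝ) :
    walkerOperator g h e i j x ρ
      = walkerExpr (components e g) (fun ρ => components e (h ρ)) i j x ρ := by
  rw [walkerOperator, iteratedDeriv_eq_iterate]
  rfl

lemma ambient_add_eq_ambMatrix : ambient e (fun ρ x => g x + h ρ x)
    = ambMatrix (fun ρ x => components e g x + components e (h ρ) x) := rfl

end Charts

end AmbientWalker

open AmbientWalker in
theorem mainTheorem3 {n : ℕ} (hn : 3 ≤ n) {M : Type*} [TopologicalSpace M]
    [ChartedSpace (EuclideanSpace ℝ (Fin n)) M] [IsManifold (𝓡 n) ∞ M]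
    (g : AmbientWalker.BilinField n M) (N : AmbientWalker.SubspaceField n M)
    (hg : AmbientWalker.IsNullRicciWalker g N)
    (ε : ℝ) (hε : 0 < ε) (h : ℝ → AmbientWalker.BilinField n M)
    (h_smooth : AmbientWalker.IsSmoothSymmFamily ε h)
    (h_zero : ∀ x, h 0 x = 0)
    (h_image : ∀ ρ ∈ Ioo (-ε) ε, AmbientWalker.ImageIn g (h ρ) N)
    (h_div : ∀ ρ ∈ Ioo (-ε) ε, AmbientWalker.IsDivFree g (h ρ)) :
    (AmbientWalker.IsAmbientMetric ε g (fun ρ x => g x + h ρ x) ↔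
        AmbientWalker.SolvesWalkerEquation g h) ∧
      (AmbientWalker.AmbientRicciVanishes (fun ρ x => g x + h ρ x) ↔
        AmbientWalker.SolvesWalkerEquation g h) := by
  have hW := fun e (he : e ∈ smoothCharts n M) =>
    hg.isLocalWalker hn h_smooth h_image h_div he
  have h0 : (0 : ℝ) ∈ Ioo (-ε) ε := ⟨by linarith, hε⟩
  have key : AmbientRicciVanishes (fun ρ x => g x + h ρ x) ↔ SolvesWalkerEquation g h := by
    constructor
    · intro hA e he i j k hk x₀ hx₀
      -- Restrict to `t = 1`.
      set J : EuclideanSpace ℝ (Fin n) × ℝ → EuclideanSpace ℝ (AmbIdx n) := fun q =>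
        WithLp.toLp 2 (Sum.elim (fun _ => 1) (Sum.elim (fun i => q.1 i) fun _ => q.2)) with hJ
      have hJc : Continuous J := by
        refine (PiLp.continuous_toLp 2 _).comp (continuous_pi fun a => ?_)
        rcases a with _ | i | _
        · exact continuous_const
        · exact (continuous_apply i).comp ((PiLp.continuous_ofLp 2 _).comp continuous_fst)
        · exact continuous_snd
      have hO := (hA e he (xIdx i) (xIdx j) k hk (J (x₀, 0)) one_pos hx₀ rfl).comp_tendsto
        (hJc.tendsto (x₀, 0))
      refine hO.congr' ?_ EventuallyEq.rfl
      have hnear : ∀ᶠ q in 𝓝 (x₀, (0 : ℝ)), q ∈ e.target ×ˢ Ioo (-ε) ε :=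
        (e.open_target.prod isOpen_Ioo).mem_nhds ⟨hx₀, h0⟩
      filter_upwards [hnear] with q hq
      rw [walkerOperator_eq_walkerExpr]
      exact (hW e he).ricci_x_x (y := J q) ⟨one_pos, hq.1, hq.2⟩ i j
    · intro hS e he a b k hk y₀ ht hx hρ
      have hy₀ : y₀ ∈ ambRegion e.target ε := ⟨ht, hx, by rw [hρ]; exact h0⟩
      have hnear := (hW e he).metricFamily.mem_nhds hy₀
      by_cases hab : ∃ i j, a = xIdx i ∧ b = xIdx j
      · obtain ⟨i, j, rfl, rfl⟩ := hab
        have hlim : Tendsto (fun y => toXRho y) (𝓝 y₀) (𝓝 (xPart y₀, 0)) := by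
          have := toXRho.continuous.tendsto y₀
          rwa [toXRho_apply, hρ] at this
        refine ((hS e he i j k hk _ hx).comp_tendsto hlim).congr' ?_ EventuallyEq.rfl
        filter_upwards [hnear] with y hy
        rw [ambient_add_eq_ambMatrix, (hW e he).ricci_x_x hy]
        exact walkerOperator_eq_walkerExpr i j _
      · refine (Asymptotics.isBigO_zero _ _).congr' ?_ EventuallyEq.rfl
        filter_upwards [hnear] with y hy
        refine (((hW e he).ricci_ambMatrix hy a b).resolve_right ?_).symm
        rintro ⟨i, j, hi, hj, -⟩
        exact hab ⟨i, j, hi, hj⟩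
  refine ⟨⟨fun hA => key.1 hA.ricci_vanishes, fun hS => ?_⟩, key⟩
  refine ⟨⟨?_, ?_⟩, ?_, ?_, key.2 hS, ?_⟩
  · intro ρ hρ x v w
    simp only [LinearMap.add_apply, hg.metric.symm x v w, h_smooth.symm ρ hρ x v w]
  · intro e he i j q hq
    exact ((hW e he).metricFamily.smooth q.1 hq.1 q.2 hq.2 i j).contDiffWithinAt
  · intro x
    simp only [h_zero, add_zero]
  · intro e he y hy
    exact (hW e he).metricFamily.isLocalMetric.det y hy
  · intro _ e he x hx t ht
    refine tendsto_const_nhds.congr' ?_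
    have hnear : ∀ᶠ ρ in 𝓝[≠] (0 : ℝ), ρ ∈ Ioo (-ε) ε :=
      mem_nhdsWithin_of_mem_nhds (isOpen_Ioo.mem_nhds h0)
    filter_upwards [hnear] with ρ hρ
    have htrace := (hW e he).trace_walkerExpr hx hρ
    have hric := fun i j => (hW e he).ricci_x_x
      (y := WithLp.toLp 2 (Sum.elim (fun _ => t) (Sum.elim (fun i => x i) fun _ => ρ)))
      ⟨ht, hx, hρ⟩ i j
    rw [← ambient_add_eq_ambMatrix] at hric
    simp only [hric]
    exact (mul_eq_zero_of_right _ htrace).symm
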